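/- For an even integer $k\ge 4$ and an integer $m\ge 0$ let $$P_{k,m}(z)=\frac12\sum_{\substack{c,d\in\mathbb Z\\ \gcd(c,d)=1}}\frac{e^{2\pi i m\gamma z}}{(cz+d)^k},\qquad \operatorname{Im} z>0,$$ where $\gamma\in \mathrm{SL}(2,\mathbb Z)$ is any matrix with bottom row $(c,d)$. Let $$\mathcal F=\{\operatorname{Im}z>0,\ |z|>1,\ \operatorname{Re} z\in(-\tfrac12,\tfrac12]\}\cup\{|z|=1,\ \arg z\in[\tfrac\pi3,\tfrac\pi2]\},$$ $\mathcal A=\{e^{i\theta}:\theta\in[\frac\pi3,\frac\pi2]\}$, $\mathcal L_\rho=\{\frac12+it: t\ge\frac{\sqrt3}2\}$, $\mathcal L_i=\{it:t\ge1\}$. Zeros are counted with multiplicity, and a zero in $\mathcal F$ is called non-real if it does not lie on $\mathcal A\cup\mathcal L_\rho\cup\mathcal L_i$. Let $0<\alpha<\frac1{4\pi}$ and let $$\Gamma_\alpha=\Bigl\{z=x+iy\in\mathcal F:\ |z|>1,\ 2\pi\alpha y=\frac{\log|z|}{1-|z|^{-2}}\Bigr\}.$$ Put $F(t)=\frac1{4\pi}\,\frac{(\frac14+t^2)\log(\frac14+t^2)}{t\,(t^2-\frac34)}$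 for $t>\frac{\sqrt3}2$. Then there is exactly one $T=F^{-1}(\alpha)>\frac{\sqrt3}2$ with $F(T)=\alpha$, and there is a constant $C(\alpha)>0$, depending only on $\alpha$, such that the following holds whenever $k\to\infty$ through even integers and $m=m(k)\ge 0$ are integers with $m=\alpha k+o(k)$. For all large $k$ the form $P_{k,m}$ has only finitely many zeros in $\mathcal F$. For every $\varepsilon>0$, the number $N_{\Gamma_\alpha,\varepsilon}$ of non-real zeros of $P_{k,m}$ in $\mathcal F$ whose distance from $\Gamma_\alpha$ is at most $\varepsilon$ satisfies $$N_{\Gamma_\alpha,\varepsilon}>C(\alpha)k+o(k),$$ and all but at most $o(k)$ of the zeros of $P_{k,m}$ in $\mathcal F$ that lie neither on $\mathcal A$ nor on $\mathcal L_\rho$ are non-real zeros whose distance from $\Gamma_\alpha$ is at most $\varepsilon$. Moreover, the number of zeros of $P_{k,m}$ on $\mathcal L_\rho$ is equal to $$P_\rho(\alpha)\frac{k}{12}+o(k),\qquad P_\rho(\alpha)=12\left(\frac12-\frac{\alpha}{\frac14+T^2}-\frac1\pi\arctan(2T)\right).$$ The $o(k)$ terms may depend on $\alpha$, on $\varepsilon$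 and on the choice of $m$. -/

import Mathlib

open Filter Asymptotics

noncomputable section

namespace PoincareZeros

/-- The term `exp (2 π i m γ z) / (c z + d) ^ k` attached to a coprime pair `(c, d)`. The matrix
`γ` with bottom row `(c, d)` is the one with top row `(Int.gcdB c d, -Int.gcdA c d)`; it has
determinant one (`topRow_det`) and any other choice gives the same term (`term_eq`). -/
def term (k m : ℕ) (c d : ℤ) (z : ℂ) : ℂ :=
  Complex.exp (2 * Real.pi * Complex.I * m *
      (((Int.gcdB c d : ℂ) * z + ((-Int.gcdA c d : ℤ) : ℂ)) / ((c : ℂ) * z + d))) /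
    ((c : ℂ) * z + d) ^ k

/-- The Poincaré series `P_{k,m}` of the full modular group (only its values on the upper half
plane are meaningful). -/
def poincare (k m : ℕ) (z : ℂ) : ℂ :=
  (1 / 2) * ∑' p : {p : ℤ × ℤ // IsCoprime p.1 p.2}, term k m p.1.1 p.1.2 z

theorem topRow_det {c d : ℤ} (h : IsCoprime c d) :
    Int.gcdB c d * d - (-Int.gcdA c d) * c = 1 := by
  have h1 := Int.gcd_eq_gcd_ab c d
  rw [Int.isCoprime_iff_gcd_eq_one.mp h] at h1
  push_cast at h1
  linarith

theorem term_eq (k m : ℕ) {a b c d : ℤ} (h : a * d - b * c = 1) {z : ℂ} (hz : 0 < z.im) :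
    term k m c d z =
      Complex.exp (2 * Real.pi * Complex.I * m * (((a : ℂ) * z + b) / ((c : ℂ) * z + d))) /
        ((c : ℂ) * z + d) ^ k := by
  have hcop : IsCoprime c d := ⟨-b, a, by linarith⟩
  have hdet := topRow_det hcop
  set a' := Int.gcdB c d with ha'
  set b' := -Int.gcdA c d with hb'
  have hne : (c : ℂ) * z + d ≠ 0 := by
    intro h0
    have him : (c : ℝ) * z.im = 0 := by simpa using congrArg Complex.im h0
    have hc : c = 0 := by
      rcases mul_eq_zero.mp him with h1 | h1
      · exact_mod_cast h1
      · exact absurd h1 hz.ne'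
    subst hc
    have hd : d = 0 := by simpa using h0
    subst hd
    simp at h
  -- the two top rows differ by the multiple `n` of the bottom row
  set n : ℤ := a' * b - a * b' with hn
  have h1 : a' = a - n * c := by rw [hn]; linear_combination a * hdet - a' * h
  have h2 : b' = b - n * d := by rw [hn]; linear_combination b * hdet - b' * h
  have h3 : ((a' : ℂ) * z + (b' : ℤ)) / ((c : ℂ) * z + d) =
      ((a : ℂ) * z + b) / ((c : ℂ) * z + d) - n := by
    rw [h1, h2]
    push_cast
    field_simp
    ring
  unfold term
  rw [← ha', ← hb', h3]
  congr 1
  rw [Complex.exp_eq_exp_iff_exists_int]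
  exact ⟨-(m * n), by push_cast; ring⟩

/-- The fundamental domain of the full modular group. -/
def fundDomain : Set ℂ :=
  {z | 0 < z.im ∧ 1 < ‖z‖ ∧ z.re ∈ Set.Ioc (-(1 / 2) : ℝ) (1 / 2)} ∪
    {z | 0 < z.im ∧ ‖z‖ = 1 ∧ z.arg ∈ Set.Icc (Real.pi / 3) (Real.pi / 2)}

/-- The arc `𝒜`. -/
def arc : Set ℂ :=
  {z | ∃ θ ∈ Set.Icc (Real.pi / 3) (Real.pi / 2), z = Complex.exp (θ * Complex.I)}

/-- The half line `1/2 + i t`, `t ≥ √3/2`. -/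
def lineRho : Set ℂ :=
  {z | ∃ t : ℝ, √3 / 2 ≤ t ∧ z = 1 / 2 + t * Complex.I}

/-- The half line `i t`, `t ≥ 1`. -/
def lineI : Set ℂ :=
  {z | ∃ t : ℝ, 1 ≤ t ∧ z = t * Complex.I}

/-- The curve `Γ_α`. -/
def curve (α : ℝ) : Set ℂ :=
  {z | z ∈ fundDomain ∧ 1 < ‖z‖ ∧
    2 * Real.pi * α * z.im = Real.log ‖z‖ / (1 - ‖z‖ ^ (-2 : ℤ))}

/-- The points of the fundamental domain off the three segments (a zero there is called non-real)
whose Euclidean distance to `Γ_α` is at most `ε`. -/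
def nearCurve (α ε : ℝ) : Set ℂ :=
  {z | z ∈ fundDomain \ (arc ∪ lineRho ∪ lineI) ∧
    Metric.infEDist z (curve α) ≤ ENNReal.ofReal ε}

/-- The number of zeros of `f` in `S`, counted with multiplicity. It is meaningful when `f` is
analytic around `S` and has only finitely many zeros in `S`. -/
def zeroCount (f : ℂ → ℂ) (S : Set ℂ) : ℕ :=
  ∑ᶠ z ∈ S, analyticOrderNatAt f z

/-- `F(t) = (1/(4π)) · (1/4 + t²) log (1/4 + t²) / (t (t² - 3/4))`. -/
def heightFun (t : ℝ) : ℝ :=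
  1 / (4 * Real.pi) * ((1 / 4 + t ^ 2) * Real.log (1 / 4 + t ^ 2) / (t * (t ^ 2 - 3 / 4)))

/-- `P_ρ(α) = 12 (1/2 - α / (1/4 + T²) - arctan (2 T) / π)`, to be used with `T = F⁻¹(α)`. -/
def rhoProportion (α T : ℝ) : ℝ :=
  12 * (1 / 2 - α / (1 / 4 + T ^ 2) - 1 / Real.pi * Real.arctan (2 * T))

end PoincareZeros

end

/-!
The form `P_{k,m}` is a cusp form of weight `k`, so by the valence formula it has at most `k / 12`
zeros in the fundamental domain, counted with suitable weights. It therefore suffices to exhibit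
`k / 12 - o(k)` zeros, each of them on the arc, near `Γ_α` or on the line through `ρ`.

Since `α < 1 / (4π)`, the terms of the bottom rows `(0, 1)`, `(1, 0)` and, close to `Re z = 1 / 2`,
also `(1, -1)`, dominate the series. On the arc, the first two terms are conjugate up to a common
phase, and the sign changes of the resulting cosine give `(1 / 12 - α) k` zeros. On the line
`Re z = 1 / 2` above height `T` the last two terms beat the first one and are conjugate to each
other, which gives `P_ρ(α) k / 12` zeros. Elsewhere the first two terms are in competition: their
quotient is close to `exp (k φ)` with `φ = phase α`, and `Γ_α` is the level set `Re φ = 0`. The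
number of solutions of `exp (k φ) = -1` near `Γ_α` is then about `k / (2π)` times the variation of
`Im φ` along `Γ_α`. The three proportions add up to `1 / 12`.
-/

namespace PoincareZeros

open UpperHalfPlane ModularGroup Matrix.SpecialLinearGroup
open scoped MatrixGroups Modular Topology

/-! ### Poincaré series as cusp forms -/

section Terms

/-- The coprime pairs `(c, d)`: the bottom rows of `SL(2, ℤ)`, which index the Poincaré series.
The norm of a pair is `max |c| |d|`. -/
abbrev CoprimePair : Type := {p : ℤ × ℤ // IsCoprime p.1 p.2}

theorem isCoprime_bottom_row (γ : SL(2, ℤ)) : IsCoprime (γ 1 0) (γ 1 1) :=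
  ModularGroup.bottom_row_coprime γ

theorem mul_add_ne_zero_of_isCoprime {c d : ℤ} (h : IsCoprime c d) {z : ℂ} (hz : 0 < z.im) :
    (c : ℂ) * z + d ≠ 0 := by
  have hcd : ![(c : ℝ), (d : ℝ)] ≠ 0 := fun h0 => by
    have hc : c = 0 := by simpa using congrFun h0 0
    have hd : d = 0 := by simpa using congrFun h0 1
    exact not_isCoprime_zero_zero (hc ▸ hd ▸ h)
  simpa using linear_ne_zero ⟨z, hz⟩ hcd

theorem smul_im_eq (γ : SL(2, ℤ)) (τ : ℍ) :
    (γ • τ).im = τ.im / ‖(γ 1 0 : ℂ) * τ + γ 1 1‖ ^ 2 := by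
  rw [ModularGroup.im_smul_eq_div_normSq, ModularGroup.denom_apply, Complex.normSq_eq_norm_sq]

theorem term_bottom_row (k m : ℕ) (γ : SL(2, ℤ)) (τ : ℍ) :
    term k m (γ 1 0) (γ 1 1) τ =
      Complex.exp (2 * Real.pi * Complex.I * m * ((γ • τ : ℍ) : ℂ)) /
        ((γ 1 0 : ℂ) * τ + γ 1 1) ^ k := by
  have hdet : γ 0 0 * γ 1 1 - γ 0 1 * γ 1 0 = 1 := by
    rw [← Matrix.det_fin_two, γ.det_coe]
  rw [term_eq k m hdet τ.im_pos, specialLinearGroup_apply]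
  simp

theorem norm_term (k m : ℕ) {c d : ℤ} (h : IsCoprime c d) {z : ℂ} (hz : 0 < z.im) :
    ‖term k m c d z‖ =
      Real.exp (-(2 * Real.pi * m * (z.im / ‖(c : ℂ) * z + d‖ ^ 2))) /
        ‖(c : ℂ) * z + d‖ ^ k := by
  obtain ⟨γ, rfl, rfl⟩ := h.exists_SL2_row 1
  lift z to ℍ using hz
  have him : ((γ • z : ℍ) : ℂ).im = z.im / ‖(γ 1 0 : ℂ) * z + γ 1 1‖ ^ 2 := smul_im_eq γ z
  rw [term_bottom_row, norm_div, norm_pow, Complex.norm_exp, coe_im, ← him]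
  simp

theorem norm_term_le (k m : ℕ) {c d : ℤ} (h : IsCoprime c d) {z : ℂ} (hz : 0 < z.im) :
    ‖term k m c d z‖ ≤ 1 / ‖(c : ℂ) * z + d‖ ^ k := by
  rw [norm_term k m h hz]
  gcongr
  rw [Real.exp_le_one_iff, Left.neg_nonpos_iff]
  positivity

theorem term_neg {k : ℕ} (hk : Even k) (m : ℕ) {c d : ℤ} (h : IsCoprime c d) {z : ℂ}
    (hz : 0 < z.im) : term k m (-c) (-d) z = term k m c d z := by
  obtain ⟨γ, rfl, rfl⟩ := h.exists_SL2_row 1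
  lift z to ℍ using hz
  have hneg := term_bottom_row k m (-γ) z
  rw [ModularGroup.SL_neg_smul, coe_neg, Matrix.neg_apply, Matrix.neg_apply] at hneg
  rw [hneg, term_bottom_row]
  push_cast
  rw [neg_mul, ← neg_add, hk.neg_pow]

theorem differentiableAt_term (k m : ℕ) {c d : ℤ} (h : IsCoprime c d) {z : ℂ} (hz : 0 < z.im) :
    DifferentiableAt ℂ (term k m c d) z := by
  have hne := mul_add_ne_zero_of_isCoprime h hz
  have hden : DifferentiableAt ℂ (fun z : ℂ => (c : ℂ) * z + d) z := by fun_prop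
  unfold term
  refine DifferentiableAt.div ?_ (hden.pow k) (pow_ne_zero _ hne)
  refine DifferentiableAt.cexp (DifferentiableAt.const_mul (DifferentiableAt.div ?_ hden hne) _)
  fun_prop

end Terms

section Convergence

theorem norm_vec_eq_norm_pair (c d : ℤ) : ‖![c, d]‖ = ‖(c, d)‖ := by
  simp [EisensteinSeries.norm_eq_max_natAbs, Prod.norm_def, Int.norm_eq_abs, Nat.cast_natAbs]

theorem exists_mul_norm_le_norm_mul_add (A : ℝ) {B : ℝ} (hB : 0 < B) :
    ∃ r > 0, ∀ z : ℂ, |z.re| ≤ A → B ≤ z.im → ∀ c d : ℤ,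
      r * ‖(c, d)‖ ≤ ‖(c : ℂ) * z + d‖ := by
  refine ⟨EisensteinSeries.r ⟨⟨A, B⟩, hB⟩, EisensteinSeries.r_pos _, fun z hre him c d => ?_⟩
  rcases eq_or_ne ![c, d] 0 with hcd | hcd
  · rw [← norm_vec_eq_norm_pair, hcd]
    simp
  · have hr := EisensteinSeries.r_mul_max_le ⟨z, hB.trans_le him⟩ hcd
    rw [← norm_vec_eq_norm_pair]
    refine le_trans ?_ (by simpa using hr)
    exact mul_le_mul_of_nonneg_right
      (EisensteinSeries.r_lower_bound_on_verticalStrip ⟨z, hB.trans_le him⟩ hB ⟨hre, him⟩)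
      (norm_nonneg _)

theorem one_le_norm_of_isCoprime {c d : ℤ} (h : IsCoprime c d) : 1 ≤ ‖(c, d)‖ := by
  rw [Prod.norm_mk, Int.norm_eq_abs, Int.norm_eq_abs, le_max_iff]
  by_contra! hlt
  norm_cast at hlt
  rw [Int.abs_lt_one_iff, Int.abs_lt_one_iff] at hlt
  exact not_isCoprime_zero_zero (hlt.1 ▸ hlt.2 ▸ h)

theorem summable_one_div_norm_pow {s : ℕ} (hs : 3 ≤ s) :
    Summable fun p : CoprimePair => 1 / ‖(p : ℤ × ℤ)‖ ^ s := by
  have h := EisensteinSeries.summable_one_div_norm_rpow (k := s) (by exact_mod_cast hs)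
  rw [← (finTwoArrowEquiv ℤ).symm.summable_iff] at h
  refine (h.subtype {p : ℤ × ℤ | IsCoprime p.1 p.2}).congr fun p => ?_
  rw [Function.comp, Function.comp, finTwoArrowEquiv_symm_apply, norm_vec_eq_norm_pair,
    Real.rpow_neg (norm_nonneg _), Real.rpow_natCast, one_div]

theorem norm_term_le_of_mul_norm_le (k m : ℕ) {r : ℝ} (hr : 0 < r) {z : ℂ} (hz : 0 < z.im)
    (p : CoprimePair) (hrz : r * ‖(p : ℤ × ℤ)‖ ≤ ‖(p.1.1 : ℂ) * z + p.1.2‖) :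
    ‖term k m p.1.1 p.1.2 z‖ ≤ 1 / r ^ k * (1 / ‖(p : ℤ × ℤ)‖ ^ k) := by
  have hp := one_le_norm_of_isCoprime p.2
  refine (norm_term_le k m p.2 hz).trans ?_
  rw [one_div_mul_one_div, ← mul_pow]
  gcongr

theorem summable_term {k : ℕ} (hk : 3 ≤ k) (m : ℕ) {z : ℂ} (hz : 0 < z.im) :
    Summable fun p : CoprimePair => term k m p.1.1 p.1.2 z := by
  obtain ⟨r, hr, hrz⟩ := exists_mul_norm_le_norm_mul_add |z.re| hz
  exact Summable.of_norm_bounded ((summable_one_div_norm_pow hk).mul_left (1 / r ^ k))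
    fun p => norm_term_le_of_mul_norm_le k m hr hz p (hrz z le_rfl le_rfl _ _)

theorem differentiableOn_poincare {k : ℕ} (hk : 3 ≤ k) (m : ℕ) :
    DifferentiableOn ℂ (poincare k m) {z : ℂ | 0 < z.im} := by
  intro z hz
  obtain ⟨r, hr, hrw⟩ := exists_mul_norm_le_norm_mul_add (|z.re| + 1) (half_pos hz)
  set U : Set ℂ := {w : ℂ | |w.re| < |z.re| + 1 ∧ z.im / 2 < w.im}
  have hU : IsOpen U :=
    (isOpen_lt Complex.continuous_re.abs continuous_const).inter
      (isOpen_lt continuous_const Complex.continuous_im)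
  have hzU : z ∈ U := ⟨by linarith, by simpa using hz⟩
  have hUpos : ∀ w ∈ U, 0 < w.im := fun w hw => (half_pos hz).trans hw.2
  have hsum := Complex.differentiableOn_tsum_of_summable_norm
    ((summable_one_div_norm_pow hk).mul_left (1 / r ^ k))
    (F := fun (p : CoprimePair) w => term k m p.1.1 p.1.2 w)
    (fun p w hw => (differentiableAt_term k m p.2 (hUpos w hw)).differentiableWithinAt) hU
    fun p w hw =>
      norm_term_le_of_mul_norm_le k m hr (hUpos w hw) p (hrw w hw.1.le hw.2.le _ _)
  exact ((hsum.differentiableAt (hU.mem_nhds hzU)).const_mul (1 / 2)).differentiableWithinAt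

theorem continuousAt_poincare {k : ℕ} (hk : 3 ≤ k) (m : ℕ) {z : ℂ} (hz : 0 < z.im) :
    ContinuousAt (poincare k m) z :=
  (differentiableOn_poincare hk m).continuousOn.continuousAt
    (isOpen_upperHalfPlaneSet.mem_nhds hz)

end Convergence

section Modularity

open scoped ModularForm

/-- Right multiplication of the rows `(c, d)` by `γ`. -/
def mulRightEquiv (γ : SL(2, ℤ)) : CoprimePair ≃ CoprimePair :=
  have hdet : γ 0 0 * γ 1 1 - γ 0 1 * γ 1 0 = 1 := by
    rw [← Matrix.det_fin_two, γ.det_coe]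
  { toFun p := ⟨(p.1.1 * γ 0 0 + p.1.2 * γ 1 0, p.1.1 * γ 0 1 + p.1.2 * γ 1 1), by
      obtain ⟨u, v, huv⟩ := p.2
      exact ⟨u * γ 1 1 - v * γ 0 1, v * γ 0 0 - u * γ 1 0, by
        linear_combination huv + (u * p.1.1 + v * p.1.2) * hdet⟩⟩
    invFun p := ⟨(p.1.1 * γ 1 1 - p.1.2 * γ 1 0, p.1.2 * γ 0 0 - p.1.1 * γ 0 1), by
      obtain ⟨u, v, huv⟩ := p.2
      exact ⟨u * γ 0 0 + v * γ 0 1, u * γ 1 0 + v * γ 1 1, by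
        linear_combination huv + (u * p.1.1 + v * p.1.2) * hdet⟩⟩
    left_inv p := by
      ext
      · linear_combination p.1.1 * hdet
      · linear_combination p.1.2 * hdet
    right_inv p := by
      ext
      · linear_combination p.1.1 * hdet
      · linear_combination p.1.2 * hdet }

theorem term_smul (k m : ℕ) (γ : SL(2, ℤ)) (τ : ℍ) (p : CoprimePair) :
    term k m p.1.1 p.1.2 ((γ • τ : ℍ) : ℂ) =
      ((γ 1 0 : ℂ) * τ + γ 1 1) ^ k *
        term k m (mulRightEquiv γ p).1.1 (mulRightEquiv γ p).1.2 τ := by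
  obtain ⟨⟨c, d⟩, hp⟩ := p
  obtain ⟨g, rfl, rfl⟩ := IsCoprime.exists_SL2_row hp 1
  have hγ := mul_add_ne_zero_of_isCoprime (isCoprime_bottom_row γ) τ.im_pos
  have hrow : ∀ i, (g * γ) 1 i = g 1 0 * γ 0 i + g 1 1 * γ 1 i := fun i => by
    rw [coe_mul, Matrix.mul_apply, Fin.sum_univ_two]
  have hcocycle : ((g 1 0 : ℂ) * (γ • τ : ℍ) + g 1 1) * ((γ 1 0 : ℂ) * τ + γ 1 1) =
      ((g * γ) 1 0 : ℂ) * τ + (g * γ) 1 1 := by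
    rw [specialLinearGroup_apply, hrow, hrow]
    simp only [algebraMap_int_eq, Int.coe_castRingHom, Complex.ofReal_intCast]
    rw [add_mul, mul_assoc, div_mul_cancel₀ _ hγ]
    push_cast
    ring
  have hterm := term_bottom_row k m (g * γ) τ
  rw [← hcocycle, hrow, hrow, mul_pow, mul_smul] at hterm
  change _ = _ * term k m (g 1 0 * γ 0 0 + g 1 1 * γ 1 0) (g 1 0 * γ 0 1 + g 1 1 * γ 1 1) τ
  rw [hterm, term_bottom_row]
  field_simp

theorem poincare_smul (k m : ℕ) (γ : SL(2, ℤ)) (τ : ℍ) :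
    poincare k m ((γ • τ : ℍ) : ℂ) = ((γ 1 0 : ℂ) * τ + γ 1 1) ^ k * poincare k m τ := by
  unfold poincare
  rw [tsum_congr (term_smul k m γ τ), tsum_mul_left,
    (mulRightEquiv γ).tsum_eq (fun p : CoprimePair => term k m p.1.1 p.1.2 (τ : ℂ))]
  ring

theorem tendsto_term_atImInfty {k m : ℕ} (hk : k ≠ 0) (hm : m ≠ 0) (p : CoprimePair) :
    Tendsto (fun τ : ℍ => term k m p.1.1 p.1.2 τ) atImInfty (𝓝 0) := by
  rw [tendsto_zero_iff_norm_tendsto_zero]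
  obtain ⟨⟨c, d⟩, hcd⟩ := p
  have him : Tendsto UpperHalfPlane.im atImInfty atTop := tendsto_comap
  rcases eq_or_ne c 0 with rfl | hc
  · have hd : |(d : ℝ)| = 1 := by
      exact_mod_cast Int.isUnit_iff_abs_eq.mp (isCoprime_zero_left.mp hcd)
    have hlin : Tendsto (fun τ : ℍ => 2 * Real.pi * m * τ.im) atImInfty atTop :=
      him.const_mul_atTop (by positivity)
    refine (Real.tendsto_exp_neg_atTop_nhds_zero.comp hlin).congr fun τ => ?_
    rw [norm_term k m hcd τ.im_pos]
    simp [hd]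
  · refine squeeze_zero (fun _ => norm_nonneg _) (fun τ => ?_)
      ((tendsto_inv_atTop_zero.comp ((tendsto_pow_atTop hk).comp him)))
    have hle : τ.im ≤ ‖(c : ℂ) * τ + d‖ :=
      calc τ.im ≤ |(c : ℝ)| * τ.im :=
            le_mul_of_one_le_left τ.im_pos.le (by exact_mod_cast Int.one_le_abs hc)
        _ = |((c : ℂ) * τ + d).im| := by simp [abs_mul, abs_of_pos τ.im_pos]
        _ ≤ _ := Complex.abs_im_le_norm _
    refine (norm_term_le k m hcd τ.im_pos).trans ?_
    rw [Function.comp, Function.comp, ← one_div]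
    have := τ.im_pos
    gcongr

theorem isZeroAtImInfty_poincare {k m : ℕ} (hk : 3 ≤ k) (hm : m ≠ 0) :
    IsZeroAtImInfty fun τ : ℍ => poincare k m τ := by
  obtain ⟨r, hr, hrz⟩ := exists_mul_norm_le_norm_mul_add (1 / 2) one_pos
  set S : Set ℍ := {τ | |τ.re| ≤ 1 / 2 ∧ 1 ≤ τ.im}
  have hstrip : Tendsto (fun τ : ℍ => poincare k m τ) (atImInfty ⊓ 𝓟 S) (𝓝 0) := by
    have h := tendsto_tsum_of_dominated_convergence
      ((summable_one_div_norm_pow hk).mul_left (1 / r ^ k))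
      (fun p => (tendsto_term_atImInfty (by omega : k ≠ 0) hm p).mono_left
        (inf_le_left (b := 𝓟 S)))
      (eventually_inf_principal.mpr (.of_forall fun τ hτ p =>
        norm_term_le_of_mul_norm_le k m hr τ.im_pos p (hrz τ hτ.1 hτ.2 _ _)))
    rw [tsum_zero] at h
    simpa only [mul_zero] using! h.const_mul (1 / 2)
  rw [isZeroAtImInfty_iff]
  intro ε hε
  have hev := (tendsto_zero_iff_norm_tendsto_zero.mp hstrip).eventually_le_const hε
  obtain ⟨A, hA⟩ := atImInfty_mem _ |>.mp (eventually_inf_principal.mp hev)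
  refine ⟨max A 1, fun τ hτ => ?_⟩
  set τ' : ℍ := ModularGroup.T ^ (-round τ.re) • τ
  have him : τ'.im = τ.im := ModularGroup.im_T_zpow_smul τ _
  have hre : |τ'.re| ≤ 1 / 2 := by
    rw [ModularGroup.re_T_zpow_smul, Int.cast_neg, ← sub_eq_add_neg]
    exact abs_sub_round _
  have hP : poincare k m τ' = poincare k m τ := by
    rw [poincare_smul, ModularGroup.coe_T_zpow]
    simp
  rw [← hP]
  exact hA τ' (him ▸ (le_max_left _ _).trans hτ) ⟨hre, him ▸ (le_max_right _ _).trans hτ⟩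

/-- The Poincaré series as a level one cusp form, through which the theory of cusp forms applies
to its zeros. -/
noncomputable def poincareForm {k m : ℕ} (hk : 3 ≤ k) (hm : m ≠ 0) : CuspForm 𝒮ℒ k :=
  have hslash (γ : SL(2, ℤ)) :
      (fun τ : ℍ => poincare k m τ) ∣[(k : ℤ)] γ = fun τ : ℍ => poincare k m τ := by
    ext τ
    have hne := mul_add_ne_zero_of_isCoprime (isCoprime_bottom_row γ) τ.im_pos
    rw [ModularForm.SL_slash_apply, poincare_smul, ModularGroup.denom_apply, zpow_neg,
      zpow_natCast]
    field_simp
  { toFun τ := poincare k m τ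
    slash_action_eq' := by
      rintro _ ⟨γ, rfl⟩
      exact hslash γ
    holo' := by
      rw [UpperHalfPlane.mdifferentiable_iff]
      exact (differentiableOn_poincare hk m).congr fun z hz => by
        simp [ofComplex_apply_of_im_pos hz]
    zero_at_cusps' hc := by
      rw [OnePoint.isZeroAt_iff_forall_SL2Z hc]
      intro γ _
      rw [hslash γ]
      exact isZeroAtImInfty_poincare hk hm }

end Modularity

section Reflection

/-- The involution `(c, d) ↦ (-c, d)`, which the reflection `z ↦ -z̄` induces on the terms. -/
def negLeftEquiv : CoprimePair ≃ CoprimePair where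
  toFun p := ⟨(-p.1.1, p.1.2), p.2.neg_left⟩
  invFun p := ⟨(-p.1.1, p.1.2), p.2.neg_left⟩
  left_inv p := by ext <;> simp
  right_inv p := by ext <;> simp

theorem term_neg_conj (k m : ℕ) {z : ℂ} (hz : 0 < z.im) (p : CoprimePair) :
    term k m p.1.1 p.1.2 (-starRingEnd ℂ z) =
      starRingEnd ℂ (term k m (negLeftEquiv p).1.1 (negLeftEquiv p).1.2 z) := by
  obtain ⟨⟨c, d⟩, hp⟩ := p
  have hdet := topRow_det hp
  change term k m c d _ = starRingEnd ℂ (term k m (-c) d z)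
  have hz' : 0 < (-starRingEnd ℂ z).im := by simpa using hz
  set a := Int.gcdB c d
  set b := -Int.gcdA c d
  rw [term_eq k m hdet hz', term_eq k m (a := a) (b := -b) (by linarith) hz, map_div₀, map_pow,
    ← Complex.exp_conj]
  congr 2
  · simp only [map_mul, map_div₀, map_add, map_ofNat, Complex.conj_ofReal, Complex.conj_I,
      map_natCast, map_intCast, Int.cast_neg, map_neg]
    rw [show (a : ℂ) * -starRingEnd ℂ z + b = -(a * starRingEnd ℂ z + -b) by ring,
      show (c : ℂ) * -starRingEnd ℂ z + d = -c * starRingEnd ℂ z + d by ring]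
    ring
  · simp

theorem poincare_neg_conj (k m : ℕ) {z : ℂ} (hz : 0 < z.im) :
    poincare k m (-starRingEnd ℂ z) = starRingEnd ℂ (poincare k m z) := by
  unfold poincare
  rw [tsum_congr (term_neg_conj k m hz), map_mul, Complex.conj_tsum,
    negLeftEquiv.tsum_eq (fun p : CoprimePair => starRingEnd ℂ (term k m p.1.1 p.1.2 z))]
  simp [map_ofNat]

end Reflection

/-! ### Counting bottom rows by height -/

section LatticeCount

open MeasureTheory

/-- The height `Im z / |c z + d|²`. For a coprime pair it is the imaginary part of the image of
`z` under a matrix with bottom row `(c, d)`; at `(0, 0)` it is `0`. -/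
noncomputable def rowHeight (z : ℂ) (p : ℤ × ℤ) : ℝ :=
  z.im / ‖(p.1 : ℂ) * z + p.2‖ ^ 2

theorem finite_setOf_le_rowHeight {z : ℂ} (hz : 0 < z.im) {s : ℝ} (hs : 0 < s) :
    {p : ℤ × ℤ | s ≤ rowHeight z p}.Finite := by
  obtain ⟨r, hr, hrz⟩ := exists_mul_norm_le_norm_mul_add |z.re| hz
  refine (isCompact_closedBall (0 : ℤ × ℤ) (√(z.im / s) / r)).finite_of_discrete.subset
    fun p hp => ?_
  have hp0 : 0 < ‖(p.1 : ℂ) * z + p.2‖ := by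
    by_contra! h
    exact hs.not_ge (by simpa [rowHeight, h.antisymm (norm_nonneg _)] using hp)
  have hnorm : ‖(p.1 : ℂ) * z + p.2‖ ≤ √(z.im / s) := by
    refine Real.le_sqrt_of_sq_le ?_
    rw [Set.mem_ofPred_eq, rowHeight, le_div_comm₀ hs (by positivity)] at hp
    exact hp
  rw [mem_closedBall_zero_iff, le_div_iff₀' hr]
  exact (hrz z le_rfl le_rfl p.1 p.2).trans hnorm

/-- The periods `τ` and `1`. -/
noncomputable def periodPair (τ : ℍ) : PeriodPair where
  ω₁ := τ
  ω₂ := 1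
  indep := by
    rw [LinearIndependent.pair_iff]
    intro s t h
    have him := congrArg Complex.im h
    have hs : s = 0 := by simpa [τ.im_ne_zero] using him
    subst hs
    exact ⟨rfl, by simpa using h⟩

theorem covolume_lattice_periodPair (τ : ℍ) :
    ZLattice.covolume (periodPair τ).lattice = τ.im := by
  have hvol : volume.real (ZSpan.fundamentalDomain Complex.orthonormalBasisOneI.toBasis) = 1 := by
    rw [measureReal_congr (ZSpan.fundamentalDomain_ae_parallelepiped _ volume), measureReal_def,
      OrthonormalBasis.coe_toBasis, OrthonormalBasis.volume_parallelepiped, ENNReal.toReal_one]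
  rw [ZLattice.covolume_eq_det_mul_measureReal _ _ (periodPair τ).latticeBasis
    Complex.orthonormalBasisOneI.toBasis, hvol, mul_one, Module.Basis.det_apply,
    Matrix.det_fin_two]
  simp only [Complex.toBasis_orthonormalBasisOneI, Module.Basis.toMatrix_apply, Function.comp,
    PeriodPair.latticeBasis_zero, PeriodPair.latticeBasis_one]
  simp [periodPair, abs_of_pos τ.im_pos]

theorem card_normSq_le_eq (τ : ℍ) (x : ℝ) :
    Nat.card {p : ℤ × ℤ | ‖(p.1 : ℂ) * τ + p.2‖ ^ 2 ≤ x} =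
      Nat.card ({z : ℂ | ‖z‖ ^ 2 ≤ x} ∩ (periodPair τ).lattice : Set ℂ) := by
  have hcoe : ∀ p : ℤ × ℤ,
      (((periodPair τ).latticeEquivProd.symm p : (periodPair τ).lattice) : ℂ) =
        (p.1 : ℂ) * τ + p.2 := fun p => by
    rw [PeriodPair.latticeEquiv_symm_apply, periodPair, mul_one]
  rw [← Nat.card_image_of_injective
    (Subtype.val_injective.comp (periodPair τ).latticeEquivProd.symm.injective)]
  congr 2
  ext z
  constructor
  · rintro ⟨p, hp, rfl⟩
    exact ⟨by simpa [hcoe] using hp, Subtype.prop _⟩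
  · rintro ⟨hz, hL⟩
    refine ⟨(periodPair τ).latticeEquivProd ⟨z, hL⟩, ?_, by simp⟩
    rw [Set.mem_ofPred_eq, ← hcoe, LinearEquiv.symm_apply_apply]
    exact hz

theorem tendsto_card_normSq_le_div (τ : ℍ) :
    Tendsto (fun x : ℝ => (Nat.card {p : ℤ × ℤ | ‖(p.1 : ℂ) * τ + p.2‖ ^ 2 ≤ x} : ℝ) / x) atTop
      (𝓝 (Real.pi / τ.im)) := by
  have hball : {z ∈ (Set.univ : Set ℂ) | ‖z‖ ^ 2 ≤ 1} = Metric.closedBall 0 1 := by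
    ext z
    simp
  have h := ZLattice.covolume.tendsto_card_le_div' (periodPair τ).lattice (X := Set.univ)
    (F := fun z : ℂ => ‖z‖ ^ 2) (fun _ _ _ _ => Set.mem_univ _)
    (fun z r hr => by simp [abs_of_nonneg hr, mul_pow])
    (hball ▸ Metric.isBounded_closedBall) (hball ▸ Metric.isClosed_closedBall.measurableSet)
    (hball ▸ (convex_closedBall 0 1).addHaar_frontier volume)
  rw [hball, covolume_lattice_periodPair, measureReal_def, Complex.volume_closedBall] at h
  simpa only [card_normSq_le_eq, Set.mem_univ, true_and, ENNReal.ofReal_one, one_pow, one_mul,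
    ENNReal.coe_toReal, NNReal.coe_real_pi] using h

theorem card_le_rowHeight (τ : ℍ) {s : ℝ} (hs : 0 < s) :
    Nat.card {p : ℤ × ℤ | ‖(p.1 : ℂ) * τ + p.2‖ ^ 2 ≤ τ.im / s} =
      Nat.card {p : ℤ × ℤ | s ≤ rowHeight τ p} + 1 := by
  have hinsert : {p : ℤ × ℤ | ‖(p.1 : ℂ) * τ + p.2‖ ^ 2 ≤ τ.im / s} =
      insert 0 {p : ℤ × ℤ | s ≤ rowHeight τ p} := by
    ext p
    rcases eq_or_ne p 0 with rfl | hp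
    · simpa using div_nonneg τ.im_pos.le hs.le
    · have hcd : ![(p.1 : ℝ), (p.2 : ℝ)] ≠ 0 := fun h0 => hp <| Prod.ext
        (by simpa using congrFun h0 0) (by simpa using congrFun h0 1)
      have hne : (p.1 : ℂ) * τ + p.2 ≠ 0 := by simpa using linear_ne_zero τ hcd
      simp only [Set.mem_ofPred_eq, Set.mem_insert_iff, hp, false_or, rowHeight, coe_im]
      exact le_div_comm₀ (by positivity) hs
  rw [hinsert, Nat.card_coe_set_eq, Nat.card_coe_set_eq, Set.ncard_insert_of_notMem _
    (finite_setOf_le_rowHeight τ.im_pos hs)]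
  simpa [rowHeight] using hs

theorem tendsto_mul_card_le_rowHeight (τ : ℍ) :
    Tendsto (fun s : ℝ => s * Nat.card {p : ℤ × ℤ | s ≤ rowHeight τ p}) (𝓝[>] 0)
      (𝓝 Real.pi) := by
  have hdiv : Tendsto (fun s : ℝ => τ.im / s) (𝓝[>] 0) atTop :=
    tendsto_inv_nhdsGT_zero.const_mul_atTop τ.im_pos
  have hlim := (((tendsto_card_normSq_le_div τ).comp hdiv).const_mul τ.im).sub
    (tendsto_nhdsWithin_of_tendsto_nhds (tendsto_id (x := 𝓝 (0 : ℝ))))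
  rw [mul_div_cancel₀ _ τ.im_ne_zero, sub_zero] at hlim
  refine hlim.congr' ?_
  filter_upwards [self_mem_nhdsWithin] with s hs
  rw [Function.comp, card_le_rowHeight τ hs, id]
  have := τ.im_ne_zero
  have := (Set.mem_Ioi.mp hs).ne'
  field_simp
  push_cast
  ring

theorem intervalIntegrable_indicator_Iic (a y s : ℝ) :
    IntervalIntegrable ((Set.Iic a).indicator fun _ => (1 : ℝ)) volume y s := by
  rw [intervalIntegrable_iff]
  exact (integrableOn_const (by simp)).indicator measurableSet_Iic

theorem integral_indicator_Iic_le {a y s : ℝ} (hys : y ≤ s) :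
    ∫ t in y..s, (Set.Iic a).indicator (fun _ => (1 : ℝ)) t ≤ max (a - y) 0 := by
  rw [intervalIntegral.integral_of_le hys, integral_indicator measurableSet_Iic,
    integral_const, smul_eq_mul, mul_one, measureReal_restrict_apply MeasurableSet.univ,
    Set.univ_inter, measureReal_restrict_apply measurableSet_Iic]
  have hsub : Set.Iic a ∩ Set.Ioc y s ⊆ Set.Ioc y a := fun t ht => ⟨ht.2.1, ht.1⟩
  refine (measureReal_mono hsub (by simp)).trans ?_
  simp [measureReal_def, ENNReal.toReal_ofReal']

theorem integral_card_le_le_sum {ι : Type*} (E : Finset ι) (w : ι → ℝ) {y s : ℝ} (hys : y ≤ s) :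
    ∫ t in y..s, (∑ i ∈ E, (Set.Iic (w i)).indicator (fun _ => (1 : ℝ)) t) ≤
      ∑ i ∈ E, max (w i - y) 0 := by
  rw [intervalIntegral.integral_finsetSum fun i _ => intervalIntegrable_indicator_Iic _ _ _]
  exact Finset.sum_le_sum fun i _ => integral_indicator_Iic_le hys

theorem exists_mul_log_le_sum_rowHeight (τ : ℍ) {a : ℝ} (ha : a < Real.pi) :
    ∃ B s₀ : ℝ, 0 < s₀ ∧ ∀ y, 0 < y → y ≤ s₀ → ∃ E : Finset (ℤ × ℤ),
      a * Real.log (1 / y) - B ≤ ∑ p ∈ E, max (rowHeight τ p - y) 0 := by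
  obtain ⟨s₀, hs₀, hcount⟩ := mem_nhdsGT_iff_exists_Ioc_subset.mp
    ((tendsto_mul_card_le_rowHeight τ).eventually_const_le ha)
  refine ⟨a * Real.log (1 / s₀), s₀, hs₀, fun y hy hys => ?_⟩
  have hfin : {p : ℤ × ℤ | y ≤ rowHeight τ p}.Finite := finite_setOf_le_rowHeight τ.im_pos hy
  refine ⟨hfin.toFinset, ?_⟩
  have hpoint : ∀ t ∈ Set.Icc y s₀, a * t⁻¹ ≤
      ∑ p ∈ hfin.toFinset, (Set.Iic (rowHeight τ p)).indicator (fun _ => (1 : ℝ)) t := by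
    intro t ht
    have ht0 : 0 < t := hy.trans_le ht.1
    have hcard : Nat.card {p : ℤ × ℤ | t ≤ rowHeight τ p} =
        (hfin.toFinset.filter fun p => t ≤ rowHeight τ p).card := by
      rw [Nat.card_coe_set_eq, ← Set.ncard_coe_finset]
      congr 1
      ext p
      simpa using ht.1.trans
    have h : a ≤ t * Nat.card {p : ℤ × ℤ | t ≤ rowHeight τ p} := hcount ⟨ht0, ht.2⟩
    rw [← div_eq_mul_inv, div_le_iff₀' ht0]
    simpa [Set.indicator_apply, hcard] using h
  have hinv : IntervalIntegrable (fun t : ℝ => a * t⁻¹) volume y s₀ := by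
    refine (intervalIntegral.intervalIntegrable_inv (fun t ht => ?_) continuousOn_id).const_mul _
    rw [Set.uIcc_of_le hys] at ht
    exact (hy.trans_le ht.1).ne'
  have hstep := IntervalIntegrable.sum hfin.toFinset fun p _ =>
    intervalIntegrable_indicator_Iic (rowHeight τ p) y s₀
  rw [Finset.sum_fn] at hstep
  calc a * Real.log (1 / y) - a * Real.log (1 / s₀) = ∫ t in y..s₀, a * t⁻¹ := by
        rw [intervalIntegral.integral_const_mul, integral_inv_of_pos hy hs₀,
          Real.log_div hs₀.ne' hy.ne', one_div, one_div, Real.log_inv, Real.log_inv]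
        ring
    _ ≤ _ := intervalIntegral.integral_mono_on hys hinv hstep hpoint
    _ ≤ _ := integral_card_le_le_sum _ _ hys

end LatticeCount

/-! ### The valence inequality for cusp forms -/

section Jensen

variable {g : ℂ → ℂ} {R M : ℝ}

theorem circleAverage_log_norm_le_log (hg : AnalyticOnNhd ℂ g (Metric.sphere 0 |R|)) (hM : 1 ≤ M)
    (hb : ∀ q ∈ Metric.sphere 0 |R|, ‖g q‖ ≤ M) :
    Real.circleAverage (Real.log ‖g ·‖) 0 R ≤ Real.log M := by
  refine Real.circleAverage_mono_on_of_le_circle hg.meromorphicOn.circleIntegrable_log_norm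
    fun q hq => ?_
  rcases eq_or_ne (g q) 0 with h0 | h0
  · rw [h0, norm_zero, Real.log_zero]
    exact Real.log_nonneg hM
  · exact Real.log_le_log (norm_pos_iff.mpr h0) (hb q hq)

theorem divisor_mul_log_nonneg (hR : 0 < R) (hg : AnalyticOnNhd ℂ g (Metric.closedBall 0 |R|))
    (u : ℂ) :
    0 ≤ MeromorphicOn.divisor g (Metric.closedBall 0 |R|) u * Real.log (R * ‖0 - u‖⁻¹) := by
  by_cases hu : u ∈ Metric.closedBall 0 |R|
  · rw [mem_closedBall_zero_iff, abs_of_pos hR] at hu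
    refine mul_nonneg (mod_cast MeromorphicOn.AnalyticOnNhd.divisor_nonneg hg u) ?_
    rcases eq_or_ne u 0 with rfl | hu0
    · simp
    · rw [zero_sub, norm_neg, ← div_eq_mul_inv]
      exact Real.log_nonneg ((one_le_div (norm_pos_iff.mpr hu0)).mpr hu)
  · rw [Function.locallyFinsuppWithin.apply_eq_zero_of_notMem _ hu, Int.cast_zero, zero_mul]

theorem divisor_apply_eq_analyticOrderNatAt (hg : AnalyticOnNhd ℂ g (Metric.closedBall 0 |R|))
    {u : ℂ} (hu : u ∈ Metric.closedBall 0 |R|) :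
    (MeromorphicOn.divisor g (Metric.closedBall 0 |R|) u : ℝ) = analyticOrderNatAt g u := by
  rw [MeromorphicOn.AnalyticOnNhd.divisor_apply hg hu, analyticOrderNatAt]
  cases analyticOrderAt g u <;> simp

theorem sum_analyticOrderNatAt_mul_log_le (hR : 0 < R)
    (hg : AnalyticOnNhd ℂ g (Metric.closedBall 0 |R|)) (hM : 1 ≤ M)
    (hb : ∀ q ∈ Metric.sphere 0 |R|, ‖g q‖ ≤ M) {Q : Finset ℂ} (hQ : ∀ u ∈ Q, ‖u‖ ≤ R) :
    ∑ u ∈ Q, analyticOrderNatAt g u * Real.log (R / ‖u‖) ≤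
      Real.log M - analyticOrderNatAt g 0 * Real.log R -
        Real.log ‖meromorphicTrailingCoeffAt g 0‖ := by
  have hmem {u : ℂ} (hu : ‖u‖ ≤ R) : u ∈ Metric.closedBall (0 : ℂ) |R| := by
    rwa [mem_closedBall_zero_iff, abs_of_pos hR]
  have hJensen := hg.meromorphicOn.circleAverage_log_norm hR.ne'
  rw [divisor_apply_eq_analyticOrderNatAt hg (hmem (norm_zero.trans_le hR.le))] at hJensen
  have hM := circleAverage_log_norm_le_log (hg.mono Metric.sphere_subset_closedBall) hM hb
  have hfin := (MeromorphicOn.divisor g (Metric.closedBall 0 |R|)).finiteSupport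
    (isCompact_closedBall 0 |R|)
  have hsum : ∑ u ∈ Q, analyticOrderNatAt g u * Real.log (R / ‖u‖) ≤
      ∑ᶠ u, MeromorphicOn.divisor g (Metric.closedBall 0 |R|) u * Real.log (R * ‖0 - u‖⁻¹) := by
    classical
    rw [finsum_eq_sum_of_support_subset (s := Q ∪ hfin.toFinset) _ fun u hu => ?_]
    · refine (Finset.sum_congr rfl fun u hu => ?_).trans_le
        (Finset.sum_le_sum_of_subset_of_nonneg Finset.subset_union_left
          fun u _ _ => divisor_mul_log_nonneg hR hg u)
      rw [divisor_apply_eq_analyticOrderNatAt hg (hmem (hQ u hu)), zero_sub, norm_neg,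
        div_eq_mul_inv]
    · rw [Finset.coe_union, Set.Finite.coe_toFinset]
      exact Or.inr fun h0 => hu (by simp only [h0, Int.cast_zero, zero_mul])
  linarith

end Jensen

section CuspForm

variable {k : ℤ} (f : CuspForm 𝒮ℒ k)

theorem cuspForm_apply_smul (γ : SL(2, ℤ)) (τ : ℍ) :
    f (γ • τ) = (γ 1 0 * τ + γ 1 1 : ℂ) ^ k * f τ := by
  have hγ : Matrix.SpecialLinearGroup.mapGL ℝ γ ∈ 𝒮ℒ := ⟨γ, rfl⟩
  simpa [ModularGroup.sl_moeb] using! SlashInvariantForm.slash_action_eqn' f hγ τ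

theorem analyticOnNhd_cuspFunction :
    AnalyticOnNhd ℂ (cuspFunction 1 f) (Metric.ball 0 1) :=
  DifferentiableOn.analyticOnNhd (fun _ hq =>
    (ModularFormClass.differentiableAt_cuspFunction f one_pos one_mem_strictPeriods_SL
      (mem_ball_zero_iff.mp hq)).differentiableWithinAt) Metric.isOpen_ball

theorem analyticAt_comp_ofComplex (τ : ℍ) : AnalyticAt ℂ (f ∘ ofComplex) τ :=
  (UpperHalfPlane.mdifferentiable_iff.mp (ModularFormClass.holo f)).analyticOnNhd
    isOpen_upperHalfPlaneSet τ τ.im_pos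

theorem analyticOrderAt_cuspFunction (τ : ℍ) :
    analyticOrderAt (cuspFunction 1 f) (Function.Periodic.qParam 1 τ) =
      analyticOrderAt (f ∘ ofComplex) τ := by
  have hder : deriv (Function.Periodic.qParam 1) τ ≠ 0 := by
    have h : HasDerivAt (Function.Periodic.qParam 1)
        (Complex.exp (2 * Real.pi * Complex.I * τ / (1 : ℝ)) *
          (2 * Real.pi * Complex.I * 1 / (1 : ℝ))) τ :=
      (((hasDerivAt_id _).const_mul (2 * Real.pi * Complex.I)).div_const ((1 : ℝ) : ℂ)).cexp
    rw [h.deriv]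
    simp [Real.pi_ne_zero, Complex.exp_ne_zero]
  rw [← analyticOrderAt_comp_of_deriv_ne_zero
    (Function.Periodic.differentiable_qParam.analyticAt _) hder]
  congr 1
  ext z
  exact Function.Periodic.eq_cuspFunction one_ne_zero
    (SlashInvariantFormClass.periodic_comp_ofComplex f one_mem_strictPeriods_SL) z

theorem hasDerivAt_moebius (γ : SL(2, ℤ)) (τ : ℍ) :
    HasDerivAt (fun z : ℂ => (γ 0 0 * z + γ 0 1) / (γ 1 0 * z + γ 1 1))
      (1 / (γ 1 0 * τ + γ 1 1) ^ 2) τ := by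
  have hne := mul_add_ne_zero_of_isCoprime (isCoprime_bottom_row γ) τ.im_pos
  have hdet : (γ 0 0 : ℂ) * γ 1 1 - γ 0 1 * γ 1 0 = 1 := by
    exact_mod_cast (Matrix.det_fin_two _).symm.trans γ.det_coe
  have hlin (a b : ℂ) : HasDerivAt (fun z : ℂ => a * z + b) a τ := by
    simpa using ((hasDerivAt_id (τ : ℂ)).const_mul a).add_const b
  refine ((hlin _ _).div (hlin _ _) hne).congr_deriv ?_
  congr 1
  linear_combination hdet

theorem analyticOrderAt_smul (γ : SL(2, ℤ)) (τ : ℍ) :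
    analyticOrderAt (f ∘ ofComplex) (γ • τ : ℍ) = analyticOrderAt (f ∘ ofComplex) τ := by
  set G : ℂ → ℂ := fun z => (γ 0 0 * z + γ 0 1) / (γ 1 0 * z + γ 1 1)
  have hG (σ : ℍ) : ((γ • σ : ℍ) : ℂ) = G σ := by
    rw [coe_specialLinearGroup_apply]; simp [G]
  have hne := mul_add_ne_zero_of_isCoprime (isCoprime_bottom_row γ) τ.im_pos
  have hden : AnalyticAt ℂ (fun z : ℂ => (γ 1 0 * z + γ 1 1 : ℂ)) τ := by fun_prop
  have hGa : AnalyticAt ℂ G τ := AnalyticAt.div (by fun_prop) hden hne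
  have hder : deriv G τ ≠ 0 := by
    rw [(hasDerivAt_moebius γ τ).deriv]
    exact div_ne_zero one_ne_zero (pow_ne_zero _ hne)
  have hpow : AnalyticAt ℂ (fun z : ℂ => (γ 1 0 * z + γ 1 1 : ℂ) ^ k) τ := hden.zpow hne
  have hcomp : (f ∘ ofComplex) ∘ G =ᶠ[𝓝 (τ : ℂ)]
      (fun z => (γ 1 0 * z + γ 1 1 : ℂ) ^ k) * (f ∘ ofComplex) := by
    filter_upwards [isOpen_upperHalfPlaneSet.mem_nhds τ.im_pos] with z hz
    lift z to ℍ using hz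
    simp only [Function.comp_apply, Pi.mul_apply, ← hG, ofComplex_apply, cuspForm_apply_smul]
  rw [hG, ← analyticOrderAt_comp_of_deriv_ne_zero hGa hder, analyticOrderAt_congr hcomp,
    analyticOrderAt_mul hpow (analyticAt_comp_ofComplex f τ),
    hpow.analyticOrderAt_eq_zero.mpr (zpow_ne_zero _ hne), zero_add]

theorem exists_norm_cuspFunction_le : ∃ C : ℝ, ∀ y : ℝ, 0 < y → ∀ q : ℂ,
    ‖q‖ = Real.exp (-(2 * Real.pi * y)) → ‖cuspFunction 1 f q‖ ≤ C / y ^ (k / 2 : ℝ) := by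
  obtain ⟨C, hC⟩ := CuspFormClass.exists_bound f
  refine ⟨C, fun y hy q hq => ?_⟩
  have hq0 : q ≠ 0 := norm_pos_iff.mp (hq ▸ Real.exp_pos _)
  set z := Function.Periodic.invQParam 1 q
  have hz : z.im = y := by
    rw [Function.Periodic.im_invQParam, hq, Real.log_exp]
    field
  have hf := hC ⟨z, hz ▸ hy⟩
  rw [← Function.Periodic.qParam_right_inv one_ne_zero hq0]
  rw [← ofComplex_apply_of_im_pos (hz ▸ hy)] at hf
  refine (congrArg norm (Function.Periodic.eq_cuspFunction one_ne_zero
    (SlashInvariantFormClass.periodic_comp_ofComplex f one_mem_strictPeriods_SL) z)).trans_le ?_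
  simpa only [ofComplex_apply_of_im_pos (hz ▸ hy), Function.comp_apply, UpperHalfPlane.im,
    UpperHalfPlane.coe_mk, hz] using hf

theorem exists_sum_cuspFunction_le_of_le_one (hk : 0 ≤ k) :
    ∃ B : ℝ, 0 ≤ B ∧ ∀ y : ℝ, 0 < y → y ≤ 1 → ∀ Q : Finset ℂ, (∀ u ∈ Q, u ≠ 0) →
      ∑ u ∈ Q, analyticOrderNatAt (cuspFunction 1 f) u *
        max (-Real.log ‖u‖ - 2 * Real.pi * y) 0 ≤ k / 2 * Real.log (1 / y) + B := by
  obtain ⟨C, hC⟩ := exists_norm_cuspFunction_le f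
  set g := cuspFunction 1 f
  set M := max C 1
  have hM : 1 ≤ M := le_max_right _ _
  refine ⟨Real.log M + analyticOrderNatAt g 0 * (2 * Real.pi) +
    |Real.log ‖meromorphicTrailingCoeffAt g 0‖|, ?_, fun y hy hy1 Q hQ => ?_⟩
  · have := Real.log_nonneg hM
    positivity
  set R := Real.exp (-(2 * Real.pi * y)) with hRdef
  have hR : 0 < R := Real.exp_pos _
  have hR1 : R < 1 := Real.exp_lt_one_iff.mpr (by rw [neg_lt_zero]; positivity)
  have hyk : y ^ (k / 2 : ℝ) ≤ 1 := Real.rpow_le_one hy.le hy1 (by positivity)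
  have hbound : ∀ q ∈ Metric.sphere (0 : ℂ) |R|, ‖g q‖ ≤ M / y ^ (k / 2 : ℝ) := fun q hq => by
    rw [mem_sphere_zero_iff_norm, abs_of_pos hR] at hq
    refine (hC y hy q hq).trans ?_
    gcongr
    exact le_max_left _ _
  have hJensen := sum_analyticOrderNatAt_mul_log_le hR ((analyticOnNhd_cuspFunction f).mono
    (Metric.closedBall_subset_ball (by rwa [abs_of_pos hR])))
    ((one_le_div (by positivity)).mpr (hyk.trans hM)) hbound
    (Q := {u ∈ Q | ‖u‖ ≤ R}) fun u hu => (Finset.mem_filter.mp hu).2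
  have hsum : ∑ u ∈ Q, analyticOrderNatAt g u * max (-Real.log ‖u‖ - 2 * Real.pi * y) 0 =
      ∑ u ∈ Q with ‖u‖ ≤ R, analyticOrderNatAt g u * Real.log (R / ‖u‖) := by
    rw [Finset.sum_filter]
    refine Finset.sum_congr rfl fun u hu => ?_
    have hu0 := norm_pos_iff.mpr (hQ u hu)
    rw [Real.log_div hR.ne' hu0.ne', Real.log_exp]
    simp only [hRdef, ← Real.log_le_iff_le_exp hu0]
    split_ifs with hle
    · rw [max_eq_left (by linarith), neg_sub_left, neg_sub_left, add_comm]
    · rw [max_eq_right (by linarith), mul_zero]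
  rw [Real.log_div (by positivity) (by positivity), Real.log_rpow hy, Real.log_exp] at hJensen
  have hy2 : analyticOrderNatAt g 0 * (2 * Real.pi * y) ≤ analyticOrderNatAt g 0 * (2 * Real.pi) :=
    mul_le_mul_of_nonneg_left (mul_le_of_le_one_right (by positivity) hy1) (Nat.cast_nonneg _)
  rw [hsum, one_div, Real.log_inv]
  linarith [neg_abs_le (Real.log ‖meromorphicTrailingCoeffAt g 0‖)]

theorem exists_sum_cuspFunction_le (hk : 0 ≤ k) :
    ∃ B : ℝ, 0 ≤ B ∧ ∀ y : ℝ, 0 < y → ∀ Q : Finset ℂ, (∀ u ∈ Q, u ≠ 0) →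
      ∑ u ∈ Q, analyticOrderNatAt (cuspFunction 1 f) u *
        max (-Real.log ‖u‖ - 2 * Real.pi * y) 0 ≤ k / 2 * max (Real.log (1 / y)) 0 + B := by
  obtain ⟨B, hB, h⟩ := exists_sum_cuspFunction_le_of_le_one f hk
  refine ⟨B, hB, fun y hy Q hQ => ?_⟩
  rcases le_total y 1 with hy1 | hy1
  · refine (h y hy hy1 Q hQ).trans ?_
    gcongr
    exact le_max_left _ _
  · refine (Finset.sum_le_sum fun u _ => ?_).trans ((h 1 one_pos le_rfl Q hQ).trans ?_)
    · gcongr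
    · rw [div_one, Real.log_one, mul_zero]
      gcongr
      positivity

end CuspForm

section Orbits

open ModularGroup

theorem exists_T_zpow_smul_of_qParam_eq {τ σ : ℍ}
    (h : Function.Periodic.qParam 1 τ = Function.Periodic.qParam 1 σ) :
    ∃ n : ℤ, T ^ n • σ = τ := by
  obtain ⟨n, hn⟩ := Complex.exp_eq_exp_iff_exists_int.mp h
  refine ⟨n, UpperHalfPlane.ext ?_⟩
  have h2 : 2 * Real.pi * Complex.I ≠ 0 := Complex.two_pi_I_ne_zero
  rw [modular_T_zpow_smul, coe_vadd]
  refine mul_left_cancel₀ h2 ?_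
  push_cast at hn ⊢
  linear_combination -hn

theorem card_filter_qParam_smul_le {C : Finset SL(2, ℤ)}
    (hC : Set.InjOn (fun γ : SL(2, ℤ) => γ 1) C) (τ : ℍ)
    [Finite (MulAction.stabilizer SL(2, ℤ) τ)] (q : ℂ) :
    Finset.card {γ ∈ C | Function.Periodic.qParam 1 (γ • τ : ℍ) = q} ≤
      Nat.card (MulAction.stabilizer SL(2, ℤ) τ) := by
  rcases Finset.eq_empty_or_nonempty {γ ∈ C | Function.Periodic.qParam 1 (γ • τ : ℍ) = q}
    with h0 | ⟨γ₀, hγ₀⟩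
  · exact (Finset.card_eq_zero.mpr h0).trans_le (Nat.zero_le _)
  rw [Finset.mem_filter] at hγ₀
  have hex (γ : {γ ∈ C | Function.Periodic.qParam 1 (γ • τ : ℍ) = q}) :
      ∃ g : MulAction.stabilizer SL(2, ℤ) τ, (γ₀ * g : SL(2, ℤ)) 1 = γ.1 1 := by
    obtain ⟨n, hn⟩ := exists_T_zpow_smul_of_qParam_eq
      (hγ₀.2.trans (Finset.mem_filter.mp γ.2).2.symm)
    refine ⟨⟨γ₀⁻¹ * (T ^ n * γ.1), ?_⟩, ?_⟩
    · rw [MulAction.mem_stabilizer_iff, mul_smul, mul_smul, hn, inv_smul_smul]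
    · rw [mul_inv_cancel_left, T_pow_mul_apply_one]
  choose g hg using hex
  rw [← Fintype.card_coe, ← Nat.card_eq_fintype_card]
  refine Nat.card_le_card_of_injective g fun γ δ h => Subtype.ext ?_
  exact hC (Finset.mem_filter.mp γ.2).1 (Finset.mem_filter.mp δ.2).1 ((hg γ).symm.trans (h ▸ hg δ))

/-- The order of vanishing of `f` at `τ`, divided by the order of the stabilizer of `τ` in
`SL(2, ℤ)`. In this normalization the valence formula bounds the sum of the weights by `k / 24`. -/
noncomputable def zeroWeight (f : ℍ → ℂ) (τ : ℍ) : ℝ :=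
  analyticOrderNatAt (f ∘ ofComplex) τ / Nat.card (MulAction.stabilizer SL(2, ℤ) τ)

theorem zeroWeight_nonneg (f : ℍ → ℂ) (τ : ℍ) : 0 ≤ zeroWeight f τ := by
  unfold zeroWeight
  positivity

variable {k : ℤ} (f : CuspForm 𝒮ℒ k)

theorem analyticOrderNatAt_cuspFunction_smul (γ : SL(2, ℤ)) (τ : ℍ) :
    analyticOrderNatAt (cuspFunction 1 f) (Function.Periodic.qParam 1 (γ • τ : ℍ)) =
      analyticOrderNatAt (f ∘ ofComplex) τ :=
  congrArg ENat.toNat ((analyticOrderAt_cuspFunction f _).trans (analyticOrderAt_smul f γ τ))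

theorem zeroWeight_mul_sum_le {C : Finset SL(2, ℤ)} (hC : Set.InjOn (fun γ : SL(2, ℤ) => γ 1) C)
    (τ : ℍ) (y : ℝ) :
    2 * Real.pi * (zeroWeight f τ * ∑ γ ∈ C, max ((γ • τ).im - y) 0) ≤
      ∑ u ∈ C.image fun γ : SL(2, ℤ) => Function.Periodic.qParam 1 (γ • τ : ℍ),
        analyticOrderNatAt (cuspFunction 1 f) u * max (-Real.log ‖u‖ - 2 * Real.pi * y) 0 := by
  set F : ℂ → ℝ := fun u =>
    analyticOrderNatAt (cuspFunction 1 f) u * max (-Real.log ‖u‖ - 2 * Real.pi * y) 0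
  have hF0 (u : ℂ) : 0 ≤ F u := by positivity
  rcases (Nat.card (MulAction.stabilizer SL(2, ℤ) τ)).eq_zero_or_pos with h0 | hpos
  · rw [zeroWeight, h0, Nat.cast_zero, div_zero, zero_mul, mul_zero]
    exact Finset.sum_nonneg fun u _ => hF0 u
  have hfin := Nat.finite_of_card_ne_zero hpos.ne'
  have hterm (γ : SL(2, ℤ)) : F (Function.Periodic.qParam 1 (γ • τ : ℍ)) =
      2 * Real.pi * (analyticOrderNatAt (f ∘ ofComplex) τ * max ((γ • τ).im - y) 0) := by
    have h2 : (0 : ℝ) ≤ 2 * Real.pi := by positivity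
    simp only [F, analyticOrderNatAt_cuspFunction_smul, Function.Periodic.norm_qParam, Real.log_exp]
    rw [mul_left_comm, mul_max_of_nonneg _ _ h2, mul_zero, coe_im]
    ring_nf
  have hcomp := Finset.sum_comp F (s := C)
    fun γ : SL(2, ℤ) => Function.Periodic.qParam 1 (γ • τ : ℍ)
  have hsum : 2 * Real.pi * (zeroWeight f τ * ∑ γ ∈ C, max ((γ • τ).im - y) 0) =
      (∑ γ ∈ C, F (Function.Periodic.qParam 1 (γ • τ : ℍ))) /
        Nat.card (MulAction.stabilizer SL(2, ℤ) τ) := by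
    simp only [hterm, ← Finset.mul_sum, zeroWeight]
    ring
  rw [hsum, hcomp, Finset.sum_div]
  refine Finset.sum_le_sum fun u _ => ?_
  rw [nsmul_eq_mul, div_le_iff₀ (Nat.cast_pos.mpr hpos), mul_comm]
  gcongr
  exact card_filter_qParam_smul_le hC τ u

theorem exists_sum_zeroWeight_mul_sum_smul_le (hk : 0 ≤ k) :
    ∃ B : ℝ, 0 ≤ B ∧ ∀ y : ℝ, 0 < y →
      ∀ S : Finset ℍ, (S : Set ℍ).Pairwise (fun τ σ => σ ∉ MulAction.orbit SL(2, ℤ) τ) →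
      ∀ C : Finset SL(2, ℤ), Set.InjOn (fun γ : SL(2, ℤ) => γ 1) C →
      2 * Real.pi * ∑ τ ∈ S, zeroWeight f τ * ∑ γ ∈ C, max ((γ • τ).im - y) 0 ≤
        k / 2 * max (Real.log (1 / y)) 0 + B := by
  obtain ⟨B, hB, h⟩ := exists_sum_cuspFunction_le f hk
  refine ⟨B, hB, fun y hy S hS C hC => ?_⟩
  set Q : ℍ → Finset ℂ := fun τ =>
    C.image fun γ : SL(2, ℤ) => Function.Periodic.qParam 1 (γ • τ : ℍ)
  have hdisj : (S : Set ℍ).PairwiseDisjoint Q := fun τ hτ σ hσ hne => by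
    simp only [Function.onFun, Q, Finset.disjoint_left, Finset.mem_image]
    rintro u ⟨γ, -, rfl⟩ ⟨δ, -, hδ⟩
    obtain ⟨n, hn⟩ := exists_T_zpow_smul_of_qParam_eq hδ
    refine hS hτ hσ hne ⟨δ⁻¹ * (T ^ n * γ), ?_⟩
    simp only [mul_smul, hn, inv_smul_smul]
  rw [Finset.mul_sum]
  refine (Finset.sum_le_sum fun τ _ => zeroWeight_mul_sum_le f hC τ y).trans ?_
  rw [← Finset.sum_biUnion hdisj]
  refine h y hy _ fun u hu => ?_
  obtain ⟨τ, -, hu⟩ := Finset.mem_biUnion.mp hu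
  obtain ⟨γ, -, rfl⟩ := Finset.mem_image.mp hu
  exact Function.Periodic.qParam_ne_zero _

theorem exists_multiples_of_bottom_rows (E : Finset (ℤ × ℤ)) :
    ∃ (N : Finset ℕ) (C : Finset SL(2, ℤ)), Set.InjOn (fun γ : SL(2, ℤ) => γ 1) C ∧
      ∀ p ∈ E, p ≠ 0 → ∃ n ∈ N, n ≠ 0 ∧ ∃ γ ∈ C, (n * γ 1 0, n * γ 1 1) = p := by
  classical
  have hrow (p : CoprimePair) : ∃ γ : SL(2, ℤ), γ 1 0 = p.1.1 ∧ γ 1 1 = p.1.2 :=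
    p.2.exists_SL2_row 1
  choose σ hσ₀ hσ₁ using hrow
  have hprim (p : ℤ × ℤ) (hp : p ≠ 0) : ∃ (n : ℕ) (q : CoprimePair), n ≠ 0 ∧
      (n * q.1.1, n * q.1.2) = p := by
    have hg : 0 < Int.gcd p.1 p.2 := Int.gcd_pos_iff.mpr (by
      contrapose! hp
      exact Prod.ext hp.1 hp.2)
    obtain ⟨a, b, hab, ha, hb⟩ := Int.exists_gcd_one hg
    exact ⟨_, ⟨(a, b), Int.isCoprime_iff_gcd_eq_one.mpr hab⟩, hg.ne',
      Prod.ext ((mul_comm _ _).trans ha.symm) ((mul_comm _ _).trans hb.symm)⟩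
  have : Nonempty CoprimePair := ⟨⟨(1, 0), isCoprime_one_left⟩⟩
  choose! n q hn hq using hprim
  refine ⟨E.image n, (E.image q).image σ, ?_, fun p hp hp0 => ⟨n p, Finset.mem_image_of_mem n hp,
    hn p hp0, σ (q p), Finset.mem_image_of_mem σ (Finset.mem_image_of_mem q hp), ?_⟩⟩
  · rintro γ hγ δ hδ h
    obtain ⟨a, -, rfl⟩ := Finset.mem_image.mp hγ
    obtain ⟨b, -, rfl⟩ := Finset.mem_image.mp hδ
    have hab : a = b := Subtype.ext <| Prod.ext
      (by rw [← hσ₀ a, ← hσ₀ b]; exact congrFun h 0) (by rw [← hσ₁ a, ← hσ₁ b]; exact congrFun h 1)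
    rw [hab]
  · rw [hσ₀, hσ₁, hq p hp0]

theorem rowHeight_mul_bottom_row (τ : ℍ) (n : ℕ) (γ : SL(2, ℤ)) :
    rowHeight τ (n * γ 1 0, n * γ 1 1) = (γ • τ).im / n ^ 2 := by
  rw [rowHeight, smul_im_eq]
  push_cast
  rw [show (n : ℂ) * γ 1 0 * τ + n * γ 1 1 = n * (γ 1 0 * τ + γ 1 1) by ring, norm_mul,
    Complex.norm_natCast, mul_pow, div_div, mul_comm (‖_‖ ^ 2), coe_im]

theorem exists_sum_rowHeight_le (E : Finset (ℤ × ℤ)) :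
    ∃ (N : Finset ℕ) (C : Finset SL(2, ℤ)), Set.InjOn (fun γ : SL(2, ℤ) => γ 1) C ∧
      ∀ (τ : ℍ) (y : ℝ), 0 ≤ y → ∑ p ∈ E, max (rowHeight τ p - y) 0 ≤
        ∑ n ∈ N, 1 / (n : ℝ) ^ 2 * ∑ γ ∈ C, max ((γ • τ).im - n ^ 2 * y) 0 := by
  classical
  obtain ⟨N, C, hC, hE⟩ := exists_multiples_of_bottom_rows E
  refine ⟨N, C, hC, fun τ y hy => ?_⟩
  set F : ℤ × ℤ → ℝ := fun p => max (rowHeight τ p - y) 0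
  have hF0 (p : ℤ × ℤ) : 0 ≤ F p := le_max_right _ _
  have hsub : E.erase 0 ⊆ ({n ∈ N | n ≠ 0} ×ˢ C).image
      fun x : ℕ × SL(2, ℤ) => ((x.1 : ℤ) * x.2 1 0, (x.1 : ℤ) * x.2 1 1) := fun p hp => by
    obtain ⟨n, hn, hn0, γ, hγ, rfl⟩ :=
      hE p (Finset.mem_of_mem_erase hp) (Finset.ne_of_mem_erase hp)
    exact Finset.mem_image.mpr
      ⟨(n, γ), Finset.mem_product.mpr ⟨Finset.mem_filter.mpr ⟨hn, hn0⟩, hγ⟩, rfl⟩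
  calc
    ∑ p ∈ E, F p ≤ ∑ p ∈ E.erase 0, F p := by
      refine (Finset.sum_erase E ?_).ge
      simp [F, rowHeight, hy]
    _ ≤ ∑ x ∈ {n ∈ N | n ≠ 0} ×ˢ C, F (x.1 * x.2 1 0, x.1 * x.2 1 1) :=
      (Finset.sum_le_sum_of_subset_of_nonneg hsub fun p _ _ => hF0 p).trans
        (Finset.sum_image_le_of_nonneg fun x _ => hF0 _)
    _ = ∑ n ∈ N with n ≠ 0, 1 / (n : ℝ) ^ 2 * ∑ γ ∈ C, max ((γ • τ).im - n ^ 2 * y) 0 := by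
      rw [Finset.sum_product]
      refine Finset.sum_congr rfl fun n hn => ?_
      have hn0 : (0 : ℝ) < n := Nat.cast_pos.mpr (Nat.pos_of_ne_zero (Finset.mem_filter.mp hn).2)
      rw [Finset.mul_sum]
      refine Finset.sum_congr rfl fun γ _ => ?_
      rw [mul_max_of_nonneg _ _ (by positivity), mul_zero]
      simp only [F, rowHeight_mul_bottom_row]
      congr 1
      field
    _ ≤ ∑ n ∈ N, 1 / (n : ℝ) ^ 2 * ∑ γ ∈ C, max ((γ • τ).im - n ^ 2 * y) 0 :=
      Finset.sum_le_sum_of_subset_of_nonneg (Finset.filter_subset _ _) fun n _ _ => by positivity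

theorem exists_sum_zeroWeight_mul_sum_rowHeight_le (hk : 0 ≤ k) {S : Finset ℍ}
    (hS : (S : Set ℍ).Pairwise (fun τ σ => σ ∉ MulAction.orbit SL(2, ℤ) τ)) :
    ∃ B : ℝ, ∀ y : ℝ, 0 < y → ∀ E : Finset (ℤ × ℤ),
      2 * Real.pi * ∑ τ ∈ S, zeroWeight f τ * ∑ p ∈ E, max (rowHeight τ p - y) 0 ≤
        Real.pi ^ 2 / 6 * (k / 2 * max (Real.log (1 / y)) 0 + B) := by
  obtain ⟨B, hB, h⟩ := exists_sum_zeroWeight_mul_sum_smul_le f hk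
  refine ⟨B, fun y hy E => ?_⟩
  obtain ⟨N, C, hC, hE⟩ := exists_sum_rowHeight_le E
  set D := k / 2 * max (Real.log (1 / y)) 0 + B
  have _ : 0 ≤ D := by positivity
  have hterm (n : ℕ) : 1 / (n : ℝ) ^ 2 * (2 * Real.pi * ∑ τ ∈ S, zeroWeight f τ *
      ∑ γ ∈ C, max ((γ • τ).im - n ^ 2 * y) 0) ≤ 1 / (n : ℝ) ^ 2 * D := by
    rcases eq_or_ne n 0 with rfl | hn
    · simp
    have hn1 : (1 : ℝ) ≤ n := Nat.one_le_cast.mpr (Nat.one_le_iff_ne_zero.mpr hn)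
    refine mul_le_mul_of_nonneg_left ((h (n ^ 2 * y) (by positivity) S hS C hC).trans ?_)
      (by positivity)
    simp only [D]
    gcongr
    exact le_mul_of_one_le_left hy.le (one_le_pow₀ hn1)
  calc
    2 * Real.pi * ∑ τ ∈ S, zeroWeight f τ * ∑ p ∈ E, max (rowHeight τ p - y) 0
      ≤ 2 * Real.pi * ∑ τ ∈ S, zeroWeight f τ *
          ∑ n ∈ N, 1 / (n : ℝ) ^ 2 * ∑ γ ∈ C, max ((γ • τ).im - n ^ 2 * y) 0 := by
        gcongr with τ
        · exact zeroWeight_nonneg f τ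
        · exact hE τ y hy.le
    _ = ∑ n ∈ N, 1 / (n : ℝ) ^ 2 * (2 * Real.pi * ∑ τ ∈ S, zeroWeight f τ *
          ∑ γ ∈ C, max ((γ • τ).im - n ^ 2 * y) 0) := by
        simp only [Finset.mul_sum]
        rw [Finset.sum_comm]
        refine Finset.sum_congr rfl fun n _ => Finset.sum_congr rfl fun τ _ =>
          Finset.sum_congr rfl fun γ _ => by ring
    _ ≤ ∑ n ∈ N, 1 / (n : ℝ) ^ 2 * D := Finset.sum_le_sum fun n _ => hterm n
    _ = (∑ n ∈ N, 1 / (n : ℝ) ^ 2) * D := (Finset.sum_mul ..).symm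
    _ ≤ Real.pi ^ 2 / 6 * D := by
        gcongr
        exact sum_le_hasSum N (fun n _ => by positivity) hasSum_zeta_two

theorem exists_mul_log_le_sum_zeroWeight_mul_sum_rowHeight (S : Finset ℍ) {a : ℝ}
    (ha : a < Real.pi) : ∃ B : ℝ, ∀ᶠ y in 𝓝[>] (0 : ℝ), ∃ E : Finset (ℤ × ℤ),
      (∑ τ ∈ S, zeroWeight f τ) * (a * Real.log (1 / y)) - B ≤
        ∑ τ ∈ S, zeroWeight f τ * ∑ p ∈ E, max (rowHeight τ p - y) 0 := by
  classical
  choose B s hs h using fun τ : ℍ => exists_mul_log_le_sum_rowHeight τ ha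
  refine ⟨∑ τ ∈ S, zeroWeight f τ * B τ, ?_⟩
  filter_upwards [S.eventually_all.mpr fun τ _ => Ioc_mem_nhdsGT (hs τ)] with y hy
  choose! E hE using fun τ (hτ : τ ∈ S) => h τ y (hy τ hτ).1 (hy τ hτ).2
  refine ⟨S.biUnion E, ?_⟩
  rw [Finset.sum_mul, ← Finset.sum_sub_distrib]
  refine Finset.sum_le_sum fun τ hτ => ?_
  rw [← mul_sub]
  refine mul_le_mul_of_nonneg_left ((hE τ hτ).trans ?_) (zeroWeight_nonneg f τ)
  exact Finset.sum_le_sum_of_subset_of_nonneg (Finset.subset_biUnion_of_mem E hτ)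
    fun p _ _ => le_max_right _ _

/- Jensen's formula for the cusp function bounds the zeros of `f` in `im τ > y` from above by
`(k / 2) log (1 / y)`; an orbit of zeros contributes the number of its points in that region, and
by lattice point counting this is asymptotically a fixed multiple of `log (1 / y)`. -/
theorem sum_zeroWeight_le (hk : 0 ≤ k) {S : Finset ℍ}
    (hS : (S : Set ℍ).Pairwise (fun τ σ => σ ∉ MulAction.orbit SL(2, ℤ) τ)) :
    ∑ τ ∈ S, zeroWeight f τ ≤ k / 24 := by
  obtain ⟨B, hB⟩ := exists_sum_zeroWeight_mul_sum_rowHeight_le f hk hS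
  have hlog : Tendsto (fun y : ℝ => Real.log (1 / y)) (𝓝[>] 0) atTop := by
    simpa only [one_div, Function.comp_def] using
      Real.tendsto_log_atTop.comp tendsto_inv_nhdsGT_zero
  have hlt (a : ℝ) (ha : a < Real.pi) :
      (∑ τ ∈ S, zeroWeight f τ) * a ≤ k / 24 * Real.pi := by
    obtain ⟨B', hB'⟩ := exists_mul_log_le_sum_zeroWeight_mul_sum_rowHeight f S ha
    set W := ∑ τ ∈ S, zeroWeight f τ
    by_contra! hW
    have hlarge := hlog.eventually_gt_atTop
      ((Real.pi / 12 * B + B') / (W * a - k / 24 * Real.pi))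
    obtain ⟨y, hy, ⟨E, hE⟩, hL, hL0⟩ := (eventually_mem_nhdsWithin.and
      (hB'.and (hlarge.and (hlog.eventually_ge_atTop 0)))).exists
    have hup := hB y hy E
    rw [max_eq_left hL0] at hup
    rw [div_lt_iff₀ (sub_pos.mpr hW)] at hL
    have hlow := mul_le_mul_of_nonneg_left hE (by positivity : 0 ≤ 2 * Real.pi)
    have hcancel : 2 * Real.pi * (W * (a * Real.log (1 / y)) - B') ≤
        2 * Real.pi * (k / 24 * Real.pi * Real.log (1 / y) + Real.pi / 12 * B) := by
      linarith
    have := le_of_mul_le_mul_left hcancel (by positivity)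
    linarith
  refine le_of_mul_le_mul_right ?_ Real.pi_pos
  refine le_of_tendsto (((continuous_const_mul _).tendsto _).mono_left nhdsWithin_le_nhds) ?_
    (x := 𝓝[<] Real.pi)
  exact eventually_mem_nhdsWithin.mono hlt

end Orbits

/-! ### Zeros in the fundamental domain -/

section Stabilizers

theorem natCard_stabilizer_eq_card {τ : ℍ} {G : Finset SL(2, ℤ)}
    (h : ∀ g : SL(2, ℤ), g • τ = τ ↔ g ∈ G) :
    Nat.card (MulAction.stabilizer SL(2, ℤ) τ) = G.card := by
  have hG : (MulAction.stabilizer SL(2, ℤ) τ : Set SL(2, ℤ)) = G := Set.ext h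
  rw [← Set.ncard_coe_finset, ← hG]
  exact Nat.card_coe_set_eq _

theorem natCard_stabilizer_eq_two {τ : ℍ} (hτ : τ ∈ 𝒟) (hI : τ ≠ I) (hρ : τ ≠ ρ)
    (hρ' : τ ≠ (1 : ℝ) +ᵥ ρ) : Nat.card (MulAction.stabilizer SL(2, ℤ) τ) = 2 := by
  refine natCard_stabilizer_eq_card (G := {1, -1}) fun g => ?_
  rw [Finset.mem_insert, Finset.mem_singleton]
  refine ⟨fun hg => stabilizer_of_ne hτ hg hI hρ hρ', ?_⟩
  rintro (rfl | rfl)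
  · exact one_smul _ τ
  · rw [SL_neg_smul, one_smul]

theorem natCard_stabilizer_I : Nat.card (MulAction.stabilizer SL(2, ℤ) I) = 4 :=
  natCard_stabilizer_eq_card fun _ => stabilizer_I

theorem natCard_stabilizer_rho : Nat.card (MulAction.stabilizer SL(2, ℤ) ρ) = 6 :=
  (natCard_stabilizer_eq_card fun _ => stabilizer_ρ).trans (by decide +kernel)

theorem natCard_stabilizer_one_add_rho :
    Nat.card (MulAction.stabilizer SL(2, ℤ) ((1 : ℝ) +ᵥ ρ)) = 6 :=
  (Nat.card_congr (MulAction.stabilizerEquivStabilizer (modular_T_smul ρ).symm).toEquiv).symm.trans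
    natCard_stabilizer_rho

theorem natCard_stabilizer_of_mem_fd {τ : ℍ} (hτ : τ ∈ 𝒟) :
    Nat.card (MulAction.stabilizer SL(2, ℤ) τ) = 2 ∨
      Nat.card (MulAction.stabilizer SL(2, ℤ) τ) = 4 ∨
      Nat.card (MulAction.stabilizer SL(2, ℤ) τ) = 6 := by
  by_cases hI : τ = I
  · exact hI ▸ .inr (.inl natCard_stabilizer_I)
  by_cases hρ : τ = ρ
  · exact hρ ▸ .inr (.inr natCard_stabilizer_rho)
  by_cases hρ' : τ = (1 : ℝ) +ᵥ ρ
  · exact hρ' ▸ .inr (.inr natCard_stabilizer_one_add_rho)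
  exact .inl (natCard_stabilizer_eq_two hτ hI hρ hρ')

end Stabilizers

section FundDomain

theorem sq_norm_eq_re_sq_add_im_sq (z : ℂ) : ‖z‖ ^ 2 = z.re ^ 2 + z.im ^ 2 := by
  rw [← Complex.normSq_eq_norm_sq, Complex.normSq_apply, sq, sq]

theorem arg_mem_Icc_iff_of_norm_eq_one {z : ℂ} (hn : ‖z‖ = 1) (hz : 0 < z.im) :
    z.arg ∈ Set.Icc (Real.pi / 3) (Real.pi / 2) ↔ z.re ∈ Set.Icc 0 (1 / 2) := by
  have hcos : Real.cos z.arg = z.re := by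
    simpa only [hn, one_mul] using Complex.norm_mul_cos_arg z
  have harg : z.arg ∈ Set.Icc 0 Real.pi :=
    ⟨Complex.arg_nonneg_iff.mpr hz.le, Complex.arg_le_pi z⟩
  have hmem {x : ℝ} (hx : 2 ≤ x) : Real.pi / x ∈ Set.Icc 0 Real.pi :=
    ⟨by positivity, div_le_self Real.pi_pos.le (by linarith)⟩
  rw [← hcos, ← Real.cos_pi_div_two, ← Real.cos_pi_div_three, Set.mem_Icc, Set.mem_Icc,
    Real.strictAntiOn_cos.le_iff_ge (hmem le_rfl) harg,
    Real.strictAntiOn_cos.le_iff_ge harg (hmem (by norm_num)), and_comm]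

theorem mem_fundDomain_iff {z : ℂ} :
    z ∈ fundDomain ↔ 0 < z.im ∧ 1 ≤ ‖z‖ ∧ z.re ∈ Set.Ioc (-(1 / 2)) (1 / 2) ∧
      (‖z‖ = 1 → 0 ≤ z.re) := by
  constructor
  · rintro (⟨him, hn, hre⟩ | ⟨him, hn, harg⟩)
    · exact ⟨him, hn.le, hre, fun h => absurd h hn.ne'⟩
    · obtain ⟨h0, h1⟩ := (arg_mem_Icc_iff_of_norm_eq_one hn him).mp harg
      exact ⟨him, hn.ge, ⟨by linarith, h1⟩, fun _ => h0⟩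
  · rintro ⟨him, hn, hre, hnonneg⟩
    rcases hn.lt_or_eq with hn | hn
    · exact .inl ⟨him, hn, hre⟩
    · exact .inr ⟨him, hn.symm,
        (arg_mem_Icc_iff_of_norm_eq_one hn.symm him).mpr ⟨hnonneg hn.symm, hre.2⟩⟩

theorem im_pos_of_mem_fundDomain {z : ℂ} (hz : z ∈ fundDomain) : 0 < z.im :=
  (mem_fundDomain_iff.mp hz).1

theorem mem_arc_of_norm_eq_one {z : ℂ} (hz : z ∈ fundDomain) (hn : ‖z‖ = 1) : z ∈ arc := by
  rcases hz with ⟨-, h, -⟩ | ⟨-, -, h⟩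
  · exact absurd hn h.ne'
  · exact ⟨z.arg, h, by simpa [hn] using (Complex.norm_mul_exp_arg_mul_I z).symm⟩

theorem mem_lineRho_iff {z : ℂ} : z ∈ lineRho ↔ z.re = 1 / 2 ∧ √3 / 2 ≤ z.im := by
  constructor
  · rintro ⟨t, ht, rfl⟩
    simpa using ht
  · rintro ⟨hre, him⟩
    exact ⟨z.im, him, by apply Complex.ext <;> simp [hre]⟩

theorem lineRho_subset_fundDomain : lineRho ⊆ fundDomain := by
  intro z hz
  obtain ⟨hre, him⟩ := mem_lineRho_iff.mp hz
  have hsq : √3 ^ 2 = 3 := Real.sq_sqrt zero_le_three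
  have hpos : 0 < √3 := by positivity
  have hn : 1 ≤ ‖z‖ ^ 2 := by
    rw [sq_norm_eq_re_sq_add_im_sq, hre]
    nlinarith
  rw [mem_fundDomain_iff, hre]
  exact ⟨by linarith, (one_le_sq_iff₀ (norm_nonneg z)).mp hn, by norm_num, fun _ => by norm_num⟩

theorem mem_fd_of_mem_fundDomain {τ : ℍ} (hτ : (τ : ℂ) ∈ fundDomain) : τ ∈ 𝒟 := by
  obtain ⟨-, hn, hre, -⟩ := mem_fundDomain_iff.mp hτ
  exact ⟨by rw [Complex.normSq_eq_norm_sq]; exact one_le_pow₀ hn, abs_le.mpr ⟨hre.1.le, hre.2⟩⟩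

theorem ne_rho_of_mem_fundDomain {τ : ℍ} (hτ : (τ : ℂ) ∈ fundDomain) : τ ≠ ρ := by
  rintro rfl
  have hre : (ρ : ℂ).re = -(1 / 2) := by norm_num [ρ]
  exact (mem_fundDomain_iff.mp hτ).2.2.1.1.ne' hre

theorem eq_of_S_smul_eq_of_mem_fundDomain {τ σ : ℍ} (hτ : (τ : ℂ) ∈ fundDomain)
    (hσ : (σ : ℂ) ∈ fundDomain) (hn : ‖(τ : ℂ)‖ = 1) (h : S • τ = σ) : τ = σ := by
  have hconj : (σ : ℂ) = -starRingEnd ℂ τ := by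
    rw [← h, modular_S_smul, coe_mk, inv_neg, Complex.inv_eq_conj hn]
  have hre : (σ : ℂ).re = -(τ : ℂ).re := by rw [hconj]; simp
  have hτ0 := (mem_fundDomain_iff.mp hτ).2.2.2 hn
  have hσ0 := (mem_fundDomain_iff.mp hσ).2.2.2 (by rw [hconj, norm_neg, RCLike.norm_conj, hn])
  refine UpperHalfPlane.ext_iff.mpr (Complex.ext (by linarith) ?_)
  rw [hconj]
  simp

theorem eq_or_eq_one_add_rho_of_smul_eq_of_mem_fundDomain {τ σ : ℍ} (hτ : (τ : ℂ) ∈ fundDomain)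
    (hσ : (σ : ℂ) ∈ fundDomain) {γ : SL(2, ℤ)} (h : γ • τ = σ) :
    τ = σ ∨ τ = (1 : ℝ) +ᵥ ρ := by
  have hneg {g : SL(2, ℤ)} (hγ : γ = g ∨ γ = -g) : g • τ = σ := by
    rcases hγ with rfl | rfl
    · exact h
    · rwa [SL_neg_smul] at h
  have hσre : -(1 / 2) < σ.re := (mem_fundDomain_iff.mp hσ).2.2.1.1
  have hτre : -(1 / 2) < τ.re := (mem_fundDomain_iff.mp hτ).2.2.1.1
  have hfd : γ • τ ∈ 𝒟 := h ▸ mem_fd_of_mem_fundDomain hσ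
  rcases cases_of_mem_fd_smul_mem_fd (mem_fd_of_mem_fundDomain hτ) hfd with
    hγ | ⟨-, hre⟩ | ⟨hγ, hre⟩ | ⟨hγ, hn⟩ | ⟨-, hω⟩ | ⟨-, hω⟩ | ⟨-, hω⟩ | ⟨-, hρ⟩ |
      ⟨-, hρ⟩ | ⟨-, hρ⟩
  · exact .inl (by simpa only [one_smul] using hneg hγ)
  · linarith
  · have := congrArg UpperHalfPlane.re (hneg hγ)
    rw [re_T_inv_smul, hre] at this
    linarith
  · exact .inl (eq_of_S_smul_eq_of_mem_fundDomain hτ hσ hn (hneg hγ))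
  · exact .inr hω
  · exact .inr hω
  · exact .inr hω
  · exact absurd hρ (ne_rho_of_mem_fundDomain hτ)
  · exact absurd hρ (ne_rho_of_mem_fundDomain hτ)
  · exact absurd hρ (ne_rho_of_mem_fundDomain hτ)

theorem eq_of_smul_eq_of_mem_fundDomain {τ σ : ℍ} (hτ : (τ : ℂ) ∈ fundDomain)
    (hσ : (σ : ℂ) ∈ fundDomain) {γ : SL(2, ℤ)} (h : γ • τ = σ) : τ = σ := by
  rcases eq_or_eq_one_add_rho_of_smul_eq_of_mem_fundDomain hτ hσ h with hτσ | hτρ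
  · exact hτσ
  rcases eq_or_eq_one_add_rho_of_smul_eq_of_mem_fundDomain hσ hτ
    (inv_smul_eq_iff.mpr h.symm) with hστ | hσρ
  · exact hστ.symm
  · rw [hτρ, hσρ]

end FundDomain

section ZeroCount

variable {k : ℤ} {f : CuspForm 𝒮ℒ k}

theorem sum_zeroWeight_ofComplex_le (f : CuspForm 𝒮ℒ k) (hk : 0 ≤ k) {S : Finset ℂ}
    (hS : ∀ z ∈ S, z ∈ fundDomain) : ∑ z ∈ S, zeroWeight f (ofComplex z) ≤ k / 24 := by
  classical
  have hcoe {z : ℂ} (hz : z ∈ S) : (ofComplex z : ℂ) = z :=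
    congrArg _ (ofComplex_apply_of_im_pos (im_pos_of_mem_fundDomain (hS z hz)))
  have hinj : Set.InjOn (ofComplex : ℂ → ℍ) S := fun z hz w hw h => by
    rw [← hcoe hz, h, hcoe hw]
  rw [← Finset.sum_image (f := zeroWeight f) hinj]
  refine sum_zeroWeight_le f hk fun τ hτ σ hσ hne hmem => ?_
  obtain ⟨z, hz, rfl⟩ := Finset.mem_image.mp hτ
  obtain ⟨w, hw, rfl⟩ := Finset.mem_image.mp hσ
  obtain ⟨γ, hγ⟩ := hmem
  exact hne (eq_of_smul_eq_of_mem_fundDomain ((hcoe hz).symm ▸ hS z hz)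
    ((hcoe hw).symm ▸ hS w hw) hγ)

theorem analyticOrderNatAt_div_six_le_zeroWeight (f : ℍ → ℂ) {z : ℂ} (hz : z ∈ fundDomain) :
    (analyticOrderNatAt (f ∘ ofComplex) z : ℝ) / 6 ≤ zeroWeight f (ofComplex z) := by
  have hcoe : (ofComplex z : ℂ) = z :=
    congrArg _ (ofComplex_apply_of_im_pos (im_pos_of_mem_fundDomain hz))
  rw [zeroWeight, hcoe]
  have hfd : ofComplex z ∈ 𝒟 := mem_fd_of_mem_fundDomain (hcoe.symm ▸ hz)
  rcases natCard_stabilizer_of_mem_fd hfd with h | h | h <;> rw [h] <;> push_cast <;> gcongr <;>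
    norm_num

theorem zeroWeight_ofComplex_eq (f : ℍ → ℂ) {z : ℂ} (hz : z ∈ fundDomain) (hI : z ≠ Complex.I)
    (hρ : z ≠ 1 + ρ) : zeroWeight f (ofComplex z) = analyticOrderNatAt (f ∘ ofComplex) z / 2 := by
  have hcoe : (ofComplex z : ℂ) = z :=
    congrArg _ (ofComplex_apply_of_im_pos (im_pos_of_mem_fundDomain hz))
  have hz' : (ofComplex z : ℂ) ∈ fundDomain := hcoe.symm ▸ hz
  rw [zeroWeight, hcoe, natCard_stabilizer_eq_two (mem_fd_of_mem_fundDomain hz') _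
    (ne_rho_of_mem_fundDomain hz')]
  · rfl
  · intro h
    rw [h, coe_vadd] at hcoe
    exact hρ (by rw [← hcoe, Complex.ofReal_one])
  · intro h
    rw [h] at hcoe
    exact hI hcoe.symm

theorem analyticOnNhd_comp_ofComplex (f : CuspForm 𝒮ℒ k) :
    AnalyticOnNhd ℂ (f ∘ ofComplex) {z | 0 < z.im} := fun z hz =>
  analyticAt_comp_ofComplex f ⟨z, hz⟩

theorem one_le_analyticOrderNatAt (hf : f ≠ 0) {z : ℂ} (hz : 0 < z.im)
    (h : (f ∘ ofComplex) z = 0) : 1 ≤ analyticOrderNatAt (f ∘ ofComplex) z := by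
  obtain ⟨τ, hτ⟩ := DFunLike.ne_iff.mp hf
  have hτ' : analyticOrderAt (f ∘ ofComplex) τ = 0 := by
    refine (analyticAt_comp_ofComplex f τ).analyticOrderAt_eq_zero.mpr ?_
    rwa [Function.comp_apply, ofComplex_apply]
  have htop := (analyticOnNhd_comp_ofComplex f).analyticOrderAt_ne_top_of_isPreconnected
    (convex_halfSpace_im_gt 0).isPreconnected τ.im_pos hz (hτ' ▸ ENat.zero_ne_top)
  rw [Nat.one_le_iff_ne_zero, ne_eq, ← Nat.cast_inj (R := ℕ∞), Nat.cast_analyticOrderNatAt htop]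
  exact (analyticOnNhd_comp_ofComplex f z hz).analyticOrderAt_ne_zero.mpr h

theorem finite_zeros (hf : f ≠ 0) (hk : 0 ≤ k) :
    {z ∈ fundDomain | (f ∘ ofComplex) z = 0}.Finite := by
  by_contra hinf
  obtain ⟨S, hS, hcard⟩ := Set.Infinite.exists_subset_card_eq hinf (k.toNat + 1)
  have hle : ∑ z ∈ S, (1 / 6 : ℝ) ≤ ∑ z ∈ S, zeroWeight f (ofComplex z) := by
    refine Finset.sum_le_sum fun z hz => le_trans ?_
      (analyticOrderNatAt_div_six_le_zeroWeight f (hS hz).1)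
    have hord := one_le_analyticOrderNatAt hf (im_pos_of_mem_fundDomain (hS hz).1) (hS hz).2
    gcongr
    exact_mod_cast hord
  have hsum := hle.trans (sum_zeroWeight_ofComplex_le f hk fun z hz => (hS hz).1)
  have hk' : (k.toNat : ℝ) = k := by exact_mod_cast Int.toNat_of_nonneg hk
  have hk0 : (0 : ℝ) ≤ k := Int.cast_nonneg hk
  rw [Finset.sum_const, hcard, nsmul_eq_mul, Nat.cast_add_one, hk'] at hsum
  linarith

theorem zeroCount_eq_sum {g : ℂ → ℂ} {S : Set ℂ} (hfin : {z ∈ S | g z = 0}.Finite) :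
    zeroCount g S = ∑ z ∈ hfin.toFinset, analyticOrderNatAt g z := by
  refine finsum_mem_eq_sum_of_inter_support_eq _ (Set.ext fun z => ?_)
  rw [Set.Finite.coe_toFinset]
  exact ⟨fun h => ⟨⟨h.1, apply_eq_zero_of_analyticOrderNatAt_ne_zero h.2⟩, h.2⟩,
    fun h => ⟨h.1.1, h.2⟩⟩

theorem zeroCount_congr {g h : ℂ → ℂ} {U S : Set ℂ} (hU : IsOpen U) (heq : Set.EqOn g h U)
    (hS : S ⊆ U) : zeroCount g S = zeroCount h S :=
  finsum_mem_congr rfl fun _ hz => congrArg ENat.toNat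
    (analyticOrderAt_congr (heq.eventuallyEq_of_mem (hU.mem_nhds (hS hz))))

/-- The zeros of `g` in the fundamental domain at which the stabilizer in `SL(2, ℤ)` is `{1, -1}`.
These count with weight one in the valence formula. -/
def ordinaryZeros (g : ℂ → ℂ) : Set ℂ :=
  {z | z ∈ fundDomain ∧ g z = 0 ∧ z ≠ Complex.I ∧ z ≠ 1 + ρ}

theorem half_le_zeroWeight (hf : f ≠ 0) {z : ℂ} (hz : z ∈ ordinaryZeros (f ∘ ofComplex)) :
    1 / 2 ≤ zeroWeight f (ofComplex z) := by
  obtain ⟨hfund, h0, hI, hρ⟩ := hz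
  have hord := one_le_analyticOrderNatAt hf (im_pos_of_mem_fundDomain hfund) h0
  rw [zeroWeight_ofComplex_eq f hfund hI hρ]
  gcongr
  exact_mod_cast hord

theorem sum_analyticOrderNatAt_le (hf : f ≠ 0) {V W : Finset ℂ} (hV : ∀ z ∈ V, z ∈ fundDomain)
    (hW : ∀ z ∈ W, z ∈ ordinaryZeros (f ∘ ofComplex)) (hWV : W ⊆ V) :
    (∑ z ∈ V, (analyticOrderNatAt (f ∘ ofComplex) z : ℝ)) / 6 + W.card / 3 ≤
      ∑ z ∈ V, zeroWeight f (ofComplex z) := by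
  classical
  calc
    _ = ∑ z ∈ V, ((analyticOrderNatAt (f ∘ ofComplex) z : ℝ) / 6 +
          if z ∈ W then 1 / 3 else 0) := by
        rw [Finset.sum_add_distrib, Finset.sum_div, Finset.sum_ite_mem,
          Finset.inter_eq_right.mpr hWV, Finset.sum_const, nsmul_eq_mul, mul_one_div]
    _ ≤ _ := Finset.sum_le_sum fun z hz => ?_
  split_ifs with hzW
  · have h := half_le_zeroWeight hf (hW z hzW)
    obtain ⟨hfund, -, hI, hρ⟩ := hW z hzW
    rw [zeroWeight_ofComplex_eq f hfund hI hρ] at h ⊢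
    linarith
  · rw [add_zero]
    exact analyticOrderNatAt_div_six_le_zeroWeight f (hV z hz)

theorem card_le_zeroCount (hf : f ≠ 0) (hk : 0 ≤ k) {S : Set ℂ} (hS : S ⊆ fundDomain)
    {Z : Finset ℂ} (hZ : ∀ z ∈ Z, z ∈ S ∧ (f ∘ ofComplex) z = 0) :
    Z.card ≤ zeroCount (f ∘ ofComplex) S := by
  have hfin : {z ∈ S | (f ∘ ofComplex) z = 0}.Finite :=
    (finite_zeros hf hk).subset fun z hz => ⟨hS hz.1, hz.2⟩
  rw [zeroCount_eq_sum hfin, Finset.card_eq_sum_ones]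
  calc
    ∑ z ∈ Z, 1 ≤ ∑ z ∈ Z, analyticOrderNatAt (f ∘ ofComplex) z :=
        Finset.sum_le_sum fun z hz =>
          one_le_analyticOrderNatAt hf (im_pos_of_mem_fundDomain (hS (hZ z hz).1)) (hZ z hz).2
    _ ≤ _ := Finset.sum_le_sum_of_subset fun z hz => hfin.mem_toFinset.mpr (hZ z hz)

theorem zeroCount_le (hf : f ≠ 0) (hk : 0 ≤ k) {S : Set ℂ} (hS : S ⊆ fundDomain) {Z W : Finset ℂ}
    (hZ : ∀ z ∈ Z, z ∈ ordinaryZeros (f ∘ ofComplex) ∧ z ∉ S)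
    (hW : ∀ z ∈ W, z ∈ ordinaryZeros (f ∘ ofComplex) ∧ z ∈ S) :
    (zeroCount (f ∘ ofComplex) S : ℝ) ≤ W.card + 3 * (k / 12 - Z.card - W.card) := by
  classical
  have hfin : {z ∈ S | (f ∘ ofComplex) z = 0}.Finite :=
    (finite_zeros hf hk).subset fun z hz => ⟨hS hz.1, hz.2⟩
  have hV {z : ℂ} (hz : z ∈ hfin.toFinset) : z ∈ S := (hfin.mem_toFinset.mp hz).1
  have hdisj : Disjoint Z hfin.toFinset :=
    Finset.disjoint_left.mpr fun z hz hzV => (hZ z hz).2 (hV hzV)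
  have hsum := sum_zeroWeight_ofComplex_le f hk (S := Z ∪ hfin.toFinset) fun z hz =>
    (Finset.mem_union.mp hz).elim (fun h => (hZ z h).1.1) fun h => hS (hV h)
  rw [Finset.sum_union hdisj] at hsum
  have hsumZ : Z.card • (1 / 2 : ℝ) ≤ ∑ z ∈ Z, zeroWeight f (ofComplex z) :=
    Finset.card_nsmul_le_sum _ _ _ fun z hz => half_le_zeroWeight hf (hZ z hz).1
  have hsumV := sum_analyticOrderNatAt_le hf (fun z hz => hS (hV hz)) (fun z hz => (hW z hz).1)
    fun z hz => hfin.mem_toFinset.mpr ⟨(hW z hz).2, (hW z hz).1.2.1⟩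
  rw [nsmul_eq_mul] at hsumZ
  rw [zeroCount_eq_sum hfin, Nat.cast_sum]
  linarith

end ZeroCount

/-! ### The two main terms -/

/-- The modulus of the term of the Poincaré series of a pair with `‖c * z + d‖ = r`, at a point `z`
of height `y`; see `norm_term`. -/
noncomputable def termSize (k m : ℕ) (y r : ℝ) : ℝ :=
  Real.exp (-(2 * Real.pi * m * (y / r ^ 2))) / r ^ k

theorem termSize_pos (k m : ℕ) (y : ℝ) {r : ℝ} (hr : 0 < r) : 0 < termSize k m y r := by
  unfold termSize; positivity

theorem termSize_eq_exp (k m : ℕ) (y : ℝ) {r : ℝ} (hr : 0 < r) :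
    termSize k m y r = Real.exp (-(2 * Real.pi * m * (y / r ^ 2)) - k * Real.log r) := by
  rw [Real.exp_sub, termSize, mul_comm (k : ℝ), Real.exp_mul, Real.exp_log hr, Real.rpow_natCast]

-- The exponential factor may grow with `r`, but by `1 - (R / r) ^ 2 ≤ 2 * log (r / R)` it grows by
-- at most `(r / R) ^ ((1 - κ) * k)`.
theorem termSize_le {k m : ℕ} {y r R κ : ℝ} (hy : 0 ≤ y) (hR : 0 < R) (hr : R ≤ r)
    (h : 4 * Real.pi * m * y ≤ (1 - κ) * k * R ^ 2) :
    termSize k m y r ≤ termSize k m y R * (R / r) ^ (κ * k) := by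
  have hr0 : 0 < r := hR.trans_le hr
  rw [termSize_eq_exp _ _ _ hR, termSize_eq_exp _ _ _ hr0, Real.rpow_def_of_pos (by positivity),
    ← Real.exp_add, Real.exp_le_exp, Real.log_div hR.ne' hr0.ne']
  set B : ℝ := 2 * Real.pi * m * (y / R ^ 2) with hB
  have hB0 : 0 ≤ B := by positivity
  have hBk : B ≤ (1 - κ) * k / 2 := by
    rw [hB, mul_div_assoc', div_le_iff₀ (by positivity)]
    linarith
  have hlog : 1 - ((r / R) ^ 2)⁻¹ ≤ 2 * (Real.log r - Real.log R) := by
    have := Real.one_sub_inv_le_log_of_pos (show 0 < (r / R) ^ 2 by positivity)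
    rwa [Real.log_pow, Real.log_div hr0.ne' hR.ne'] at this
  have hlog0 : 0 ≤ Real.log r - Real.log R := sub_nonneg.mpr (Real.log_le_log hR hr)
  have hgrowth : B * (1 - ((r / R) ^ 2)⁻¹) ≤ (1 - κ) * k / 2 * (2 * (Real.log r - Real.log R)) := by
    exact (mul_le_mul_of_nonneg_left hlog hB0).trans (by gcongr)
  have hBr : 2 * Real.pi * m * (y / r ^ 2) = B * ((r / R) ^ 2)⁻¹ := by
    rw [hB]
    field
  rw [hBr]
  linarith

theorem norm_term_eq_termSize (k m : ℕ) {c d : ℤ} (h : IsCoprime c d) {z : ℂ} (hz : 0 < z.im) :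
    ‖term k m c d z‖ = termSize k m z.im ‖(c : ℂ) * z + d‖ :=
  norm_term k m h hz

theorem norm_term_le_of_lt {k m : ℕ} {κ δ r R Y : ℝ} {z : ℂ} (hz : 0 < z.im) (hR : 0 < R)
    (hRY : R ≤ Y) (hδ : 0 < δ) (hr : 0 < r) (hκ : 3 ≤ κ * k)
    (hm : 4 * Real.pi * m * z.im ≤ (1 - κ) * k * R ^ 2) (p : CoprimePair)
    (hpR : (1 + δ) * R ≤ ‖(p.1.1 : ℂ) * z + p.1.2‖)
    (hpr : r * ‖(p : ℤ × ℤ)‖ ≤ ‖(p.1.1 : ℂ) * z + p.1.2‖) :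
    ‖term k m p.1.1 p.1.2 z‖ ≤ termSize k m z.im R * ((1 / (1 + δ)) ^ (κ * k - 3) * (Y / r) ^ 3) *
      (1 / ‖(p : ℤ × ℤ)‖ ^ 3) := by
  have hp := one_le_norm_of_isCoprime p.2
  rw [norm_term_eq_termSize k m p.2 hz]
  set w := ‖(p.1.1 : ℂ) * z + p.1.2‖
  have hw : 0 < w := lt_of_lt_of_le (by positivity) hpR
  have hTR := termSize_pos k m z.im hR
  have hY : 0 < Y := hR.trans_le hRY
  have hδw : R / w ≤ 1 / (1 + δ) := by
    rw [div_le_div_iff₀ hw (by positivity)]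
    linarith
  have hrw : R / w ≤ Y / r * (1 / ‖(p : ℤ × ℤ)‖) := by
    rw [div_mul_div_comm, mul_one]
    gcongr
  calc termSize k m z.im w
      ≤ termSize k m z.im R * (R / w) ^ (κ * k) := termSize_le hz.le hR (by nlinarith) hm
    _ = termSize k m z.im R * ((R / w) ^ (κ * k - 3) * (R / w) ^ 3) := by
        rw [← Real.rpow_natCast, ← Real.rpow_add (by positivity)]
        norm_num
    _ ≤ termSize k m z.im R *
        ((1 / (1 + δ)) ^ (κ * k - 3) * (Y / r * (1 / ‖(p : ℤ × ℤ)‖)) ^ 3) := by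
        gcongr
    _ = _ := by
        rw [mul_pow, one_div_pow]
        ring

instance : InvolutiveNeg CoprimePair where
  neg p := ⟨-p.1, p.2.neg_neg⟩
  neg_neg _ := Subtype.ext (neg_neg _)

open scoped Pointwise in
theorem norm_poincare_sub_sum_le {k m : ℕ} (hk : 3 ≤ k) (hev : Even k) {z : ℂ} (hz : 0 < z.im)
    {F : Finset CoprimePair} (hF : Disjoint F (-F)) {A : ℝ} (hA : 0 ≤ A)
    (h : ∀ p ∉ F, -p ∉ F → ‖term k m p.1.1 p.1.2 z‖ ≤ A * (1 / ‖(p : ℤ × ℤ)‖ ^ 3)) :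
    ‖poincare k m z - ∑ p ∈ F, term k m p.1.1 p.1.2 z‖ ≤
      A * ∑' p : CoprimePair, 1 / ‖(p : ℤ × ℤ)‖ ^ 3 := by
  have hsum : Summable fun p : CoprimePair => A * (1 / ‖(p : ℤ × ℤ)‖ ^ 3) :=
    (summable_one_div_norm_pow le_rfl).mul_left A
  have hneg : ∑ p ∈ -F, term k m p.1.1 p.1.2 z = ∑ p ∈ F, term k m p.1.1 p.1.2 z := by
    rw [Finset.sum_neg_index]
    exact Finset.sum_congr rfl fun p _ => term_neg hev m p.2 hz
  set G : Finset CoprimePair := F ∪ -F with hG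
  have hsplit := (summable_term hk m hz).sum_add_tsum_compl (s := G)
  rw [hG, Finset.sum_union hF, hneg, ← hG] at hsplit
  set tail : ℂ := ∑' p : ((G : Set CoprimePair)ᶜ : Set CoprimePair), term k m p.1.1.1 p.1.1.2 z
  have hrest : poincare k m z - ∑ p ∈ F, term k m p.1.1 p.1.2 z = 1 / 2 * tail := by
    rw [poincare, ← hsplit]
    ring
  have htail_le : ‖tail‖ ≤ A * ∑' p : CoprimePair, 1 / ‖(p : ℤ × ℤ)‖ ^ 3 := by
    rw [← tsum_mul_left]
    refine (tsum_of_norm_bounded (hsum.subtype _).hasSum fun p => ?_).trans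
      (hsum.tsum_subtype_le _ _ fun p => by positivity)
    have hp : p.1 ∉ F ∧ -p.1 ∉ F := by simpa [G] using p.2
    exact h p.1 hp.1 hp.2
  rw [hrest, norm_mul, norm_div, norm_one, Complex.norm_two]
  linarith [norm_nonneg tail]

theorem tendsto_rpow_mul_atTop_nhds_zero {κ q : ℝ} (hκ : 0 < κ) (hq₀ : 0 < q) (hq₁ : q < 1)
    (C : ℝ) : Tendsto (fun k : ℕ => q ^ (κ * k - 3) * C) atTop (𝓝 0) := by
  have hexp : Tendsto (fun k : ℕ => κ * (k : ℝ) - 3) atTop atTop :=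
    tendsto_atTop_add_const_right _ _ (tendsto_natCast_atTop_atTop.const_mul_atTop hκ)
  simpa using ((tendsto_rpow_atTop_of_base_lt_one q (by linarith) hq₁).comp hexp).mul_const C

open scoped Pointwise in
theorem eventually_norm_poincare_sub_sum_le (Y : ℝ) {κ δ η : ℝ} (hκ : 0 < κ) (hδ : 0 < δ)
    (hη : 0 < η) {F : Finset CoprimePair} (hF : Disjoint F (-F)) :
    ∀ᶠ k : ℕ in atTop, Even k → ∀ m : ℕ, ∀ z : ℂ, |z.re| ≤ 1 / 2 → 1 / 2 ≤ z.im →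
      ∀ R : ℝ, 0 < R → R ≤ Y → 4 * Real.pi * m * z.im ≤ (1 - κ) * k * R ^ 2 →
      (∀ p : CoprimePair, p ∉ F → -p ∉ F → (1 + δ) * R ≤ ‖(p.1.1 : ℂ) * z + p.1.2‖) →
      ‖poincare k m z - ∑ p ∈ F, term k m p.1.1 p.1.2 z‖ ≤ η * termSize k m z.im R := by
  obtain ⟨r, hr, hbound⟩ := exists_mul_norm_le_norm_mul_add (1 / 2) (B := 1 / 2) (by norm_num)
  set S := ∑' p : CoprimePair, 1 / ‖(p : ℤ × ℤ)‖ ^ 3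
  have hq₁ : 1 / (1 + δ) < 1 := by
    rw [div_lt_one (by positivity)]
    linarith
  filter_upwards [(tendsto_rpow_mul_atTop_nhds_zero hκ (by positivity) hq₁
      ((Y / r) ^ 3 * S)).eventually_le_const hη,
    (tendsto_natCast_atTop_atTop.const_mul_atTop hκ).eventually_ge_atTop 3,
    eventually_ge_atTop 3] with k hkη hkκ hk hev m z hx hy R hR hRY hm hp
  have hz : 0 < z.im := by linarith
  have hTR := termSize_pos k m z.im hR
  have hY : 0 < Y := hR.trans_le hRY
  refine (norm_poincare_sub_sum_le hk hev hz hF (by positivity) fun p hpF hpF' =>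
    norm_term_le_of_lt hz hR hRY hδ hr hkκ hm p (hp p hpF hpF')
      (hbound z hx hy p.1.1 p.1.2)).trans ?_
  calc termSize k m z.im R * ((1 / (1 + δ)) ^ (κ * k - 3) * (Y / r) ^ 3) * S
      = (1 / (1 + δ)) ^ (κ * k - 3) * ((Y / r) ^ 3 * S) * termSize k m z.im R := by ring
    _ ≤ η * termSize k m z.im R := by gcongr

theorem exists_one_add_mul_le {ε M : ℝ} (hε : 0 < ε) (hM : 0 < M) :
    ∃ δ > 0, ∀ a b : ℝ, 0 < a → a ≤ M → 0 ≤ b → a ^ 2 + ε ≤ b ^ 2 → (1 + δ) * a ≤ b := by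
  refine ⟨min 1 (ε / (3 * M ^ 2)), by positivity, fun a b ha haM hb hab => ?_⟩
  set δ := min 1 (ε / (3 * M ^ 2))
  have hδ₀ : 0 < δ := by positivity
  have hδ₁ : δ ≤ 1 := min_le_left _ _
  have hδM : δ * (3 * M ^ 2) ≤ ε := (le_div_iff₀ (by positivity)).mp (min_le_right _ _)
  have hδa : δ * a ^ 2 ≤ δ * M ^ 2 := by gcongr
  refine (abs_le_of_sq_le_sq' ?_ hb).2
  nlinarith [mul_nonneg hδ₀.le (sub_nonneg.mpr hδ₁), sq_nonneg a]

theorem sq_norm_intCast_mul_add (c d : ℤ) (z : ℂ) :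
    ‖(c : ℂ) * z + d‖ ^ 2 = (c * z.re + d) ^ 2 + (c * z.im) ^ 2 := by
  simp [sq_norm_eq_re_sq_add_im_sq]

theorem sq_norm_add_le_of_ne_zero {δ : ℝ} (hδ : 0 < δ) {z : ℂ} (hx : |z.re| ≤ 1 / 2 - δ)
    (hz : 1 ≤ ‖z‖) {c d : ℤ} (hc : c ≠ 0) (hd : d ≠ 0) :
    ‖z‖ ^ 2 + 2 * δ ≤ ‖(c : ℂ) * z + d‖ ^ 2 := by
  rw [sq_norm_intCast_mul_add, sq_norm_eq_re_sq_add_im_sq]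
  have hz2 : 1 ≤ z.re ^ 2 + z.im ^ 2 := by
    rw [← sq_norm_eq_re_sq_add_im_sq]
    exact one_le_pow₀ hz
  obtain ⟨hx1, hx2⟩ := abs_le.mp hx
  by_cases hc1 : c ^ 2 = 1
  · have hc1' : (c : ℝ) ^ 2 = 1 := by exact_mod_cast hc1
    have hcd : -(|(d : ℝ)| * (1 / 2 - δ)) ≤ c * z.re * d := by
      have hcabs : |(c : ℝ)| = 1 := by
        rwa [← pow_eq_one_iff_of_nonneg (abs_nonneg _) two_ne_zero, sq_abs]
      have habs := neg_abs_le (c * z.re * d)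
      rw [abs_mul, abs_mul, hcabs, one_mul, mul_comm] at habs
      have : |(d : ℝ)| * |z.re| ≤ |(d : ℝ)| * (1 / 2 - δ) := by gcongr
      linarith
    have hd1 : (1 : ℝ) ≤ |(d : ℝ)| := by exact_mod_cast Int.one_le_abs hd
    nlinarith [sq_abs (d : ℝ)]
  · have hc4 : (4 : ℝ) ≤ (c : ℝ) ^ 2 := by
      exact_mod_cast not_lt.mp fun h => hc1 (Int.sq_eq_one_of_sq_lt_four h hc)
    have hcy : 4 * z.im ^ 2 ≤ (c : ℝ) ^ 2 * z.im ^ 2 := by gcongr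
    nlinarith [sq_nonneg ((c : ℝ) * z.re + d)]

theorem sq_norm_add_two_le_of_ne_zero {z : ℂ} (hx : z.re = 1 / 2) (hz : 1 ≤ ‖z‖) {c d : ℤ}
    (hc : c ≠ 0) (hd : d ≠ 0) (hcd : c + d ≠ 0) : ‖z‖ ^ 2 + 2 ≤ ‖(c : ℂ) * z + d‖ ^ 2 := by
  rw [sq_norm_intCast_mul_add, sq_norm_eq_re_sq_add_im_sq, hx]
  have hz2 : 1 ≤ (1 / 2) ^ 2 + z.im ^ 2 := by
    rw [← hx, ← sq_norm_eq_re_sq_add_im_sq]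
    exact one_le_pow₀ hz
  by_cases hc1 : c ^ 2 = 1
  · have hc1' : (c : ℝ) ^ 2 = 1 := by exact_mod_cast hc1
    have hdc : 2 ≤ d * (c + d) := by
      rcases sq_eq_one_iff.mp hc1 with rfl | rfl
      · rcases (by omega : 1 ≤ d ∨ d ≤ -2) with h | h <;> nlinarith
      · rcases (by omega : 2 ≤ d ∨ d ≤ -1) with h | h <;> nlinarith
    have hdc' : (2 : ℝ) ≤ d * (c + d) := by exact_mod_cast hdc
    nlinarith
  · have hc4 : (4 : ℝ) ≤ (c : ℝ) ^ 2 := by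
      exact_mod_cast not_lt.mp fun h => hc1 (Int.sq_eq_one_of_sq_lt_four h hc)
    have hcy : 4 * z.im ^ 2 ≤ (c : ℝ) ^ 2 * z.im ^ 2 := by gcongr
    nlinarith [sq_nonneg ((c : ℝ) * (1 / 2) + d)]

theorem half_le_im_of_one_le_norm {z : ℂ} (hx : |z.re| ≤ 1 / 2) (hz1 : 1 ≤ ‖z‖) (hz : 0 < z.im) :
    1 / 2 ≤ z.im := by
  have : 1 ≤ z.re ^ 2 + z.im ^ 2 := by
    rw [← sq_norm_eq_re_sq_add_im_sq]
    exact one_le_pow₀ hz1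
  nlinarith [abs_le.mp hx]

theorem norm_le_im_add_one {z : ℂ} (hx : |z.re| ≤ 1 / 2) (hz : 0 < z.im) : ‖z‖ ≤ z.im + 1 := by
  have := Complex.norm_le_abs_re_add_abs_im z
  rw [abs_of_pos hz] at this
  linarith

theorem im_le_sq_norm_of_one_le_norm {z : ℂ} (hz : 1 ≤ ‖z‖) : z.im ≤ ‖z‖ ^ 2 :=
  ((le_abs_self _).trans (Complex.abs_im_le_norm z)).trans (by nlinarith)

/-- The pairs `(k, m)` with `k` even and `4 * π * m ≤ (1 - κ) * k`, as `k` tends to infinity. In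
this range the terms of the Poincaré series decay in `‖c * z + d‖` throughout the fundamental
domain. -/
def subcritical (κ : ℝ) : Filter (ℕ × ℕ) :=
  comap Prod.fst atTop ⊓ 𝓟 {p | Even p.1 ∧ 4 * Real.pi * p.2 ≤ (1 - κ) * p.1}

theorem tendsto_fst_subcritical (κ : ℝ) : Tendsto Prod.fst (subcritical κ) atTop :=
  tendsto_comap.mono_left inf_le_left

theorem eventually_mem_subcritical (κ : ℝ) :
    ∀ᶠ p in subcritical κ, Even p.1 ∧ 4 * Real.pi * p.2 ≤ (1 - κ) * p.1 :=
  mem_inf_of_right (mem_principal_self _)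

open scoped Pointwise in
theorem eventually_norm_poincare_sub_sum_le_termSize (Y : ℝ) {κ ε η : ℝ} (hκ : 0 < κ) (hε : 0 < ε)
    (hη : 0 < η) {F : Finset CoprimePair} (hF : Disjoint F (-F)) :
    ∀ᶠ p in subcritical κ, ∀ z : ℂ, |z.re| ≤ 1 / 2 → 1 ≤ ‖z‖ → 0 < z.im → z.im ≤ Y →
      (∀ q : CoprimePair, q ∉ F → -q ∉ F → ‖z‖ ^ 2 + ε ≤ ‖(q.1.1 : ℂ) * z + q.1.2‖ ^ 2) →
      ‖poincare p.1 p.2 z - ∑ q ∈ F, term p.1 p.2 q.1.1 q.1.2 z‖ ≤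
        η * termSize p.1 p.2 z.im ‖z‖ := by
  obtain ⟨δ, hδ, hδM⟩ := exists_one_add_mul_le (M := max Y 0 + 1) hε (by positivity)
  filter_upwards [(tendsto_fst_subcritical κ).eventually
    (eventually_norm_poincare_sub_sum_le (max Y 0 + 1) hκ hδ hη hF), eventually_mem_subcritical κ]
    with p hp hpκ z hx hz1 hz hzY hF'
  have hzM : ‖z‖ ≤ max Y 0 + 1 := (norm_le_im_add_one hx hz).trans (by grind)
  have hzpos : 0 < ‖z‖ := by linarith
  refine hp hpκ.1 p.2 z hx (half_le_im_of_one_le_norm hx hz1 hz) ‖z‖ hzpos hzM ?_ fun q hq hq' =>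
    hδM _ _ hzpos hzM (norm_nonneg _) (hF' q hq hq')
  calc 4 * Real.pi * p.2 * z.im ≤ 4 * Real.pi * p.2 * ‖z‖ ^ 2 := by
        gcongr
        exact im_le_sq_norm_of_one_le_norm hz1
    _ ≤ (1 - κ) * p.1 * ‖z‖ ^ 2 := by
        exact mul_le_mul_of_nonneg_right hpκ.2 (by positivity)

theorem term_zero_one (k m : ℕ) {z : ℂ} (hz : 0 < z.im) :
    term k m 0 1 z = Complex.exp (2 * Real.pi * Complex.I * m * z) := by
  rw [term_eq k m (a := 1) (b := 0) (by norm_num) hz]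
  simp

theorem term_one_zero (k m : ℕ) {z : ℂ} (hz : 0 < z.im) :
    term k m 1 0 z = Complex.exp (2 * Real.pi * Complex.I * m * (-1 / z)) / z ^ k := by
  rw [term_eq k m (a := 0) (b := -1) (by norm_num) hz]
  simp

theorem term_one_neg_one (k m : ℕ) {z : ℂ} (hz : 0 < z.im) :
    term k m 1 (-1) z =
      Complex.exp (2 * Real.pi * Complex.I * m * (-1 / (z - 1))) / (z - 1) ^ k := by
  rw [term_eq k m (a := 0) (b := -1) (by norm_num) hz]
  simp [sub_eq_add_neg]

theorem eq_or_eq_neg_of_mul_eq_mul {p q : CoprimePair} (h : p.1.1 * q.1.2 = p.1.2 * q.1.1) :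
    q = p ∨ -q = p := by
  obtain ⟨u, v, huv⟩ := p.2
  set n := u * q.1.1 + v * q.1.2 with hn
  have hc : q.1.1 = n * p.1.1 := by linear_combination -q.1.1 * huv - v * h - p.1.1 * hn
  have hd : q.1.2 = n * p.1.2 := by linear_combination -q.1.2 * huv + u * h - p.1.2 * hn
  have hunit : IsUnit n := q.2.isUnit_of_dvd' ⟨_, hc⟩ ⟨_, hd⟩
  rcases Int.isUnit_iff.mp hunit with h1 | h1
  · exact .inl (Subtype.ext (Prod.ext (by rw [hc, h1, one_mul]) (by rw [hd, h1, one_mul])))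
  · refine .inr (Subtype.ext (Prod.ext ?_ ?_))
    · change -q.1.1 = p.1.1
      rw [hc, h1, neg_one_mul, neg_neg]
    · change -q.1.2 = p.1.2
      rw [hd, h1, neg_one_mul, neg_neg]

theorem mul_ne_mul_of_notMem {F : Finset CoprimePair} {p q : CoprimePair} (hp : p ∈ F)
    (hq : q ∉ F) (hq' : -q ∉ F) : p.1.1 * q.1.2 ≠ p.1.2 * q.1.1 := fun h =>
  (eq_or_eq_neg_of_mul_eq_mul h).elim (fun h' => hq (h' ▸ hp)) fun h' => hq' (h' ▸ hp)

theorem eventually_norm_poincare_sub_le (Y : ℝ) {κ δ η : ℝ} (hκ : 0 < κ) (hδ : 0 < δ)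
    (hη : 0 < η) :
    ∀ᶠ p in subcritical κ, ∀ z : ℂ, |z.re| ≤ 1 / 2 - δ → 1 ≤ ‖z‖ → 0 < z.im → z.im ≤ Y →
      ‖poincare p.1 p.2 z - (term p.1 p.2 0 1 z + term p.1 p.2 1 0 z)‖ ≤
        η * termSize p.1 p.2 z.im ‖z‖ := by
  let q₁ : CoprimePair := ⟨(0, 1), isCoprime_one_right⟩
  let q₂ : CoprimePair := ⟨(1, 0), isCoprime_one_left⟩
  filter_upwards [eventually_norm_poincare_sub_sum_le_termSize Y hκ (ε := 2 * δ) (by positivity) hη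
    (F := {q₁, q₂}) (by decide)] with p hp z hx hz1 hz hzY
  have happrox := hp z (by linarith) hz1 hz hzY fun q hq hq' => by
    have h₁ := mul_ne_mul_of_notMem (p := q₁) (by simp) hq hq'
    have h₂ := mul_ne_mul_of_notMem (p := q₂) (by simp) hq hq'
    exact sq_norm_add_le_of_ne_zero hδ hx hz1 (by grind) (by grind)
  rwa [Finset.sum_pair (by decide)] at happrox

theorem eventually_norm_poincare_sub_le_of_re_eq_half (Y : ℝ) {κ η : ℝ} (hκ : 0 < κ)
    (hη : 0 < η) :
    ∀ᶠ p in subcritical κ, ∀ z : ℂ, z.re = 1 / 2 → 1 ≤ ‖z‖ → 0 < z.im → z.im ≤ Y →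
      ‖poincare p.1 p.2 z - (term p.1 p.2 0 1 z + (term p.1 p.2 1 0 z + term p.1 p.2 1 (-1) z))‖ ≤
        η * termSize p.1 p.2 z.im ‖z‖ := by
  let q₁ : CoprimePair := ⟨(0, 1), isCoprime_one_right⟩
  let q₂ : CoprimePair := ⟨(1, 0), isCoprime_one_left⟩
  let q₃ : CoprimePair := ⟨(1, -1), isCoprime_one_left⟩
  filter_upwards [eventually_norm_poincare_sub_sum_le_termSize Y hκ two_pos hη
    (F := {q₁, q₂, q₃}) (by decide)] with p hp z hx hz1 hz hzY
  have happrox := hp z (by norm_num [hx]) hz1 hz hzY fun q hq hq' => by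
    have h₁ := mul_ne_mul_of_notMem (p := q₁) (by simp) hq hq'
    have h₂ := mul_ne_mul_of_notMem (p := q₂) (by simp) hq hq'
    have h₃ := mul_ne_mul_of_notMem (p := q₃) (by simp) hq hq'
    exact sq_norm_add_two_le_of_ne_zero hx hz1 (by grind) (by grind) (by grind)
  rwa [Finset.sum_insert (by decide), Finset.sum_pair (by decide)] at happrox

/-! ### Zeros on the unit circle -/

theorem exists_mem_Ioo_eq_zero_of_mul_neg {f : ℝ → ℝ} {a b : ℝ} (hab : a ≤ b)
    (hf : ContinuousOn f (Set.Icc a b)) (h : f a * f b < 0) : ∃ t ∈ Set.Ioo a b, f t = 0 := by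
  rcases mul_neg_iff.mp h with ⟨ha, hb⟩ | ⟨ha, hb⟩
  · exact intermediate_value_Ioo' hab hf ⟨hb, ha⟩
  · exact intermediate_value_Ioo hab hf ⟨ha, hb⟩

theorem exists_zeros_of_phase_eq {f φ A : ℝ → ℝ} {a : ℝ} (p : ℤ) (N : ℕ) {b : ℝ} (hab : a ≤ b)
    (hf : ContinuousOn f (Set.Icc a b)) (hφ : ContinuousOn φ (Set.Icc a b))
    (hA : ∀ t ∈ Set.Icc a b, |f t - A t * Real.cos (φ t)| < A t) (ha : φ a ≤ p * Real.pi)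
    (hb : φ b = (p + N) * Real.pi) :
    ∃ Z : Finset ℝ, (∀ t ∈ Z, t ∈ Set.Ioo a b ∧ f t = 0) ∧ Z.card = N := by
  induction N generalizing b with
  | zero => exact ⟨∅, by simp, rfl⟩
  | succ N ih =>
    push_cast at hb
    have hNpi : (0 : ℝ) ≤ N * Real.pi := by positivity
    obtain ⟨s, ⟨has, hsb⟩, hs⟩ := intermediate_value_Icc hab hφ
      (show (p + N) * Real.pi ∈ Set.Icc (φ a) (φ b) from
        ⟨by linarith, by linarith [Real.pi_pos]⟩)
    have hsub : Set.Icc a s ⊆ Set.Icc a b := Set.Icc_subset_Icc_right hsb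
    obtain ⟨Z, hZ, hcard⟩ := ih has (hf.mono hsub) (hφ.mono hsub) (fun t ht => hA t (hsub ht)) hs
    have hcos : Real.cos (φ b) = -Real.cos (φ s) := by
      rw [hs, hb, ← Real.cos_add_pi]
      ring_nf
    have hcos1 : Real.cos (φ s) = 1 ∨ Real.cos (φ s) = -1 := by
      have := Real.cos_int_mul_pi (p + N)
      push_cast at this
      rw [hs, this]
      exact (Int.even_or_odd (p + N)).imp Even.neg_one_zpow Odd.neg_one_zpow
    have hsign : f s * f b < 0 := by
      have h₁ := abs_lt.mp (hA s ⟨has, hsb⟩)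
      have h₂ := abs_lt.mp (hA b ⟨hab, le_rfl⟩)
      rw [hcos] at h₂
      rcases hcos1 with h | h <;> rw [h] at h₁ h₂
      · exact mul_neg_of_pos_of_neg (by linarith) (by linarith)
      · exact mul_neg_of_neg_of_pos (by linarith) (by linarith)
    obtain ⟨t, ht, ht0⟩ := exists_mem_Ioo_eq_zero_of_mul_neg hsb
      (hf.mono (Set.Icc_subset_Icc_left has)) hsign
    have htZ : t ∉ Z := fun h => ((hZ t h).1.2.trans ht.1).false
    refine ⟨insert t Z, fun u hu => ?_, by rw [Finset.card_insert_of_notMem htZ, hcard]⟩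
    rcases Finset.mem_insert.mp hu with rfl | hu
    · exact ⟨⟨has.trans_lt ht.1, ht.2⟩, ht0⟩
    · exact ⟨⟨(hZ u hu).1.1, (hZ u hu).1.2.trans_le hsb⟩, (hZ u hu).2⟩

theorem exists_zeros_of_cos_approx {f φ A : ℝ → ℝ} {a b : ℝ} (hab : a ≤ b)
    (hf : ContinuousOn f (Set.Icc a b)) (hφ : ContinuousOn φ (Set.Icc a b))
    (hA : ∀ t ∈ Set.Icc a b, |f t - A t * Real.cos (φ t)| < A t) :
    ∃ Z : Finset ℝ, (∀ t ∈ Z, t ∈ Set.Ioo a b ∧ f t = 0) ∧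
      (φ b - φ a) / Real.pi - 2 ≤ (Z.card : ℝ) := by
  set p : ℤ := ⌈φ a / Real.pi⌉
  set q : ℤ := ⌊φ b / Real.pi⌋
  have hp : φ a ≤ p * Real.pi := (div_le_iff₀ Real.pi_pos).mp (Int.le_ceil _)
  have hq : q * Real.pi ≤ φ b := (le_div_iff₀ Real.pi_pos).mp (Int.floor_le _)
  have hpq : (φ b - φ a) / Real.pi - 2 ≤ (q - p : ℤ) := by
    rw [sub_div]
    push_cast
    linarith [Int.ceil_lt_add_one (φ a / Real.pi), Int.sub_one_lt_floor (φ b / Real.pi)]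
  rcases lt_or_ge q p with hlt | hle
  · have : ((q - p : ℤ) : ℝ) ≤ 0 := by exact_mod_cast (sub_neg.mpr hlt).le
    exact ⟨∅, by simp, by simpa using hpq.trans this⟩
  obtain ⟨N, hN⟩ := Int.eq_ofNat_of_zero_le (sub_nonneg.mpr hle)
  have hqN : (q : ℝ) = p + N := by exact_mod_cast (by lia : q = p + N)
  have hpqpi : p * Real.pi ≤ q * Real.pi := by gcongr
  obtain ⟨s, ⟨has, hsb⟩, hs⟩ := intermediate_value_Icc hab hφ
    (show q * Real.pi ∈ Set.Icc (φ a) (φ b) from ⟨hp.trans hpqpi, hq⟩)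
  have hsub : Set.Icc a s ⊆ Set.Icc a b := Set.Icc_subset_Icc_right hsb
  obtain ⟨Z, hZ, hcard⟩ := exists_zeros_of_phase_eq p N has (hf.mono hsub) (hφ.mono hsub)
    (fun t ht => hA t (hsub ht)) hp (hs.trans (by rw [hqN]))
  refine ⟨Z, fun t ht => ⟨⟨(hZ t ht).1.1, (hZ t ht).1.2.trans_le hsb⟩, (hZ t ht).2⟩, ?_⟩
  rw [hcard]
  exact hpq.trans_eq (by rw [hN, Int.cast_natCast])

theorem exists_zeros_on_curve_of_cos_approx {g : ℂ → ℂ} {E z : ℝ → ℂ} {φ A : ℝ → ℝ} {a b : ℝ}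
    (hab : a ≤ b) (hE : ContinuousOn E (Set.Icc a b)) (hE₀ : ∀ t, E t ≠ 0)
    (hg : ContinuousOn (fun t => g (z t)) (Set.Icc a b)) (hφ : ContinuousOn φ (Set.Icc a b))
    (hz : Set.InjOn z (Set.Icc a b)) (hreal : ∀ t ∈ Set.Icc a b, (E t * g (z t)).im = 0)
    (hA : ∀ t ∈ Set.Icc a b, |(E t * g (z t)).re - A t * Real.cos (φ t)| < A t) :
    ∃ Z : Finset ℂ, (∀ w ∈ Z, g w = 0 ∧ w ∈ z '' Set.Ioo a b) ∧
      (φ b - φ a) / Real.pi - 2 ≤ (Z.card : ℝ) := by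
  classical
  obtain ⟨Z, hZ, hcard⟩ := exists_zeros_of_cos_approx (f := fun t => (E t * g (z t)).re) hab
    (Complex.continuous_re.comp_continuousOn (hE.mul hg)) hφ hA
  have hZ' : ∀ t ∈ Z, t ∈ Set.Icc a b := fun t ht => Set.Ioo_subset_Icc_self (hZ t ht).1
  refine ⟨Z.image z, fun w hw => ?_, ?_⟩
  · obtain ⟨t, ht, rfl⟩ := Finset.mem_image.mp hw
    have hzero : E t * g (z t) = 0 := Complex.ext (hZ t ht).2 (hreal t (hZ' t ht))
    exact ⟨(mul_eq_zero.mp hzero).resolve_left (hE₀ t), t, (hZ t ht).1, rfl⟩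
  · rwa [Finset.card_image_of_injOn (hz.mono hZ')]

theorem poincare_neg_inv (k m : ℕ) {z : ℂ} (hz : 0 < z.im) :
    poincare k m (-1 / z) = z ^ k * poincare k m z := by
  lift z to UpperHalfPlane using hz
  have := poincare_smul k m ModularGroup.S z
  rw [UpperHalfPlane.modular_S_smul] at this
  rw [neg_div, one_div, ← inv_neg]
  simpa [ModularGroup.S] using this

theorem poincare_sub_one (k m : ℕ) {z : ℂ} (hz : 0 < z.im) :
    poincare k m (z - 1) = poincare k m z := by
  lift z to UpperHalfPlane using hz
  have := poincare_smul k m (ModularGroup.T ^ (-1 : ℤ)) z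
  rw [UpperHalfPlane.modular_T_zpow_smul, ModularGroup.coe_T_zpow] at this
  simpa [← sub_eq_neg_add] using this

theorem conj_two_pi_I_mul (m : ℕ) (z : ℂ) :
    starRingEnd ℂ (2 * Real.pi * Complex.I * m * z) =
      2 * Real.pi * Complex.I * m * (-starRingEnd ℂ z) := by
  simp only [map_mul, map_ofNat, Complex.conj_ofReal, Complex.conj_I, map_natCast]
  ring

theorem neg_one_div_eq_neg_conj {z : ℂ} (hz : ‖z‖ = 1) : -1 / z = -starRingEnd ℂ z := by
  rw [neg_div, one_div, Complex.inv_eq_conj hz]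

/-- The phase of `exp (k * θ / 2 * I) * term k m 0 1 z` at the point `z = exp (θ * I)` of the unit
circle. -/
noncomputable def arcPhase (k m : ℕ) (θ : ℝ) : ℝ :=
  k * θ / 2 + 2 * Real.pi * m * Real.cos θ

section Arc

variable (k m : ℕ) {θ : ℝ} (hθ : 0 < Real.sin θ)
include hθ

theorem im_exp_mul_poincare_eq_zero :
    (Complex.exp ((k * θ / 2 : ℝ) * Complex.I) *
      poincare k m (Complex.exp (θ * Complex.I))).im = 0 := by
  have hz : 0 < (Complex.exp (θ * Complex.I)).im := by rwa [Complex.exp_ofReal_mul_I_im]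
  rw [← Complex.conj_eq_iff_im, map_mul, ← poincare_neg_conj k m hz,
    ← neg_one_div_eq_neg_conj (Complex.norm_exp_ofReal_mul_I θ), poincare_neg_inv k m hz,
    ← Complex.exp_conj, ← mul_assoc, ← Complex.exp_nat_mul, ← Complex.exp_add]
  congr 2
  simp only [map_mul, Complex.conj_ofReal, Complex.conj_I]
  push_cast
  ring

theorem exp_mul_term_zero_one :
    Complex.exp ((k * θ / 2 : ℝ) * Complex.I) * term k m 0 1 (Complex.exp (θ * Complex.I)) =
      (Real.exp (-(2 * Real.pi * m * Real.sin θ)) : ℝ) *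
        Complex.exp (arcPhase k m θ * Complex.I) := by
  rw [term_zero_one k m (by rwa [Complex.exp_ofReal_mul_I_im]), Complex.ofReal_exp,
    ← Complex.exp_add, ← Complex.exp_add, Complex.exp_mul_I, arcPhase]
  congr 1
  push_cast
  linear_combination (2 * Real.pi * m * Complex.sin θ : ℂ) * Complex.I_sq

theorem exp_mul_term_one_zero :
    Complex.exp ((k * θ / 2 : ℝ) * Complex.I) * term k m 1 0 (Complex.exp (θ * Complex.I)) =
      starRingEnd ℂ (Complex.exp ((k * θ / 2 : ℝ) * Complex.I) *
        term k m 0 1 (Complex.exp (θ * Complex.I))) := by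
  have hz : 0 < (Complex.exp (θ * Complex.I)).im := by rwa [Complex.exp_ofReal_mul_I_im]
  rw [term_one_zero k m hz, term_zero_one k m hz, map_mul, ← Complex.exp_conj, ← Complex.exp_conj,
    conj_two_pi_I_mul, ← neg_one_div_eq_neg_conj (Complex.norm_exp_ofReal_mul_I θ),
    mul_div_assoc', mul_comm, mul_div_assoc, mul_comm, ← Complex.exp_nat_mul, ← Complex.exp_sub]
  congr 2
  simp only [map_mul, Complex.conj_ofReal, Complex.conj_I]
  push_cast
  ring

theorem re_exp_mul_term_add_term :
    (Complex.exp ((k * θ / 2 : ℝ) * Complex.I) * (term k m 0 1 (Complex.exp (θ * Complex.I)) +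
      term k m 1 0 (Complex.exp (θ * Complex.I)))).re =
      2 * Real.exp (-(2 * Real.pi * m * Real.sin θ)) * Real.cos (arcPhase k m θ) := by
  rw [mul_add, exp_mul_term_one_zero k m hθ, Complex.add_re, Complex.conj_re,
    exp_mul_term_zero_one k m hθ, Complex.re_ofReal_mul, Complex.exp_ofReal_mul_I_re]
  ring

end Arc

theorem eventually_abs_re_exp_mul_poincare_sub_lt {κ a : ℝ} (hκ : 0 < κ) (ha : Real.pi / 3 < a) :
    ∀ᶠ p in subcritical κ, ∀ θ ∈ Set.Icc a (Real.pi / 2),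
      |(Complex.exp ((p.1 * θ / 2 : ℝ) * Complex.I) *
          poincare p.1 p.2 (Complex.exp (θ * Complex.I))).re -
        2 * Real.exp (-(2 * Real.pi * p.2 * Real.sin θ)) * Real.cos (arcPhase p.1 p.2 θ)| <
        2 * Real.exp (-(2 * Real.pi * p.2 * Real.sin θ)) := by
  have := Real.pi_pos
  rcases lt_or_ge (Real.pi / 2) a with ha' | ha'
  · simp [Set.Icc_eq_empty_of_lt ha']
  have hcosa : Real.cos a < 1 / 2 := by
    rw [← Real.cos_pi_div_three]
    exact Real.cos_lt_cos_of_nonneg_of_le_pi (by positivity) (by linarith) ha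
  filter_upwards [eventually_norm_poincare_sub_le 1 hκ (δ := 1 / 2 - Real.cos a)
    (by linarith) one_pos] with p hp θ hθ
  have hsin : 0 < Real.sin θ := Real.sin_pos_of_pos_of_lt_pi (by linarith [hθ.1])
    (by linarith [hθ.2])
  have hcos : |Real.cos θ| ≤ Real.cos a := by
    rw [abs_of_nonneg (Real.cos_nonneg_of_neg_pi_div_two_le_of_le (by linarith [hθ.1]) hθ.2)]
    exact Real.cos_le_cos_of_nonneg_of_le_pi (by linarith) (by linarith [hθ.2]) hθ.1
  have happrox := hp (Complex.exp (θ * Complex.I))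
  rw [Complex.exp_ofReal_mul_I_re, Complex.exp_ofReal_mul_I_im,
    Complex.norm_exp_ofReal_mul_I] at happrox
  rw [← re_exp_mul_term_add_term p.1 p.2 hsin, ← Complex.sub_re, ← mul_sub]
  calc _ ≤ _ := Complex.abs_re_le_norm _
    _ ≤ 1 * termSize p.1 p.2 (Real.sin θ) 1 := by
        rw [norm_mul, Complex.norm_exp_ofReal_mul_I, one_mul]
        exact happrox (by linarith) le_rfl hsin (Real.sin_le_one θ)
    _ < _ := by
        simp only [termSize, one_pow, div_one]
        linarith [Real.exp_pos (-(2 * Real.pi * p.2 * Real.sin θ))]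

theorem exists_arcPhase_sub_le {ε : ℝ} (hε : 0 < ε) :
    ∃ a ∈ Set.Ioo (Real.pi / 3) (Real.pi / 2), ∀ k m : ℕ,
      (1 / 12 - ε) * k - m ≤ (arcPhase k m (Real.pi / 2) - arcPhase k m a) / Real.pi := by
  have := Real.pi_pos
  set δ : ℝ := min ε (Real.pi / 12)
  have hδ : 0 < δ := by positivity
  have hδε : δ ≤ ε := min_le_left _ _
  have hδ1 : δ ≤ Real.pi / 12 := min_le_right _ _
  refine ⟨Real.pi / 3 + δ, ⟨by linarith, by linarith⟩, fun k m => ?_⟩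
  have hcosa : Real.cos (Real.pi / 3 + δ) ≤ 1 / 2 := by
    rw [← Real.cos_pi_div_three]
    exact Real.cos_le_cos_of_nonneg_of_le_pi (by positivity) (by linarith) (by linarith)
  have hm : (m : ℝ) * Real.cos (Real.pi / 3 + δ) ≤ m * (1 / 2) := by gcongr
  have hk : k * δ / (2 * Real.pi) ≤ k * ε := by
    rw [div_le_iff₀ (by positivity), mul_assoc]
    exact mul_le_mul_of_nonneg_left (by nlinarith [Real.pi_gt_three]) (by positivity)
  have heq : (arcPhase k m (Real.pi / 2) - arcPhase k m (Real.pi / 3 + δ)) / Real.pi =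
      (k : ℝ) / 12 - k * δ / (2 * Real.pi) - 2 * (m * Real.cos (Real.pi / 3 + δ)) := by
    rw [arcPhase, arcPhase, Real.cos_pi_div_two]
    field
  rw [heq]
  linarith

theorem eventually_exists_zeros_arc {κ ε : ℝ} (hκ : 0 < κ) (hε : 0 < ε) :
    ∀ᶠ p in subcritical κ, ∃ Z : Finset ℂ, (∀ z ∈ Z, poincare p.1 p.2 z = 0 ∧ 0 < z.im ∧
      ‖z‖ = 1 ∧ 0 < z.re ∧ z.re < 1 / 2) ∧ (1 / 12 - ε) * p.1 - p.2 - 2 ≤ (Z.card : ℝ) := by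
  have := Real.pi_pos
  obtain ⟨a, ⟨ha, ha'⟩, hcount⟩ := exists_arcPhase_sub_le hε
  filter_upwards [eventually_abs_re_exp_mul_poincare_sub_lt hκ ha,
    (tendsto_fst_subcritical κ).eventually_ge_atTop 3] with ⟨k, m⟩ hmain hk
  have hsin : ∀ θ ∈ Set.Icc a (Real.pi / 2), 0 < Real.sin θ := fun θ hθ =>
    Real.sin_pos_of_pos_of_lt_pi (by linarith [hθ.1]) (by linarith [hθ.2])
  have hinj : Set.InjOn (fun θ : ℝ => Complex.exp (θ * Complex.I)) (Set.Icc a (Real.pi / 2)) := by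
    intro θ hθ θ' hθ' h
    have hcos := congrArg Complex.re h
    simp only [Complex.exp_ofReal_mul_I_re] at hcos
    exact Real.injOn_cos ⟨by linarith [hθ.1], by linarith [hθ.2]⟩
      ⟨by linarith [hθ'.1], by linarith [hθ'.2]⟩ hcos
  obtain ⟨Z, hZ, hcard⟩ := exists_zeros_on_curve_of_cos_approx (g := poincare k m)
    (E := fun θ => Complex.exp ((k * θ / 2 : ℝ) * Complex.I))
    (z := fun θ => Complex.exp (θ * Complex.I)) (φ := arcPhase k m) ha'.le
    (by fun_prop) (fun _ => Complex.exp_ne_zero _)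
    (fun θ hθ => ((continuousAt_poincare hk m
      (by rw [Complex.exp_ofReal_mul_I_im]; exact hsin θ hθ)).comp_of_eq
      (by fun_prop) rfl).continuousWithinAt) (by unfold arcPhase; fun_prop) hinj
    (fun θ hθ => im_exp_mul_poincare_eq_zero k m (hsin θ hθ)) hmain
  refine ⟨Z, fun w hw => ?_, by linarith [hcount k m]⟩
  obtain ⟨hw0, θ, hθ, rfl⟩ := hZ w hw
  refine ⟨hw0, ?_, Complex.norm_exp_ofReal_mul_I θ, ?_, ?_⟩
  · rw [Complex.exp_ofReal_mul_I_im]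
    exact hsin θ (Set.Ioo_subset_Icc_self hθ)
  · rw [Complex.exp_ofReal_mul_I_re]
    exact Real.cos_pos_of_mem_Ioo ⟨by linarith [hθ.1], hθ.2⟩
  · rw [Complex.exp_ofReal_mul_I_re, ← Real.cos_pi_div_three]
    exact Real.cos_lt_cos_of_nonneg_of_le_pi (by positivity) (by linarith [hθ.2])
      (ha.trans hθ.1)

/-! ### Zeros on the line `Re z = 1 / 2` -/

theorem sq_norm_mk_half (t : ℝ) : ‖(⟨1 / 2, t⟩ : ℂ)‖ ^ 2 = 1 / 4 + t ^ 2 := by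
  rw [sq_norm_eq_re_sq_add_im_sq]
  norm_num

theorem mk_half_ne_zero (t : ℝ) : (⟨1 / 2, t⟩ : ℂ) ≠ 0 := fun h => by
  simpa using congrArg Complex.re h

theorem mk_half_sub_one (t : ℝ) : (⟨1 / 2, t⟩ : ℂ) - 1 = -starRingEnd ℂ ⟨1 / 2, t⟩ := by
  apply Complex.ext <;> norm_num

theorem arg_mk_half (t : ℝ) : (⟨1 / 2, t⟩ : ℂ).arg = Real.arctan (2 * t) := by
  have harg : |(⟨1 / 2, t⟩ : ℂ).arg| < Real.pi / 2 :=
    Complex.abs_arg_lt_pi_div_two_iff.mpr (.inl (by norm_num))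
  rw [show 2 * t = t / (1 / 2) by ring, ← Complex.tan_arg ⟨1 / 2, t⟩,
    Real.arctan_tan (abs_lt.mp harg).1 (abs_lt.mp harg).2]

theorem log_mk_half (t : ℝ) :
    Complex.log ⟨1 / 2, t⟩ = Real.log ‖(⟨1 / 2, t⟩ : ℂ)‖ + Real.arctan (2 * t) * Complex.I := by
  rw [Complex.log, arg_mk_half]

/-- The phase of the complex conjugate of `term k m 1 0 (1 / 2 + t * I)`. -/
noncomputable def linePhase (k m : ℕ) (t : ℝ) : ℝ :=
  k * Real.arctan (2 * t) + Real.pi * m / (1 / 4 + t ^ 2)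

theorem continuous_linePhase (k m : ℕ) : Continuous (linePhase k m) := by
  have : Continuous fun t : ℝ => Real.pi * m / (1 / 4 + t ^ 2) :=
    continuous_const.div (by fun_prop) fun t => by positivity
  unfold linePhase
  fun_prop

section Line

variable (k m : ℕ) {t : ℝ} (ht : 0 < t)
include ht

theorem re_term_one_zero_mk_half :
    (term k m 1 0 ⟨1 / 2, t⟩).re =
      termSize k m t ‖(⟨1 / 2, t⟩ : ℂ)‖ * Real.cos (linePhase k m t) := by
  have hv : (1 / 4 + (t : ℂ) ^ 2) ≠ 0 := by
    simpa using Complex.ofReal_ne_zero.mpr (by positivity : 1 / 4 + t ^ 2 ≠ 0)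
  have hinv : -1 / (⟨1 / 2, t⟩ : ℂ) = (-(1 / 2) + t * Complex.I) / (1 / 4 + (t : ℂ) ^ 2) := by
    rw [div_eq_div_iff (mk_half_ne_zero t) hv, Complex.mk_eq_add_mul_I]
    push_cast
    linear_combination -(t : ℂ) ^ 2 * Complex.I_sq
  have hexp : 2 * Real.pi * Complex.I * m * (-1 / ⟨1 / 2, t⟩) - k * Complex.log ⟨1 / 2, t⟩ =
      ((-(2 * Real.pi * m * (t / ‖(⟨1 / 2, t⟩ : ℂ)‖ ^ 2)) -
        k * Real.log ‖(⟨1 / 2, t⟩ : ℂ)‖ : ℝ) : ℂ) + (-linePhase k m t : ℝ) * Complex.I := by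
    rw [hinv, log_mk_half, sq_norm_mk_half, linePhase]
    push_cast
    linear_combination (2 * Real.pi * m * t / (1 / 4 + (t : ℂ) ^ 2)) * Complex.I_sq
  rw [term_one_zero k m ht, ← Complex.exp_log (mk_half_ne_zero t), ← Complex.exp_nat_mul,
    ← Complex.exp_sub, Complex.exp_log (mk_half_ne_zero t), hexp, Complex.exp_add,
    ← Complex.ofReal_exp, Complex.re_ofReal_mul, Complex.exp_ofReal_mul_I_re, Real.cos_neg,
    termSize_eq_exp _ _ _ (norm_pos_iff.mpr (mk_half_ne_zero t))]

theorem im_poincare_mk_half : (poincare k m ⟨1 / 2, t⟩).im = 0 := by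
  rw [← Complex.conj_eq_iff_im, ← poincare_neg_conj k m (z := ⟨1 / 2, t⟩) ht, ← mk_half_sub_one,
    poincare_sub_one k m (z := ⟨1 / 2, t⟩) ht]

theorem term_one_neg_one_mk_half {k : ℕ} (hk : Even k) :
    term k m 1 (-1) ⟨1 / 2, t⟩ = starRingEnd ℂ (term k m 1 0 ⟨1 / 2, t⟩) := by
  rw [term_one_neg_one k m ht, term_one_zero k m ht, map_div₀, ← Complex.exp_conj,
    conj_two_pi_I_mul, mk_half_sub_one, map_div₀, map_neg, map_one, map_pow, hk.neg_pow,
    neg_div_neg_eq, ← neg_div, neg_neg]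

-- The hypothesis says that the decay of `term k m 0 1` beats that of `term k m 1 0`.
theorem norm_term_zero_one_mk_half_le
    (h : k * Real.log (1 / 4 + t ^ 2) / 2 ≤ 2 * Real.pi * m * (t - t / (1 / 4 + t ^ 2))) :
    ‖term k m 0 1 ⟨1 / 2, t⟩‖ ≤ termSize k m t ‖(⟨1 / 2, t⟩ : ℂ)‖ := by
  have hre : (2 * Real.pi * Complex.I * m * (⟨1 / 2, t⟩ : ℂ)).re = -(2 * Real.pi * m * t) := by
    simp
  have hlog : Real.log ‖(⟨1 / 2, t⟩ : ℂ)‖ = Real.log (1 / 4 + t ^ 2) / 2 := by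
    rw [← sq_norm_mk_half, Real.log_pow]
    push_cast
    ring
  rw [term_zero_one k m ht, Complex.norm_exp, hre,
    termSize_eq_exp _ _ _ (norm_pos_iff.mpr (mk_half_ne_zero t)), Real.exp_le_exp,
    sq_norm_mk_half, hlog]
  linarith

end Line

theorem one_le_norm_mk_half {t : ℝ} (ht : √3 / 2 ≤ t) : 1 ≤ ‖(⟨1 / 2, t⟩ : ℂ)‖ := by
  rw [← one_le_sq_iff₀ (norm_nonneg _), sq_norm_mk_half]
  have : (√3 / 2) ^ 2 ≤ t ^ 2 := by gcongr
  rw [div_pow, Real.sq_sqrt (by norm_num)] at this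
  linarith

theorem eventually_abs_re_poincare_mk_half_sub_lt (Y : ℝ) {κ : ℝ} (hκ : 0 < κ) :
    ∀ᶠ p in subcritical κ, ∀ t : ℝ, √3 / 2 ≤ t → t ≤ Y →
      p.1 * Real.log (1 / 4 + t ^ 2) / 2 ≤ 2 * Real.pi * p.2 * (t - t / (1 / 4 + t ^ 2)) →
      |(poincare p.1 p.2 ⟨1 / 2, t⟩).re -
        2 * termSize p.1 p.2 t ‖(⟨1 / 2, t⟩ : ℂ)‖ * Real.cos (linePhase p.1 p.2 t)| <
        2 * termSize p.1 p.2 t ‖(⟨1 / 2, t⟩ : ℂ)‖ := by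
  filter_upwards [eventually_norm_poincare_sub_le_of_re_eq_half Y hκ (η := 1 / 2) (by norm_num),
    eventually_mem_subcritical κ] with ⟨k, m⟩ hp hpκ t ht htY hdom
  have ht₀ : 0 < t := lt_of_lt_of_le (by positivity) ht
  set T₀ := term k m 0 1 ⟨1 / 2, t⟩
  set T₁ := term k m 1 0 ⟨1 / 2, t⟩
  set T₂ := term k m 1 (-1) ⟨1 / 2, t⟩
  have happrox : ‖poincare k m ⟨1 / 2, t⟩ - (T₀ + (T₁ + T₂))‖ ≤
      1 / 2 * termSize k m t ‖(⟨1 / 2, t⟩ : ℂ)‖ :=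
    hp ⟨1 / 2, t⟩ rfl (one_le_norm_mk_half ht) ht₀ htY
  have hmain : 2 * termSize k m t ‖(⟨1 / 2, t⟩ : ℂ)‖ * Real.cos (linePhase k m t) =
      (T₁ + T₂).re := by
    rw [Complex.add_re, show T₂ = starRingEnd ℂ T₁ from term_one_neg_one_mk_half m ht₀ hpκ.1,
      Complex.conj_re, re_term_one_zero_mk_half k m ht₀]
    ring
  rw [hmain, ← Complex.sub_re]
  calc _ ≤ ‖poincare k m ⟨1 / 2, t⟩ - (T₁ + T₂)‖ := Complex.abs_re_le_norm _
    _ = ‖(poincare k m ⟨1 / 2, t⟩ - (T₀ + (T₁ + T₂))) + T₀‖ := by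
        congr 1
        ring
    _ ≤ 1 / 2 * termSize k m t ‖(⟨1 / 2, t⟩ : ℂ)‖ + termSize k m t ‖(⟨1 / 2, t⟩ : ℂ)‖ :=
        norm_add_le_of_le happrox (norm_term_zero_one_mk_half_le k m ht₀ hdom)
    _ < 2 * termSize k m t ‖(⟨1 / 2, t⟩ : ℂ)‖ := by
        linarith [termSize_pos k m t (norm_pos_iff.mpr (mk_half_ne_zero t))]

theorem eventually_exists_zeros_re_eq_half (Y : ℝ) {κ : ℝ} (hκ : 0 < κ) :
    ∀ᶠ p in subcritical κ, ∀ a b : ℝ, √3 / 2 ≤ a → a ≤ b → b ≤ Y →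
      (∀ t ∈ Set.Icc a b, p.1 * Real.log (1 / 4 + t ^ 2) / 2 ≤
        2 * Real.pi * p.2 * (t - t / (1 / 4 + t ^ 2))) →
      ∃ Z : Finset ℂ,
        (∀ z ∈ Z, poincare p.1 p.2 z = 0 ∧ z.re = 1 / 2 ∧ z.im ∈ Set.Ioo a b) ∧
        (linePhase p.1 p.2 b - linePhase p.1 p.2 a) / Real.pi - 2 ≤ (Z.card : ℝ) := by
  filter_upwards [eventually_abs_re_poincare_mk_half_sub_lt Y hκ,
    (tendsto_fst_subcritical κ).eventually_ge_atTop 3] with ⟨k, m⟩ hmain hk a b ha hab hb hdom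
  have hpos : ∀ t ∈ Set.Icc a b, 0 < t := fun t ht =>
    lt_of_lt_of_le (by positivity) (ha.trans ht.1)
  have hz : Continuous fun t : ℝ => (⟨1 / 2, t⟩ : ℂ) := by
    simp only [Complex.mk_eq_add_mul_I]
    fun_prop
  obtain ⟨Z, hZ, hcard⟩ := exists_zeros_on_curve_of_cos_approx (g := poincare k m) (E := 1)
    (z := fun t => ⟨1 / 2, t⟩) (φ := linePhase k m)
    (A := fun t => 2 * termSize k m t ‖(⟨1 / 2, t⟩ : ℂ)‖) hab continuousOn_const
    (fun _ => one_ne_zero)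
    (fun t ht => ((continuousAt_poincare hk m (z := ⟨1 / 2, t⟩) (hpos t ht)).comp_of_eq
      hz.continuousAt rfl).continuousWithinAt) (continuous_linePhase k m).continuousOn
    (fun s _ t _ h => congrArg Complex.im h)
    (fun t ht => by simpa using! im_poincare_mk_half k m (hpos t ht))
    (fun t ht => by simpa using! hmain t (ha.trans ht.1) (ht.2.trans hb) (hdom t ht))
  refine ⟨Z, fun w hw => ?_, hcard⟩
  obtain ⟨hw₀, t, ht, rfl⟩ := hZ w hw
  exact ⟨hw₀, rfl, ht⟩

/-! ### The height function -/

theorem two_mul_sub_div_lt_log {v : ℝ} (hv : 1 < v) : 2 * (v - 1) / (v + 1) < Real.log v := by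
  convert Real.lt_log_one_add_of_pos (sub_pos.mpr hv) using 2 <;> ring

/-- The function `r log r / (r² - 1)`, in terms of which `Γ_α` is
`2 π α Im z = ‖z‖ * slopeFun ‖z‖` and `F(t) = (r / t) * slopeFun r / (2 π)`, `r² = 1/4 + t²`. -/
noncomputable def slopeFun (r : ℝ) : ℝ := r * Real.log r / (r ^ 2 - 1)

theorem hasDerivAt_slopeFun {r : ℝ} (hr : 1 < r) :
    HasDerivAt slopeFun
      (((Real.log r + 1) * (r ^ 2 - 1) - r * Real.log r * (2 * r)) / (r ^ 2 - 1) ^ 2) r := by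
  have h0 : r ≠ 0 := by positivity
  have hden : r ^ 2 - 1 ≠ 0 := by nlinarith
  have hden' : HasDerivAt (fun r : ℝ => r ^ 2 - 1) (2 * r) r := by
    simpa using (hasDerivAt_pow 2 r).sub_const 1
  exact (Real.hasDerivAt_mul_log h0).div hden' hden

theorem continuousOn_slopeFun : ContinuousOn slopeFun (Set.Ioi 1) := fun _ hr =>
  (hasDerivAt_slopeFun hr).continuousAt.continuousWithinAt

theorem strictAntiOn_slopeFun : StrictAntiOn slopeFun (Set.Ioi 1) := by
  refine strictAntiOn_of_deriv_neg (convex_Ioi 1) continuousOn_slopeFun fun r hr => ?_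
  have hr1 : 1 < r := interior_subset hr
  have hlog : 2 * (r ^ 2 - 1) / (r ^ 2 + 1) < 2 * Real.log r := by
    simpa using two_mul_sub_div_lt_log (one_lt_pow₀ hr1 two_ne_zero)
  rw [div_lt_iff₀ (by positivity)] at hlog
  have hden : 0 < r ^ 2 - 1 := by nlinarith
  rw [(hasDerivAt_slopeFun hr1).deriv]
  exact div_neg_of_neg_of_pos (by nlinarith) (by positivity)

theorem one_div_add_one_le_slopeFun {r : ℝ} (hr : 1 < r) : 1 / (r + 1) ≤ slopeFun r := by
  have hden : 0 < r ^ 2 - 1 := by nlinarith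
  have hlog : r * (1 - r⁻¹) ≤ r * Real.log r := by
    gcongr
    exact Real.one_sub_inv_le_log_of_pos (by positivity)
  rw [mul_sub, mul_one, mul_inv_cancel₀ (by positivity)] at hlog
  rw [slopeFun, div_le_div_iff₀ (by positivity) hden]
  nlinarith

theorem slopeFun_pos {r : ℝ} (hr : 1 < r) : 0 < slopeFun r :=
  (by positivity : 0 < 1 / (r + 1)).trans_le (one_div_add_one_le_slopeFun hr)

theorem slopeFun_le {r : ℝ} (hr : 2 ≤ r) : slopeFun r ≤ 3 / √r := by
  have hden : 0 < r ^ 2 - 1 := by nlinarith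
  have hs : 0 < √r := Real.sqrt_pos.mpr (by positivity)
  have hsq : √r * √r = r := Real.mul_self_sqrt (by positivity)
  have hlog : Real.log r ≤ 2 * √r := by
    have := Real.log_le_sub_one_of_pos hs
    rw [Real.log_sqrt (by positivity)] at this
    linarith
  rw [slopeFun, div_le_div_iff₀ hden hs]
  calc r * Real.log r * √r ≤ r * (2 * √r) * √r := by gcongr
    _ = 2 * r ^ 2 := by linear_combination 2 * r * hsq
    _ ≤ _ := by nlinarith

theorem one_lt_quarter_add_sq {t : ℝ} (ht : √3 / 2 < t) : 1 < 1 / 4 + t ^ 2 := by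
  have h3 : √3 ^ 2 = 3 := Real.sq_sqrt (by norm_num)
  nlinarith [Real.sqrt_nonneg 3]

theorem one_lt_sqrt_quarter_add_sq {t : ℝ} (ht : √3 / 2 < t) : 1 < √(1 / 4 + t ^ 2) := by
  rw [Real.lt_sqrt (by norm_num), one_pow]
  exact one_lt_quarter_add_sq ht

theorem heightFun_eq {t : ℝ} (ht : √3 / 2 < t) :
    heightFun t = √(1 / 4 + t ^ 2) / t * slopeFun √(1 / 4 + t ^ 2) / (2 * Real.pi) := by
  have hr := one_lt_sqrt_quarter_add_sq ht
  have hr2 : √(1 / 4 + t ^ 2) ^ 2 = 1 / 4 + t ^ 2 := Real.sq_sqrt (by positivity)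
  have ht0 : 0 < t := lt_trans (by positivity) ht
  set r := √(1 / 4 + t ^ 2)
  have hden : r ^ 2 - 1 ≠ 0 := by nlinarith
  rw [heightFun, ← hr2, Real.log_pow, show t ^ 2 - 3 / 4 = r ^ 2 - 1 by linarith, slopeFun]
  push_cast
  field_simp
  ring

theorem sqrt_quarter_add_sq_div_eq {t : ℝ} (ht : 0 < t) :
    √(1 / 4 + t ^ 2) / t = √(1 / 4 / t ^ 2 + 1) := by
  rw [← Real.sqrt_sq ht.le, ← Real.sqrt_div (by positivity), Real.sqrt_sq ht.le, add_div,
    div_self (by positivity)]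

theorem strictAntiOn_heightFun : StrictAntiOn heightFun (Set.Ioi (√3 / 2)) := by
  intro s (hs : √3 / 2 < s) t (ht : √3 / 2 < t) hst
  have hs0 : 0 < s := lt_trans (by positivity) hs
  have hslope := strictAntiOn_slopeFun (one_lt_sqrt_quarter_add_sq hs)
    (one_lt_sqrt_quarter_add_sq ht) (Real.sqrt_lt_sqrt (by positivity) (by gcongr))
  have := slopeFun_pos (one_lt_sqrt_quarter_add_sq ht)
  rw [heightFun_eq hs, heightFun_eq ht, sqrt_quarter_add_sq_div_eq hs0,
    sqrt_quarter_add_sq_div_eq (hs0.trans hst)]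
  gcongr

theorem continuousOn_heightFun : ContinuousOn heightFun (Set.Ioi (√3 / 2)) := by
  intro t (ht : √3 / 2 < t)
  have ht0 : t ≠ 0 := (lt_trans (by positivity) ht).ne'
  have hden : t ^ 2 - 3 / 4 ≠ 0 := by linarith [one_lt_quarter_add_sq ht]
  have hlog : ContinuousAt (fun t : ℝ => Real.log (1 / 4 + t ^ 2)) t :=
    ContinuousAt.log (by fun_prop) (by positivity)
  have hnum : ContinuousAt (fun t : ℝ => (1 / 4 + t ^ 2) * Real.log (1 / 4 + t ^ 2)) t :=
    ContinuousAt.mul (by fun_prop) hlog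
  refine ContinuousAt.continuousWithinAt ?_
  unfold heightFun
  exact continuousAt_const.mul (hnum.div (by fun_prop) (mul_ne_zero ht0 hden))

theorem le_heightFun {t : ℝ} (ht : √3 / 2 < t) :
    1 / (2 * Real.pi * (√(1 / 4 + t ^ 2) + 1)) ≤ heightFun t := by
  have ht0 : 0 < t := lt_trans (by positivity) ht
  have hone : 1 ≤ √(1 / 4 + t ^ 2) / t := by
    rw [sqrt_quarter_add_sq_div_eq ht0, Real.one_le_sqrt]
    exact le_add_of_nonneg_left (by positivity)
  calc _ = 1 * (1 / (√(1 / 4 + t ^ 2) + 1)) / (2 * Real.pi) := by field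
    _ ≤ √(1 / 4 + t ^ 2) / t * slopeFun √(1 / 4 + t ^ 2) / (2 * Real.pi) := by
      gcongr
      exact one_div_add_one_le_slopeFun (one_lt_sqrt_quarter_add_sq ht)
    _ = _ := (heightFun_eq ht).symm

theorem heightFun_le {t : ℝ} (ht : 2 ≤ t) : heightFun t ≤ 1 / √t := by
  have ht0 : 0 < t := by linarith
  have ht' : √3 / 2 < t := by
    have : √3 < 2 := by rw [Real.sqrt_lt' two_pos]; norm_num
    linarith
  have htr : t ≤ √(1 / 4 + t ^ 2) := Real.le_sqrt_of_sq_le (by linarith)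
  have hr : √(1 / 4 + t ^ 2) / t ≤ 2 := by
    rw [sqrt_quarter_add_sq_div_eq ht0, Real.sqrt_le_left two_pos.le]
    have : 1 / 4 / t ^ 2 ≤ 1 := by
      rw [div_le_one (by positivity)]
      nlinarith
    linarith
  have := slopeFun_pos (one_lt_sqrt_quarter_add_sq ht')
  calc heightFun t = √(1 / 4 + t ^ 2) / t * slopeFun √(1 / 4 + t ^ 2) / (2 * Real.pi) :=
        heightFun_eq ht'
    _ ≤ 2 * (3 / √t) / (2 * 3) := by
        gcongr
        · exact (slopeFun_le (ht.trans htr)).trans (by gcongr)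
        · exact Real.pi_gt_three.le
    _ = 1 / √t := by ring

theorem one_lt_inv_two_pi_mul_sub {α : ℝ} (hα₀ : 0 < α) (hα₁ : α < 1 / (4 * Real.pi)) :
    1 < 1 / (2 * Real.pi * α) - 1 := by
  rw [lt_div_iff₀ (by positivity)] at hα₁
  rw [lt_sub_iff_add_lt, lt_div_iff₀ (by positivity)]
  linarith

theorem exists_heightFun_eq {α : ℝ} (hα₀ : 0 < α) (hα₁ : α < 1 / (4 * Real.pi)) :
    ∃ T, √3 / 2 < T ∧ heightFun T = α := by
  have hra := one_lt_inv_two_pi_mul_sub hα₀ hα₁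
  set ra := 1 / (2 * Real.pi * α) - 1 with hra_def
  set s := √(ra ^ 2 - 1 / 4)
  have hs : √3 / 2 < s := by
    rw [Real.lt_sqrt (by positivity), div_pow, Real.sq_sqrt (by positivity)]
    nlinarith
  have hs_le : α ≤ heightFun s := by
    convert le_heightFun hs using 1
    rw [Real.sq_sqrt (by nlinarith), add_sub_cancel, Real.sqrt_sq (by positivity), hra_def]
    field_simp
    ring
  set t := max (max 2 s) ((1 / α) ^ 2)
  have ht_le : heightFun t ≤ α := by
    refine (heightFun_le ((le_max_left _ _).trans (le_max_left _ _))).trans ?_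
    rw [one_div_le (Real.sqrt_pos.mpr (by positivity)) hα₀, Real.le_sqrt' (by positivity)]
    exact le_max_right _ _
  obtain ⟨T, hT, hTα⟩ := intermediate_value_Icc' ((le_max_right _ _).trans (le_max_left _ _))
    (continuousOn_heightFun.mono fun x hx => hs.trans_le hx.1) ⟨ht_le, hs_le⟩
  exact ⟨T, hs.trans_le hT.1, hTα⟩

/-- The number of zeros found near the curve is asymptotically `k * curveProportion α T`, where
`T = F⁻¹(α)`. -/
noncomputable def curveProportion (α T : ℝ) : ℝ :=
  α + α / (1 / 4 + T ^ 2) + Real.arctan (2 * T) / Real.pi - 1 / 2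

theorem arctan_lt_self {x : ℝ} (hx : 0 < x) : Real.arctan x < x := by
  simpa using Real.lt_tan (Real.arctan_pos.mpr hx) (Real.arctan_lt_pi_div_two x)

theorem curveProportion_pos {α T : ℝ} (hT : √3 / 2 < T) (h : heightFun T = α) :
    0 < curveProportion α T := by
  have hT0 : 0 < T := lt_trans (by positivity) hT
  have hv := one_lt_quarter_add_sq hT
  have hlog := two_mul_sub_div_lt_log hv
  have harctan : Real.arctan (2 * T) = Real.pi / 2 - Real.arctan (2 * T)⁻¹ := by
    rw [Real.arctan_inv_of_pos (by positivity), sub_sub_cancel]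
  rw [heightFun, show T ^ 2 - 3 / 4 = (1 / 4 + T ^ 2) - 1 by ring] at h
  rw [curveProportion, harctan, ← h]
  set v := 1 / 4 + T ^ 2
  have hv1 : 0 < v - 1 := sub_pos.mpr hv
  have hlog' : 1 / (2 * T) < (v + 1) * Real.log v / (4 * T * (v - 1)) := by
    rw [div_lt_iff₀ (by linarith)] at hlog
    rw [div_lt_div_iff₀ (by positivity) (by positivity)]
    nlinarith
  have hlt : (2 * T)⁻¹.arctan < (v + 1) * Real.log v / (4 * T * (v - 1)) :=
    (arctan_lt_self (by positivity)).trans (by rwa [← one_div])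
  calc 0 < ((v + 1) * Real.log v / (4 * T * (v - 1)) - Real.arctan (2 * T)⁻¹) / Real.pi :=
        div_pos (sub_pos.mpr hlt) Real.pi_pos
    _ = _ := by field_simp; ring

/-! ### The curve as a level set -/

/-- The right half of the interior of the fundamental domain; the left half is its mirror image. -/
def rightHalf : Set ℂ :=
  {z | 0 < z.re ∧ z.re < 1 / 2 ∧ 0 < z.im ∧ 1 < ‖z‖}

theorem isOpen_rightHalf : IsOpen rightHalf :=
  (isOpen_lt continuous_const Complex.continuous_re).inter <|
    (isOpen_lt Complex.continuous_re continuous_const).inter <|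
      (isOpen_lt continuous_const Complex.continuous_im).inter
        (isOpen_lt continuous_const continuous_norm)

/-- The function `2 π i α (z + 1/z) + log z`: for `α = m / k`, the quotient of the two main terms
`term k m 1 0` and `term k m 0 1` is `exp (-k * phase α z)`. The curve `Γ_α` is the locus where the
two terms have the same size, so that `phase α` is purely imaginary. -/
noncomputable def phase (α : ℝ) (z : ℂ) : ℂ :=
  2 * Real.pi * Complex.I * α * (z + 1 / z) + Complex.log z

theorem ne_zero_of_im_pos {z : ℂ} (hz : 0 < z.im) : z ≠ 0 := fun h => by simp [h] at hz

theorem phase_eq (α : ℝ) (z : ℂ) :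
    phase α z = ((Real.log ‖z‖ - 2 * Real.pi * α * z.im * (1 - 1 / ‖z‖ ^ 2) : ℝ) : ℂ) +
      ((2 * Real.pi * α * z.re * (1 + 1 / ‖z‖ ^ 2) + z.arg : ℝ) : ℂ) * Complex.I := by
  have hinv : 1 / z = ((z.re / ‖z‖ ^ 2 : ℝ) : ℂ) - ((z.im / ‖z‖ ^ 2 : ℝ) : ℂ) * Complex.I := by
    apply Complex.ext <;>
      simp [Complex.normSq_eq_norm_sq, -Complex.ofReal_div, neg_div]
  rw [phase, hinv, Complex.log]
  push_cast
  linear_combination (2 * Real.pi * α * (z.im - z.im / ‖z‖ ^ 2) : ℂ) * Complex.I_sq -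
    2 * Real.pi * Complex.I * α * Complex.re_add_im z

theorem hasDerivAt_phase (α : ℝ) {z : ℂ} (hz : 0 < z.im) :
    HasDerivAt (phase α) (2 * Real.pi * Complex.I * α * (1 - 1 / z ^ 2) + 1 / z) z := by
  have hadd : HasDerivAt (fun z : ℂ => z + 1 / z) (1 - 1 / z ^ 2) z := by
    simpa only [one_div, sub_eq_add_neg] using
      (hasDerivAt_id' z).fun_add (hasDerivAt_inv (ne_zero_of_im_pos hz))
  exact (hadd.const_mul _).add (by simpa using Complex.hasDerivAt_log (.inr hz.ne'))

theorem deriv_phase_ne_zero {α : ℝ} (hα : α ≠ 0) {z : ℂ} (hz : z ∈ rightHalf) :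
    2 * Real.pi * Complex.I * α * (1 - 1 / z ^ 2) + 1 / z ≠ 0 := by
  obtain ⟨hre, -, him, hn⟩ := hz
  have hz0 := ne_zero_of_im_pos him
  have hmul : (2 * Real.pi * Complex.I * α * (1 - 1 / z ^ 2) + 1 / z) * z =
      ((2 * Real.pi * α : ℝ) : ℂ) * (Complex.I * (z - 1 / z)) + 1 := by
    push_cast
    field
  have him_mul : ((2 * Real.pi * α : ℝ) * (Complex.I * (z - 1 / z)) + 1).im =
      2 * Real.pi * α * (z.re * (1 - 1 / ‖z‖ ^ 2)) := by
    rw [Complex.add_im, Complex.im_ofReal_mul, Complex.I_mul_im, Complex.one_im, add_zero, one_div,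
      Complex.sub_re, Complex.inv_re, Complex.normSq_eq_norm_sq]
    ring
  have hpos : 0 < 1 - 1 / ‖z‖ ^ 2 := by
    rw [sub_pos, div_lt_one (by positivity)]
    exact one_lt_pow₀ hn two_ne_zero
  intro h
  rw [h, zero_mul] at hmul
  rw [← hmul, Complex.zero_im] at him_mul
  exact mul_ne_zero (mul_ne_zero (by positivity) hα) (mul_pos hre hpos).ne' him_mul.symm

/-- The point of modulus `r` and nonnegative real part which satisfies the equation of `Γ_α`. It is
meaningful where `slopeFun r ≤ 2 π α`. -/
noncomputable def curvePoint (α r : ℝ) : ℂ :=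
  ⟨r * √(1 - (slopeFun r / (2 * Real.pi * α)) ^ 2), r * (slopeFun r / (2 * Real.pi * α))⟩

section CurvePoint

variable {α r : ℝ}

theorem im_curvePoint_pos (hα : 0 < α) (hr : 1 < r) : 0 < (curvePoint α r).im :=
  mul_pos (by positivity) (div_pos (slopeFun_pos hr) (by positivity))

theorem sq_slopeFun_div_le_one (hα : 0 < α) (hr : 1 < r) (hs : slopeFun r ≤ 2 * Real.pi * α) :
    (slopeFun r / (2 * Real.pi * α)) ^ 2 ≤ 1 :=
  pow_le_one₀ (div_pos (slopeFun_pos hr) (by positivity)).le (div_le_one_of_le₀ hs (by positivity))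

theorem norm_curvePoint (hα : 0 < α) (hr : 1 < r) (hs : slopeFun r ≤ 2 * Real.pi * α) :
    ‖curvePoint α r‖ = r := by
  rw [← sq_eq_sq₀ (norm_nonneg _) (by positivity), sq_norm_eq_re_sq_add_im_sq, curvePoint, mul_pow,
    Real.sq_sqrt (sub_nonneg.mpr (sq_slopeFun_div_le_one hα hr hs))]
  ring

theorem continuousOn_curvePoint (α : ℝ) : ContinuousOn (curvePoint α) (Set.Ioi 1) := by
  have hu : ContinuousOn (fun r => slopeFun r / (2 * Real.pi * α)) (Set.Ioi 1) :=
    continuousOn_slopeFun.div_const _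
  unfold curvePoint
  simp only [Complex.mk_eq_add_mul_I]
  fun_prop

theorem two_pi_mul_im_curvePoint (hα : 0 < α) (hr : 1 < r) :
    2 * Real.pi * α * (curvePoint α r).im * (1 - 1 / r ^ 2) = Real.log r := by
  have hden : r ^ 2 - 1 ≠ 0 := by nlinarith
  rw [curvePoint, slopeFun]
  field_simp

/-- The imaginary part of `phase α` at `curvePoint α r`. -/
noncomputable def curvePhase (α r : ℝ) : ℝ :=
  2 * Real.pi * α * (curvePoint α r).re * (1 + 1 / r ^ 2) + (curvePoint α r).arg

theorem phase_curvePoint (hα : 0 < α) (hr : 1 < r) (hs : slopeFun r ≤ 2 * Real.pi * α) :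
    phase α (curvePoint α r) = curvePhase α r * Complex.I := by
  rw [phase_eq, norm_curvePoint hα hr hs, two_pi_mul_im_curvePoint hα hr, sub_self,
    Complex.ofReal_zero, zero_add, curvePhase]

theorem continuousOn_curvePhase (hα : 0 < α) : ContinuousOn (curvePhase α) (Set.Ioi 1) := by
  intro r hr
  have hw := (continuousOn_curvePoint α).continuousAt (Ioi_mem_nhds hr)
  have hr0 : r ^ 2 ≠ 0 := (pow_pos (one_pos.trans hr) 2).ne'
  have harg : ContinuousAt (fun r => (curvePoint α r).arg) r :=
    (Complex.continuousAt_arg (.inr (im_curvePoint_pos hα hr).ne')).comp hw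
  refine (ContinuousAt.add (.mul ?_ ?_) harg).continuousWithinAt
  · exact continuousAt_const.mul (Complex.continuous_re.continuousAt.comp hw)
  · exact continuousAt_const.add (continuousAt_const.div (by fun_prop) hr0)

theorem curvePoint_mem_curve (hα : 0 < α) (hr : 1 < r) (hs : slopeFun r ≤ 2 * Real.pi * α)
    (hre : curvePoint α r ∈ rightHalf) : curvePoint α r ∈ curve α := by
  obtain ⟨hre, hre', him, hn⟩ := hre
  refine ⟨.inl ⟨him, hn, by linarith, hre'.le⟩, hn, ?_⟩
  have hden : 1 - r ^ (-2 : ℤ) ≠ 0 := by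
    rw [sub_ne_zero]
    exact (zpow_lt_one_of_neg₀ hr (by norm_num)).ne'
  rw [norm_curvePoint hα hr hs, eq_div_iff hden, ← two_pi_mul_im_curvePoint hα hr, zpow_neg,
    one_div, zpow_ofNat]

theorem re_curvePoint_lt {r' : ℝ} (hα : 0 < α) (hr : 1 < r) (hs : slopeFun r ≤ 2 * Real.pi * α)
    (hrr' : r < r') : (curvePoint α r).re < (curvePoint α r').re := by
  have hslope := strictAntiOn_slopeFun hr (hr.trans hrr') hrr'
  have := slopeFun_pos (hr.trans hrr')
  refine mul_lt_mul'' hrr' (Real.sqrt_lt_sqrt ?_ ?_) (by positivity) (by positivity)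
  · exact sub_nonneg.mpr (sq_slopeFun_div_le_one hα hr hs)
  · gcongr

theorem curvePoint_eq_of_slopeFun_eq (hα : 0 < α) (hs : slopeFun r = 2 * Real.pi * α) :
    curvePoint α r = ⟨0, r⟩ := by
  rw [curvePoint, hs, div_self (by positivity)]
  simp

theorem curvePhase_eq_of_slopeFun_eq (hα : 0 < α) (hr : 1 < r)
    (hs : slopeFun r = 2 * Real.pi * α) : curvePhase α r = Real.pi / 2 := by
  have harg : (⟨0, r⟩ : ℂ).arg = Real.pi / 2 :=
    Complex.arg_eq_pi_div_two_iff.mpr ⟨rfl, one_pos.trans hr⟩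
  rw [curvePhase, curvePoint_eq_of_slopeFun_eq hα hs, harg]
  ring

end CurvePoint

section CurveEndpoints

variable {α T : ℝ} (hα₀ : 0 < α) (hα₁ : α < 1 / (4 * Real.pi)) (hT : √3 / 2 < T)
  (hTα : heightFun T = α)

include hT hTα in
theorem slopeFun_sqrt_quarter_add_sq :
    slopeFun √(1 / 4 + T ^ 2) = 2 * Real.pi * α * (T / √(1 / 4 + T ^ 2)) := by
  have hT0 : 0 < T := lt_trans (by positivity) hT
  rw [heightFun_eq hT] at hTα
  rw [← hTα]
  field

include hα₀ hT hTα in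
theorem slopeFun_sqrt_quarter_add_sq_lt : slopeFun √(1 / 4 + T ^ 2) < 2 * Real.pi * α := by
  rw [slopeFun_sqrt_quarter_add_sq hT hTα]
  refine mul_lt_of_lt_one_right (by positivity) ((div_lt_one (by positivity)).mpr ?_)
  exact Real.lt_sqrt_of_sq_lt (by linarith)

include hα₀ hT hTα in
theorem curvePoint_sqrt_quarter_add_sq : curvePoint α √(1 / 4 + T ^ 2) = ⟨1 / 2, T⟩ := by
  have hsq : √(1 / 4 + T ^ 2) ^ 2 = 1 / 4 + T ^ 2 := Real.sq_sqrt (by positivity)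
  have hr0 : 0 < √(1 / 4 + T ^ 2) := by positivity
  rw [curvePoint, slopeFun_sqrt_quarter_add_sq hT hTα, mul_div_cancel_left₀ _ (by positivity)]
  set r := √(1 / 4 + T ^ 2)
  have hcos : 1 - (T / r) ^ 2 = (1 / 2 / r) ^ 2 := by
    field_simp
    linarith
  rw [hcos, Real.sqrt_sq (by positivity), mul_div_cancel₀ _ hr0.ne', mul_div_cancel₀ _ hr0.ne']

include hα₀ hT hTα in
theorem curvePhase_sqrt_quarter_add_sq :
    curvePhase α √(1 / 4 + T ^ 2) = Real.pi / 2 + Real.pi * curveProportion α T := by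
  have hsq : √(1 / 4 + T ^ 2) ^ 2 = 1 / 4 + T ^ 2 := Real.sq_sqrt (by positivity)
  rw [curvePhase, curvePoint_sqrt_quarter_add_sq hα₀ hT hTα, arg_mk_half, hsq, curveProportion]
  field

include hα₀ hα₁ hT hTα in
theorem exists_slopeFun_eq :
    ∃ r, 1 < r ∧ r ≤ √(1 / 4 + T ^ 2) ∧ slopeFun r = 2 * Real.pi * α := by
  have hra := one_lt_inv_two_pi_mul_sub hα₀ hα₁
  have hlt := slopeFun_sqrt_quarter_add_sq_lt hα₀ hT hTα
  have hle : 2 * Real.pi * α ≤ slopeFun (1 / (2 * Real.pi * α) - 1) := by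
    simpa using one_div_add_one_le_slopeFun hra
  have hra_le : 1 / (2 * Real.pi * α) - 1 ≤ √(1 / 4 + T ^ 2) :=
    (strictAntiOn_slopeFun.lt_iff_gt (one_lt_sqrt_quarter_add_sq hT) hra).mp
      (hlt.trans_le hle) |>.le
  obtain ⟨r, hr, hrα⟩ := intermediate_value_Icc' hra_le
    (continuousOn_slopeFun.mono fun x hx => hra.trans_le hx.1) ⟨hlt.le, hle⟩
  exact ⟨r, hra.trans_le hr.1, hr.2, hrα⟩

include hα₀ hα₁ hT hTα in
/-- As `Γ_α` is followed from the imaginary axis to the line `Re z = 1/2`, the imaginary part of the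
phase grows continuously from `π/2` to `π/2 + π * curveProportion α T`. -/
theorem exists_mem_curve_phase_eq {τ : ℝ} (hτ : Real.pi / 2 < τ)
    (hτ' : τ < Real.pi / 2 + Real.pi * curveProportion α T) :
    ∃ w ∈ curve α ∩ rightHalf, phase α w = τ * Complex.I := by
  obtain ⟨r₀, hr₀, hr₀₁, hs₀⟩ := exists_slopeFun_eq hα₀ hα₁ hT hTα
  have hcont : ContinuousOn (curvePhase α) (Set.Icc r₀ √(1 / 4 + T ^ 2)) :=
    (continuousOn_curvePhase hα₀).mono fun r hr => hr₀.trans_le hr.1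
  obtain ⟨r, hr, hrτ⟩ := intermediate_value_Ioo hr₀₁ hcont <| by
    rw [curvePhase_eq_of_slopeFun_eq hα₀ hr₀ hs₀, curvePhase_sqrt_quarter_add_sq hα₀ hT hTα]
    exact ⟨hτ, hτ'⟩
  have hr1 : 1 < r := hr₀.trans hr.1
  have hs : slopeFun r ≤ 2 * Real.pi * α := hs₀ ▸ (strictAntiOn_slopeFun hr₀ hr1 hr.1).le
  have hmem : curvePoint α r ∈ rightHalf := by
    refine ⟨?_, ?_, im_curvePoint_pos hα₀ hr1, by rwa [norm_curvePoint hα₀ hr1 hs]⟩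
    · simpa [curvePoint_eq_of_slopeFun_eq hα₀ hs₀] using re_curvePoint_lt hα₀ hr₀ hs₀.le hr.1
    · exact (re_curvePoint_lt hα₀ hr1 hs hr.2).trans_eq
        (by rw [curvePoint_sqrt_quarter_add_sq hα₀ hT hTα])
  exact ⟨_, ⟨curvePoint_mem_curve hα₀ hr1 hs hmem, hmem⟩, by rw [phase_curvePoint hα₀ hr1 hs, hrτ]⟩

end CurveEndpoints

/-! ### The exact phase -/

/-- A limiting regime for the parameters `(k, m)`: the weight `k` is even and tends to infinity,
while `m / k` tends to `α`. -/
noncomputable def proportional (α : ℝ) : Filter (ℕ × ℕ) :=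
  comap Prod.fst atTop ⊓ 𝓟 {p | Even p.1} ⊓ comap (fun p => (p.2 : ℝ) / p.1) (𝓝 α)

theorem tendsto_fst_proportional (α : ℝ) : Tendsto Prod.fst (proportional α) atTop :=
  tendsto_comap.mono_left (inf_le_left.trans inf_le_left)

theorem tendsto_natCast_fst_proportional (α : ℝ) :
    Tendsto (fun p => (p.1 : ℝ)) (proportional α) atTop :=
  tendsto_natCast_atTop_atTop.comp (tendsto_fst_proportional α)

theorem tendsto_div_proportional (α : ℝ) :
    Tendsto (fun p => (p.2 : ℝ) / p.1) (proportional α) (𝓝 α) :=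
  tendsto_comap.mono_left inf_le_right

theorem eventually_even_fst_proportional (α : ℝ) : ∀ᶠ p in proportional α, Even p.1 :=
  mem_inf_of_left (mem_inf_of_right (mem_principal_self _))

theorem proportional_le_subcritical {α κ : ℝ} (h : 4 * Real.pi * α < 1 - κ) :
    proportional α ≤ subcritical κ := by
  refine le_inf (inf_le_left.trans inf_le_left) (le_principal_iff.mpr ?_)
  filter_upwards [eventually_even_fst_proportional α,
    ((tendsto_div_proportional α).const_mul (4 * Real.pi)).eventually_lt_const h,
    (tendsto_fst_proportional α).eventually_gt_atTop 0] with p heven hlt hp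
  rw [mul_div_assoc', div_lt_iff₀ (by exact_mod_cast hp)] at hlt
  exact ⟨heven, hlt.le⟩

theorem exists_proportional_le_subcritical {α : ℝ} (hα : α < 1 / (4 * Real.pi)) :
    ∃ κ, 0 < κ ∧ proportional α ≤ subcritical κ := by
  rw [lt_div_iff₀ (by positivity)] at hα
  exact ⟨(1 - 4 * Real.pi * α) / 2, by linarith, proportional_le_subcritical (by linarith)⟩

/-- The quotient of `poincare k m - term k m 0 1` by the second main term `term k m 1 0`. -/
noncomputable def tailQuotient (k m : ℕ) (z : ℂ) : ℂ :=
  (poincare k m z - term k m 0 1 z) / term k m 1 0 z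

/-- The perturbation of `phase (m / k)` for which
`poincare k m z = term k m 0 1 z * (1 + exp (-k * exactPhase k m z))`. -/
noncomputable def exactPhase (k m : ℕ) (z : ℂ) : ℂ :=
  phase (m / k) z - Complex.log (tailQuotient k m z) / k

section ExactPhase

variable {k m : ℕ} {z : ℂ}

theorem term_one_zero_ne_zero (hz : 0 < z.im) : term k m 1 0 z ≠ 0 := by
  rw [term_one_zero k m hz]
  exact div_ne_zero (Complex.exp_ne_zero _) (pow_ne_zero _ (ne_zero_of_im_pos hz))

theorem poincare_eq_exactPhase (hk : k ≠ 0) (hz : 0 < z.im) (hQ : tailQuotient k m z ≠ 0) :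
    poincare k m z = term k m 0 1 z * (1 + Complex.exp (-(k * exactPhase k m z))) := by
  have hz0 := ne_zero_of_im_pos hz
  have hk0 : (k : ℂ) ≠ 0 := by exact_mod_cast hk
  have hexp : -(k * exactPhase k m z) = (-(2 * Real.pi * Complex.I * m * z) +
      2 * Real.pi * Complex.I * m * (-1 / z)) + Complex.log (tailQuotient k m z) -
      k * Complex.log z := by
    rw [exactPhase, phase]
    push_cast
    field
  have hterm : term k m 0 1 z * Complex.exp (-(k * exactPhase k m z)) =
      term k m 1 0 z * tailQuotient k m z := by
    rw [hexp, Complex.exp_sub, Complex.exp_add, Complex.exp_add, Complex.exp_log hQ,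
      Complex.exp_nat_mul, Complex.exp_log hz0, term_zero_one k m hz, term_one_zero k m hz,
      Complex.exp_neg]
    have := Complex.exp_ne_zero (2 * Real.pi * Complex.I * m * z)
    field_simp
  rw [mul_add, hterm, tailQuotient, mul_div_cancel₀ _ (term_one_zero_ne_zero hz)]
  ring

theorem poincare_eq_zero_of_exactPhase_eq (hk : k ≠ 0) (hz : 0 < z.im)
    (hQ : tailQuotient k m z ≠ 0) {n : ℤ}
    (h : exactPhase k m z = ((2 * n + 1) * Real.pi / k : ℝ) * Complex.I) :
    poincare k m z = 0 := by
  have hk0 : (k : ℂ) ≠ 0 := by exact_mod_cast hk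
  have hexp : -((k : ℂ) * exactPhase k m z) =
      Real.pi * Complex.I + ((-(n + 1) : ℤ) : ℂ) * (2 * Real.pi * Complex.I) := by
    rw [h]
    push_cast
    field
  rw [poincare_eq_exactPhase hk hz hQ, hexp, Complex.exp_add, Complex.exp_int_mul_two_pi_mul_I,
    Complex.exp_pi_mul_I, mul_one, add_neg_cancel, mul_zero]

theorem norm_tailQuotient_sub_one_le {η : ℝ} (hz : 0 < z.im)
    (h : ‖poincare k m z - (term k m 0 1 z + term k m 1 0 z)‖ ≤ η * termSize k m z.im ‖z‖) :
    ‖tailQuotient k m z - 1‖ ≤ η := by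
  have hnorm : ‖term k m 1 0 z‖ = termSize k m z.im ‖z‖ := by
    simpa using norm_term_eq_termSize k m isCoprime_one_left hz (c := 1) (d := 0)
  rw [tailQuotient, ← div_self (term_one_zero_ne_zero hz), ← sub_div, sub_sub, norm_div, hnorm]
  exact div_le_of_le_mul₀ (hnorm ▸ norm_nonneg _)
    (nonneg_of_mul_nonneg_left ((norm_nonneg _).trans h)
      (hnorm ▸ norm_pos_iff.mpr (term_one_zero_ne_zero hz))) h

theorem norm_exactPhase_sub_phase_le (α : ℝ) (hz : 1 ≤ ‖z‖)
    (hQ : ‖tailQuotient k m z - 1‖ ≤ 1 / 2) :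
    ‖exactPhase k m z - phase α z‖ ≤ 2 * Real.pi * |(m / k : ℝ) - α| * (‖z‖ + 1) + 1 / k := by
  have heq : exactPhase k m z - phase α z =
      ((2 * Real.pi * ((m / k : ℝ) - α) : ℝ) : ℂ) * Complex.I * (z + 1 / z) -
        Complex.log (tailQuotient k m z) / k := by
    rw [exactPhase, phase, phase]
    push_cast
    ring
  have hlog : ‖Complex.log (tailQuotient k m z)‖ ≤ 1 := by
    have := Complex.norm_log_one_add_half_le_self hQ
    rw [add_sub_cancel] at this
    linarith
  have hinv : ‖z + 1 / z‖ ≤ ‖z‖ + 1 := by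
    refine (norm_add_le _ _).trans ?_
    rw [norm_div, norm_one]
    gcongr
    exact div_le_one_of_le₀ hz (by positivity)
  have hcoeff :
      ‖((2 * Real.pi * ((m / k : ℝ) - α) : ℝ) : ℂ)‖ = 2 * Real.pi * |(m / k : ℝ) - α| := by
    rw [Complex.norm_real, Real.norm_eq_abs, abs_mul, abs_of_pos Real.two_pi_pos]
  rw [heq]
  refine (norm_sub_le _ _).trans ?_
  rw [norm_div, Complex.norm_natCast, norm_mul, norm_mul, Complex.norm_I, mul_one, hcoeff]
  gcongr

theorem differentiableAt_exactPhase (hk : 3 ≤ k) (m : ℕ) (hz : 0 < z.im)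
    (hQ : ‖tailQuotient k m z - 1‖ ≤ 1 / 2) : DifferentiableAt ℂ (exactPhase k m) z := by
  have hP : DifferentiableAt ℂ (poincare k m) z :=
    (differentiableOn_poincare hk m).differentiableAt
      (UpperHalfPlane.isOpen_upperHalfPlaneSet.mem_nhds hz)
  have hT : DifferentiableAt ℂ (tailQuotient k m) z :=
    (hP.sub (differentiableAt_term k m isCoprime_one_right hz)).div
      (differentiableAt_term k m isCoprime_one_left hz) (term_one_zero_ne_zero hz)
  have hslit : tailQuotient k m z ∈ Complex.slitPlane := by
    rw [← add_sub_cancel 1 (tailQuotient k m z)]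
    exact Complex.mem_slitPlane_of_norm_lt_one (by linarith)
  exact (hasDerivAt_phase _ hz).differentiableAt.sub ((hT.clog hslit).div_const _)

end ExactPhase

/-! ### Zeros near the curve -/

theorem exists_ball_subset_image_of_norm_sub_le {φ : ℂ → ℂ} {w : ℂ} {U : Set ℂ} (hU : U ∈ 𝓝 w)
    (hφ : ∀ᶠ z in 𝓝[≠] w, φ z ≠ φ w) (hc : ContinuousOn φ U) :
    ∃ r > 0, Metric.closedBall w r ⊆ U ∧ ∃ σ > 0, ∀ G : ℂ → ℂ,
      DiffContOnCl ℂ G (Metric.ball w r) → (∀ z ∈ Metric.closedBall w r, ‖G z - φ z‖ ≤ σ) →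
      Metric.ball (φ w) σ ⊆ G '' Metric.closedBall w r := by
  obtain ⟨r, hr, hrU⟩ := Metric.nhds_basis_closedBall.mem_iff.mp
    (inter_mem hU (eventually_nhdsWithin_iff.mp hφ))
  obtain ⟨z₀, hz₀, hmin⟩ := (isCompact_sphere w r).exists_isMinOn
    (NormedSpace.sphere_nonempty.mpr hr.le)
    ((hc.mono fun z hz => (hrU (Metric.sphere_subset_closedBall hz)).1).sub
      continuousOn_const).norm
  set μ := ‖φ z₀ - φ w‖
  have hμ : 0 < μ := norm_sub_pos_iff.mpr
    ((hrU (Metric.sphere_subset_closedBall hz₀)).2 (Metric.ne_of_mem_sphere hz₀ hr.ne'))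
  refine ⟨r, hr, fun z hz => (hrU hz).1, μ / 8, by positivity, fun G hG hGφ => ?_⟩
  have hGw := hGφ w (Metric.mem_closedBall_self hr.le)
  have hsphere : ∀ z ∈ Metric.sphere w r, 6 * (μ / 8) ≤ ‖G z - G w‖ := fun z hz => by
    have hmin' : μ ≤ ‖φ z - φ w‖ := hmin hz
    have hGz := hGφ z (Metric.sphere_subset_closedBall hz)
    have htri := norm_add₃_le (a := φ z - G z) (b := G z - G w) (c := G w - φ w)
    rw [sub_add_sub_cancel, sub_add_sub_cancel, norm_sub_rev (φ z) (G z)] at htri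
    linarith
  have hfreq : ∃ᶠ z in 𝓝 w, G z ≠ G w := by
    intro hconst
    have heq : Set.EqOn G (fun _ => G w) (Metric.ball w r) :=
      (hG.differentiableOn.analyticOnNhd Metric.isOpen_ball).eqOn_of_preconnected_of_eventuallyEq
        analyticOnNhd_const (convex_ball w r).isPreconnected (Metric.mem_ball_self hr)
        (hconst.mono fun _ => not_not.mp)
    have hz₀' : G z₀ = G w := heq.of_subset_closure hG.continuousOn continuousOn_const
      subset_closure subset_rfl (closure_ball w hr.ne' ▸ Metric.sphere_subset_closedBall hz₀)
    have := hsphere z₀ hz₀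
    rw [hz₀', sub_self, norm_zero] at this
    linarith
  refine (Metric.ball_subset_ball' ?_).trans (hG.ball_subset_image_closedBall hr hsphere hfreq)
  rw [dist_comm, dist_eq_norm]
  linarith

section Curve

variable {α : ℝ}

theorem eventually_norm_exactPhase_sub_phase_le {δ σ : ℝ} (hα : α < 1 / (4 * Real.pi)) (Y : ℝ)
    (hδ : 0 < δ) (hσ : 0 < σ) :
    ∀ᶠ p in proportional α, ∀ z : ℂ, |z.re| ≤ 1 / 2 - δ → 1 ≤ ‖z‖ → 0 < z.im → ‖z‖ ≤ Y →
      ‖tailQuotient p.1 p.2 z - 1‖ ≤ 1 / 2 ∧ ‖exactPhase p.1 p.2 z - phase α z‖ ≤ σ := by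
  obtain ⟨κ, hκ, hle⟩ := exists_proportional_le_subcritical hα
  have hlim : Tendsto (fun p : ℕ × ℕ => 2 * Real.pi * |(p.2 / p.1 : ℝ) - α| * (Y + 1) + 1 / p.1)
      (proportional α) (𝓝 (2 * Real.pi * |α - α| * (Y + 1) + 0)) :=
    ((((tendsto_div_proportional α).sub_const α).abs.const_mul _).mul_const _).add
      (tendsto_const_nhds.div_atTop (tendsto_natCast_fst_proportional α))
  rw [sub_self, abs_zero, mul_zero, zero_mul, add_zero] at hlim
  filter_upwards [hlim.eventually_le_const hσ,
    hle (eventually_norm_poincare_sub_le Y hκ hδ one_half_pos)] with p hp hP z hre hn him hY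
  have hQ := norm_tailQuotient_sub_one_le him
    (hP z hre hn him (((le_abs_self _).trans (Complex.abs_im_le_norm z)).trans hY))
  exact ⟨hQ, (norm_exactPhase_sub_phase_le α hn hQ).trans (le_trans (by gcongr) hp)⟩

theorem eventually_exists_exactPhase_eq {ε τ₀ : ℝ} {w : ℂ} (hα₀ : α ≠ 0)
    (hα₁ : α < 1 / (4 * Real.pi)) (hw : w ∈ rightHalf) (hτ₀ : phase α w = τ₀ * Complex.I)
    (hε : 0 < ε) :
    ∀ᶠ q in proportional α ×ˢ 𝓝 τ₀, ∃ z ∈ rightHalf, dist z w ≤ ε ∧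
      tailQuotient q.1.1 q.1.2 z ≠ 0 ∧ exactPhase q.1.1 q.1.2 z = (q.2 : ℝ) * Complex.I := by
  obtain ⟨δ, hδ, hδw⟩ : ∃ δ > 0, w.re < 1 / 2 - δ :=
    ⟨(1 / 2 - w.re) / 2, by linarith [hw.2.1], by linarith [hw.2.1]⟩
  have hU : (rightHalf ∩ {z | z.re < 1 / 2 - δ}) ∩ Metric.closedBall w ε ∈ 𝓝 w :=
    inter_mem (inter_mem (isOpen_rightHalf.mem_nhds hw)
      ((isOpen_lt Complex.continuous_re continuous_const).mem_nhds hδw))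
      (Metric.closedBall_mem_nhds w hε)
  obtain ⟨r, hr, hrU, σ, hσ, himage⟩ := exists_ball_subset_image_of_norm_sub_le hU
    ((hasDerivAt_phase α hw.2.2.1).eventually_ne (deriv_phase_ne_zero hα₀ hw))
    fun z hz => (hasDerivAt_phase α hz.1.1.2.2.1).continuousAt.continuousWithinAt
  have happrox : ∀ᶠ p in proportional α, ∀ z ∈ Metric.closedBall w r,
      ‖tailQuotient p.1 p.2 z - 1‖ ≤ 1 / 2 ∧ ‖exactPhase p.1 p.2 z - phase α z‖ ≤ σ := by
    filter_upwards [eventually_norm_exactPhase_sub_phase_le hα₁ (‖w‖ + ε) hδ hσ] with p hp z hz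
    obtain ⟨⟨⟨hre, -, him, hn⟩, hre'⟩, hzε⟩ := hrU hz
    exact hp z (by rw [abs_of_pos hre]; exact hre'.le) hn.le him (norm_le_of_mem_closedBall hzε)
  have hclose : ∀ᶠ τ : ℝ in 𝓝 τ₀, (τ * Complex.I : ℂ) ∈ Metric.ball (phase α w) σ := by
    rw [hτ₀]
    exact (by fun_prop : Continuous fun τ : ℝ => (τ * Complex.I : ℂ)).continuousAt.eventually_mem
      (Metric.ball_mem_nhds _ hσ)
  filter_upwards [(happrox.and ((tendsto_fst_proportional α).eventually_ge_atTop 3)).prod_mk hclose]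
    with ⟨⟨k, m⟩, τ⟩ ⟨⟨hG, hk⟩, hτ⟩
  have hdiff : DifferentiableOn ℂ (exactPhase k m) (Metric.closedBall w r) := fun z hz =>
    (differentiableAt_exactPhase hk m (hrU hz).1.1.2.2.1 (hG z hz).1).differentiableWithinAt
  obtain ⟨z, hz, hzτ⟩ := himage _ ((closure_ball w hr.ne' ▸ hdiff).diffContOnCl)
    (fun z hz => (hG z hz).2) hτ
  refine ⟨z, (hrU hz).1.1, (hrU hz).2, fun h0 => ?_, hzτ⟩
  have := (hG z hz).1
  rw [h0, zero_sub, norm_neg, norm_one] at this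
  norm_num at this

/-- The points of `rightHalf` within distance `ε` of the part of `Γ_α` inside `rightHalf`. -/
def rightNearCurve (α ε : ℝ) : Set ℂ :=
  {z ∈ rightHalf | ∃ w ∈ curve α ∩ rightHalf, dist z w ≤ ε}

theorem eventually_forall_exists_exactPhase_eq {ε T a b : ℝ} (hα₀ : 0 < α)
    (hα₁ : α < 1 / (4 * Real.pi)) (hT : √3 / 2 < T) (hTα : heightFun T = α) (hε : 0 < ε)
    (ha : Real.pi / 2 < a) (hb : b < Real.pi / 2 + Real.pi * curveProportion α T) :
    ∀ᶠ p in proportional α, ∀ τ ∈ Set.Icc a b, ∃ z ∈ rightNearCurve α ε,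
      tailQuotient p.1 p.2 z ≠ 0 ∧ exactPhase p.1 p.2 z = τ * Complex.I := by
  have hnhds := isCompact_Icc.mem_prod_nhdsSet_of_forall (l := proportional α)
    (s := {q : (ℕ × ℕ) × ℝ | ∃ z ∈ rightNearCurve α ε,
      tailQuotient q.1.1 q.1.2 z ≠ 0 ∧ exactPhase q.1.1 q.1.2 z = (q.2 : ℝ) * Complex.I})
    (K := Set.Icc a b) fun τ₀ hτ₀ => by
      obtain ⟨w, hw, hph⟩ := exists_mem_curve_phase_eq hα₀ hα₁ hT hTα (ha.trans_le hτ₀.1)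
        (hτ₀.2.trans_lt hb)
      filter_upwards [eventually_exists_exactPhase_eq hα₀.ne' hα₁ hw.2 hph hε]
        with q ⟨z, hz, hzw, hz'⟩
      exact ⟨z, ⟨hz, w, hw, hzw⟩, hz'⟩
  filter_upwards [Eventually.curry hnhds] with p hp τ hτ
    using Eventually.self_of_nhdsSet hp τ hτ

theorem sub_sub_one_le_card_Icc (x y : ℝ) : y - x - 1 ≤ (Finset.Icc ⌈x⌉ ⌊y⌋).card := by
  have hcard : ((⌊y⌋ + 1 - ⌈x⌉ : ℤ) : ℝ) ≤ (Finset.Icc ⌈x⌉ ⌊y⌋).card := by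
    rw [Int.card_Icc]
    exact_mod_cast Int.self_le_toNat _
  push_cast at hcard
  linarith [Int.ceil_lt_add_one x, Int.lt_floor_add_one y]

theorem exists_zeros_of_exactPhase_eq {k m : ℕ} (hk : k ≠ 0) {S : Set ℂ}
    (hS : ∀ z ∈ S, 0 < z.im) {a b : ℝ}
    (h : ∀ τ ∈ Set.Icc a b, ∃ z ∈ S, tailQuotient k m z ≠ 0 ∧ exactPhase k m z = τ * Complex.I) :
    ∃ Z : Finset ℂ, (∀ z ∈ Z, z ∈ S ∧ poincare k m z = 0) ∧
      k * (b - a) / (2 * Real.pi) - 1 ≤ Z.card := by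
  classical
  have hk0 : (0 : ℝ) < k := by exact_mod_cast hk.bot_lt
  choose! z hzS hQ hz using h
  set τ : ℤ → ℝ := fun n => (2 * n + 1) * Real.pi / k
  set I := Finset.Icc ⌈(k * a / Real.pi - 1) / 2⌉ ⌊(k * b / Real.pi - 1) / 2⌋
  have hI : ∀ n ∈ I, τ n ∈ Set.Icc a b := by
    intro n hn
    rw [Finset.mem_Icc, Int.ceil_le, Int.le_floor, div_le_iff₀ two_pos, sub_le_iff_le_add,
      div_le_iff₀ Real.pi_pos, le_div_iff₀ two_pos, le_sub_iff_add_le,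
      le_div_iff₀ Real.pi_pos] at hn
    exact ⟨(le_div_iff₀ hk0).mpr (by linarith), (div_le_iff₀ hk0).mpr (by linarith)⟩
  have hinj : Set.InjOn (fun n => z (τ n)) I := by
    intro n hn n' hn' heq
    have hphase : (τ n * Complex.I : ℂ) = τ n' * Complex.I := by
      rw [← hz _ (hI n hn), ← hz _ (hI n' hn')]
      exact congrArg _ heq
    have hτ : τ n = τ n' := by exact_mod_cast mul_right_cancel₀ Complex.I_ne_zero hphase
    have hn : (2 * n + 1 : ℝ) = 2 * n' + 1 :=
      mul_right_cancel₀ Real.pi_ne_zero ((div_left_inj' hk0.ne').mp hτ)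
    exact_mod_cast (by linarith : (n : ℝ) = n')
  refine ⟨I.image fun n => z (τ n), Finset.forall_mem_image.mpr fun n hn => ?_, ?_⟩
  · have hτ := hI n hn
    exact ⟨hzS _ hτ, poincare_eq_zero_of_exactPhase_eq hk (hS _ (hzS _ hτ)) (hQ _ hτ) (hz _ hτ)⟩
  · rw [Finset.card_image_of_injOn hinj]
    refine le_trans (le_of_eq ?_) (sub_sub_one_le_card_Icc _ _)
    field

theorem neg_conj_mem_curve {w : ℂ} (hw : w ∈ curve α ∩ rightHalf) :
    -starRingEnd ℂ w ∈ curve α := by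
  obtain ⟨⟨-, hn, heq⟩, hre, hre', him, -⟩ := hw
  have hnorm : ‖-starRingEnd ℂ w‖ = ‖w‖ := by rw [norm_neg, RCLike.norm_conj]
  have him' : (-starRingEnd ℂ w).im = w.im := by rw [Complex.neg_im, Complex.conj_im, neg_neg]
  have hre'' : (-starRingEnd ℂ w).re = -w.re := by rw [Complex.neg_re, Complex.conj_re]
  refine ⟨Or.inl ⟨him' ▸ him, hnorm ▸ hn, ?_⟩, hnorm ▸ hn, by rwa [hnorm, him']⟩
  rw [hre'']
  exact ⟨neg_lt_neg hre', by linarith⟩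

theorem mem_nearCurve_of_dist_le {ε : ℝ} {z w : ℂ} (hw : w ∈ curve α) (hd : dist z w ≤ ε)
    (hre₀ : z.re ≠ 0) (hre : |z.re| < 1 / 2) (him : 0 < z.im) (hn : 1 < ‖z‖) :
    z ∈ nearCurve α ε := by
  refine ⟨⟨Or.inl ⟨him, hn, (abs_lt.mp hre).1, (abs_lt.mp hre).2.le⟩, ?_⟩, ?_⟩
  · rintro ((⟨θ, -, rfl⟩ | ⟨t, -, rfl⟩) | ⟨t, -, rfl⟩)
    · exact hn.ne' (Complex.norm_exp_ofReal_mul_I θ)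
    · norm_num at hre
    · simp at hre₀
  · refine (Metric.infEDist_le_edist_of_mem hw).trans ?_
    rw [edist_dist]
    exact ENNReal.ofReal_le_ofReal hd

theorem rightNearCurve_subset (α ε : ℝ) : rightNearCurve α ε ⊆ nearCurve α ε := by
  rintro z ⟨⟨hre, hre', him, hn⟩, w, hw, hd⟩
  exact mem_nearCurve_of_dist_le hw.1 hd hre.ne' (abs_lt.mpr ⟨by linarith, hre'⟩) him hn

theorem neg_conj_mem_nearCurve {ε : ℝ} {z : ℂ} (hz : z ∈ rightNearCurve α ε) :
    -starRingEnd ℂ z ∈ nearCurve α ε := by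
  obtain ⟨⟨hre, hre', him, hn⟩, w, hw, hd⟩ := hz
  refine mem_nearCurve_of_dist_le (neg_conj_mem_curve hw) ?_ ?_ ?_ ?_ ?_
  · rwa [dist_neg_neg, Complex.dist_conj_conj]
  · simpa using hre.ne'
  · rw [Complex.neg_re, Complex.conj_re, abs_neg, abs_of_pos hre]
    exact hre'
  · simpa using him
  · rwa [norm_neg, RCLike.norm_conj]

theorem card_union_image_neg_conj [DecidableEq ℂ] {Z : Finset ℂ} (hZ : ∀ z ∈ Z, 0 < z.re) :
    (Z ∪ Z.image fun z => -starRingEnd ℂ z).card = 2 * Z.card := by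
  have hdisj : Disjoint Z (Z.image fun z => -starRingEnd ℂ z) := by
    rw [Finset.disjoint_right]
    refine Finset.forall_mem_image.mpr fun z hz hz' => ?_
    have := hZ _ hz'
    rw [Complex.neg_re, Complex.conj_re] at this
    linarith [hZ z hz]
  have hinj : Function.Injective fun z : ℂ => -starRingEnd ℂ z :=
    neg_injective.comp (starRingEnd ℂ).injective
  rw [Finset.card_union_of_disjoint hdisj, Finset.card_image_of_injective _ hinj, two_mul]

theorem eventually_exists_zeros_nearCurve {ε ε' T : ℝ} (hα₀ : 0 < α)
    (hα₁ : α < 1 / (4 * Real.pi)) (hT : √3 / 2 < T) (hTα : heightFun T = α) (hε : 0 < ε)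
    (hε' : 0 < ε') :
    ∀ᶠ p in proportional α, ∃ Z : Finset ℂ,
      (∀ z ∈ Z, z ∈ nearCurve α ε ∧ poincare p.1 p.2 z = 0) ∧
      (curveProportion α T - ε') * p.1 - 2 ≤ Z.card := by
  classical
  have := Real.pi_pos
  filter_upwards [(tendsto_fst_proportional α).eventually_gt_atTop 0,
    eventually_forall_exists_exactPhase_eq hα₀ hα₁ hT hTα hε
      (a := Real.pi / 2 + Real.pi * (ε' / 2))
      (b := Real.pi / 2 + Real.pi * (curveProportion α T - ε' / 2))
      (by nlinarith) (by nlinarith)] with p hp hphase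
  obtain ⟨Z, hZ, hcard⟩ := exists_zeros_of_exactPhase_eq hp.ne' (fun z hz => hz.1.2.2.1) hphase
  refine ⟨Z ∪ Z.image fun z => -starRingEnd ℂ z, fun z hz => ?_, ?_⟩
  · rcases Finset.mem_union.mp hz with hz | hz
    · exact ⟨rightNearCurve_subset α ε (hZ z hz).1, (hZ z hz).2⟩
    · obtain ⟨w, hw, rfl⟩ := Finset.mem_image.mp hz
      refine ⟨neg_conj_mem_nearCurve (hZ w hw).1, ?_⟩
      rw [poincare_neg_conj _ _ (hZ w hw).1.1.2.2.1, (hZ w hw).2, map_zero]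
  · rw [card_union_image_neg_conj fun z hz => (hZ z hz).1.1.1]
    have hlen : (p.1 * (Real.pi / 2 + Real.pi * (curveProportion α T - ε' / 2) -
        (Real.pi / 2 + Real.pi * (ε' / 2))) / (2 * Real.pi) : ℝ) =
        (curveProportion α T - ε') * p.1 / 2 := by field
    push_cast
    linarith

end Curve

theorem exists_re_phase_ne_zero (α : ℝ) :
    ∃ z : ℂ, z.re = 0 ∧ 0 < z.im ∧ 1 ≤ ‖z‖ ∧ (phase α z).re ≠ 0 := by
  obtain ⟨y, hy, hslope⟩ : ∃ y : ℝ, 1 < y ∧ slopeFun y ≠ 2 * Real.pi * α := by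
    by_contra! h
    have := strictAntiOn_slopeFun.injOn (Set.mem_Ioi.mpr one_lt_two)
      (Set.mem_Ioi.mpr (by norm_num : (1 : ℝ) < 3))
      ((h 2 one_lt_two).trans (h 3 (by norm_num)).symm)
    norm_num at this
  have hnorm : ‖(⟨0, y⟩ : ℂ)‖ = y := by
    rw [Complex.norm_def, Complex.normSq_mk, mul_zero, zero_add,
      Real.sqrt_mul_self (zero_le_one.trans hy.le)]
  refine ⟨⟨0, y⟩, rfl, zero_lt_one.trans hy, hnorm.symm ▸ hy.le, fun h0 => hslope ?_⟩
  have hy2 : y ^ 2 - 1 ≠ 0 := (sub_pos.mpr (one_lt_pow₀ hy two_ne_zero)).ne'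
  rw [phase_eq, hnorm] at h0
  simp only [Complex.add_re, Complex.ofReal_re, Complex.re_ofReal_mul, Complex.I_re, mul_zero,
    add_zero] at h0
  rw [slopeFun, div_eq_iff hy2]
  field_simp at h0
  linear_combination h0

/-- Zeros satisfy `exp (-k * exactPhase k m z) = -1`, so that the exact phase is imaginary there. -/
theorem eventually_poincare_ne_zero {α : ℝ} {z : ℂ} (hα : α < 1 / (4 * Real.pi))
    (hre : |z.re| < 1 / 2) (him : 0 < z.im) (hn : 1 ≤ ‖z‖) (hph : (phase α z).re ≠ 0) :
    ∀ᶠ p in proportional α, poincare p.1 p.2 z ≠ 0 := by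
  filter_upwards [(tendsto_fst_proportional α).eventually_gt_atTop 0,
    eventually_norm_exactPhase_sub_phase_le hα ‖z‖ (sub_pos.mpr hre)
      (half_pos (abs_pos.mpr hph))] with ⟨k, m⟩ hk happrox h0
  obtain ⟨hQ, hdist⟩ := happrox z (by linarith) hn him le_rfl
  have hQ0 : tailQuotient k m z ≠ 0 := fun h => by
    rw [h, zero_sub, norm_neg, norm_one] at hQ
    norm_num at hQ
  have hterm : term k m 0 1 z ≠ 0 := by
    rw [term_zero_one k m him]
    exact Complex.exp_ne_zero _
  have hexp : Complex.exp (-(k * exactPhase k m z)) = -1 := by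
    rw [poincare_eq_exactPhase hk.ne' him hQ0] at h0
    exact eq_neg_of_add_eq_zero_right ((mul_eq_zero.mp h0).resolve_left hterm)
  have hreal : (exactPhase k m z).re = 0 := by
    have hnorm := congrArg norm hexp
    rw [Complex.norm_exp, norm_neg, norm_one, Real.exp_eq_one_iff, Complex.neg_re, neg_eq_zero,
      ← Complex.ofReal_natCast, Complex.re_ofReal_mul] at hnorm
    exact (mul_eq_zero.mp hnorm).resolve_left (by exact_mod_cast hk.ne')
  have hle := (Complex.abs_re_le_norm _).trans hdist
  rw [Complex.sub_re, hreal, zero_sub, abs_neg] at hle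
  linarith [abs_pos.mpr hph]

theorem eventually_poincareForm_ne_zero {α : ℝ} (hα : α < 1 / (4 * Real.pi)) :
    ∀ᶠ p in proportional α, ∀ (hk : 3 ≤ p.1) (hm : p.2 ≠ 0), poincareForm hk hm ≠ 0 := by
  obtain ⟨z, hre, him, hn, hph⟩ := exists_re_phase_ne_zero α
  refine (eventually_poincare_ne_zero hα (by simp [hre]) him hn hph).mono fun p hp hk hm h0 => hp ?_
  have h : poincareForm hk hm ⟨z, him⟩ = 0 := by rw [h0, zero_apply]
  exact h

section Line

/-- The limit of `linePhase k m t / (π k)` as `m / k → α`. -/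
noncomputable def lineDensity (α t : ℝ) : ℝ :=
  Real.arctan (2 * t) / Real.pi + α / (1 / 4 + t ^ 2)

theorem linePhase_eq_mul_lineDensity {k : ℕ} (hk : k ≠ 0) (m : ℕ) (t : ℝ) :
    linePhase k m t = k * lineDensity (m / k) t * Real.pi := by
  have hk0 : (k : ℝ) ≠ 0 := by exact_mod_cast hk
  have ht : (1 / 4 + t ^ 2 : ℝ) ≠ 0 := by positivity
  rw [linePhase, lineDensity]
  generalize 1 / 4 + t ^ 2 = s at ht ⊢
  field

theorem rhoProportion_eq (α T : ℝ) : rhoProportion α T = 12 * (1 / 2 - lineDensity α T) := by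
  rw [rhoProportion, lineDensity]
  ring

theorem continuous_lineDensity (t : ℝ) : Continuous fun α => lineDensity α t := by
  unfold lineDensity
  fun_prop

theorem continuous_lineDensity_right (α : ℝ) : Continuous (lineDensity α) := by
  have : Continuous fun t : ℝ => α / (1 / 4 + t ^ 2) :=
    continuous_const.div (by fun_prop) fun t => by positivity
  unfold lineDensity
  fun_prop

theorem tendsto_lineDensity_atTop (α : ℝ) : Tendsto (lineDensity α) atTop (𝓝 (1 / 2)) := by
  have harctan : Tendsto (fun t : ℝ => Real.arctan (2 * t)) atTop (𝓝 (Real.pi / 2)) :=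
    (Real.tendsto_arctan_atTop.mono_right nhdsWithin_le_nhds).comp
      (tendsto_id.const_mul_atTop two_pos)
  have hdiv : Tendsto (fun t : ℝ => α / (1 / 4 + t ^ 2)) atTop (𝓝 0) :=
    tendsto_const_nhds.div_atTop
      (tendsto_atTop_add_const_left _ _ (tendsto_pow_atTop two_ne_zero))
  have hlim : Real.pi / 2 / Real.pi + 0 = 1 / 2 := by field
  exact hlim ▸ (harctan.div_const Real.pi).add hdiv

theorem heightFun_le_iff {α t : ℝ} (ht : √3 / 2 < t) :
    heightFun t ≤ α ↔
      Real.log (1 / 4 + t ^ 2) / 2 ≤ 2 * Real.pi * α * (t - t / (1 / 4 + t ^ 2)) := by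
  have ht0 : 0 < t := (by positivity : 0 < √3 / 2).trans ht
  have ht1 : 0 < t ^ 2 - 3 / 4 := by linarith [one_lt_quarter_add_sq ht]
  have hrhs : 2 * Real.pi * α * (t - t / (1 / 4 + t ^ 2)) =
      α * (4 * Real.pi * (t * (t ^ 2 - 3 / 4))) / (2 * (1 / 4 + t ^ 2)) := by
    field
  rw [heightFun, one_div_mul_eq_div, div_div, div_le_iff₀ (by positivity), hrhs,
    le_div_iff₀ (by positivity), mul_comm (t * (t ^ 2 - 3 / 4))]
  ring_nf

theorem eventually_exists_zeros_lineRho {α ε T : ℝ} (hα : α < 1 / (4 * Real.pi))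
    (hT : √3 / 2 < T) (hTα : heightFun T = α) (hε : 0 < ε) :
    ∀ᶠ p in proportional α, ∃ Z : Finset ℂ,
      (∀ z ∈ Z, poincare p.1 p.2 z = 0 ∧ z.re = 1 / 2 ∧ √3 / 2 < z.im) ∧
      (rhoProportion α T / 12 - ε) * p.1 - 2 ≤ Z.card := by
  obtain ⟨κ, hκ, hle⟩ := exists_proportional_le_subcritical hα
  obtain ⟨a, ha, haT⟩ : ∃ a, lineDensity α a < lineDensity α T + ε / 2 ∧ T < a :=
    ((((continuous_lineDensity_right α).continuousAt.eventually_lt_const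
      (lt_add_of_pos_right _ (half_pos hε))).filter_mono nhdsWithin_le_nhds).and
        (self_mem_nhdsWithin (s := Set.Ioi T))).exists
  obtain ⟨b, hb, hab⟩ : ∃ b, 1 / 2 - ε / 2 < lineDensity α b ∧ a ≤ b :=
    (((tendsto_lineDensity_atTop α).eventually_const_lt
      (sub_lt_self _ (half_pos hε))).and (eventually_ge_atTop a)).exists
  have ha' : √3 / 2 < a := hT.trans haT
  have hdiff : Tendsto (fun p : ℕ × ℕ => lineDensity (p.2 / p.1) b - lineDensity (p.2 / p.1) a)
      (proportional α) (𝓝 (lineDensity α b - lineDensity α a)) :=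
    (((continuous_lineDensity b).sub (continuous_lineDensity a)).tendsto α).comp
      (tendsto_div_proportional α)
  filter_upwards [hle (eventually_exists_zeros_re_eq_half b hκ),
    (tendsto_fst_proportional α).eventually_gt_atTop 0,
    (tendsto_div_proportional α).eventually_const_lt
      (hTα ▸ strictAntiOn_heightFun hT ha' haT : heightFun a < α),
    hdiff.eventually_const_lt
      (by rw [rhoProportion_eq]; linarith : rhoProportion α T / 12 - ε < _)]
    with ⟨k, m⟩ hzeros hk hheight hlt
  have hk0 : (0 : ℝ) < k := by exact_mod_cast hk
  obtain ⟨Z, hZ, hcard⟩ := hzeros a b ha'.le hab le_rfl fun t ht => by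
    have ht' : √3 / 2 < t := ha'.trans_le ht.1
    have hscale (x : ℝ) : k * (2 * Real.pi * (m / k) * x) = 2 * Real.pi * m * x := by field
    have hmain := mul_le_mul_of_nonneg_left ((heightFun_le_iff ht').mp
      ((strictAntiOn_heightFun.antitoneOn ha' ht' ht.1).trans hheight.le)) hk0.le
    rwa [hscale, ← mul_div_assoc] at hmain
  refine ⟨Z, fun z hz => ⟨(hZ z hz).1, (hZ z hz).2.1, ha'.trans (hZ z hz).2.2.1⟩, ?_⟩
  rw [linePhase_eq_mul_lineDensity hk.ne', linePhase_eq_mul_lineDensity hk.ne', ← sub_mul,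
    ← mul_sub, mul_div_cancel_right₀ _ Real.pi_ne_zero] at hcard
  linarith [mul_le_mul_of_nonneg_left hlt.le hk0.le]

end Line

/-! ### Exhausting the zeros -/

section OrdinaryZeros

variable {g : ℂ → ℂ} {z : ℂ}

theorem I_mem_arc : Complex.I ∈ arc :=
  ⟨Real.pi / 2, ⟨by linarith [Real.pi_pos], le_rfl⟩, by
    push_cast
    exact Complex.exp_pi_div_two_mul_I.symm⟩

theorem re_one_add_rho : ((1 : ℂ) + ρ).re = 1 / 2 := by
  norm_num [ρ]

theorem im_one_add_rho : ((1 : ℂ) + ρ).im = √3 / 2 := by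
  norm_num [ρ]

theorem one_add_rho_mem_lineRho : (1 : ℂ) + ρ ∈ lineRho :=
  mem_lineRho_iff.mpr ⟨re_one_add_rho, im_one_add_rho.ge⟩

theorem mem_ordinaryZeros_and_mem_arc_diff_lineRho (h0 : g z = 0) (him : 0 < z.im)
    (hn : ‖z‖ = 1) (hre : 0 < z.re) (hre' : z.re < 1 / 2) :
    z ∈ ordinaryZeros g ∧ z ∈ arc \ lineRho := by
  have hfund : z ∈ fundDomain :=
    mem_fundDomain_iff.mpr ⟨him, hn.ge, ⟨by linarith, hre'.le⟩, fun _ => hre.le⟩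
  have hline : z ∉ lineRho := fun h => hre'.ne (mem_lineRho_iff.mp h).1
  refine ⟨⟨hfund, h0, ?_, fun h => hline (h ▸ one_add_rho_mem_lineRho)⟩,
    mem_arc_of_norm_eq_one hfund hn, hline⟩
  rintro rfl
  exact hre.ne' Complex.I_re

theorem mem_ordinaryZeros_and_mem_lineRho (h0 : g z = 0) (hre : z.re = 1 / 2)
    (him : √3 / 2 < z.im) : z ∈ ordinaryZeros g ∧ z ∈ lineRho := by
  have hline : z ∈ lineRho := mem_lineRho_iff.mpr ⟨hre, him.le⟩
  refine ⟨⟨lineRho_subset_fundDomain hline, h0, ?_, ?_⟩, hline⟩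
  · rintro rfl
    norm_num at hre
  · rintro rfl
    exact him.ne' im_one_add_rho

theorem mem_ordinaryZeros_of_mem_nearCurve {α ε : ℝ} (hz : z ∈ nearCurve α ε) (h0 : g z = 0) :
    z ∈ ordinaryZeros g ∧ z ∉ arc ∪ lineRho :=
  have hoff : z ∉ arc ∪ lineRho := fun h => hz.1.2 (.inl h)
  ⟨⟨hz.1.1, h0, fun h => hoff (.inl (h ▸ I_mem_arc)),
    fun h => hoff (.inr (h ▸ one_add_rho_mem_lineRho))⟩, hoff⟩

end OrdinaryZeros

theorem zeroCount_bounds {k : ℤ} {f : CuspForm 𝒮ℒ k} (hf : f ≠ 0) (hk : 0 ≤ k) {α ε : ℝ}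
    {A N L : Finset ℂ}
    (hA : ∀ z ∈ A, z ∈ ordinaryZeros (f ∘ ofComplex) ∧ z ∈ arc \ lineRho)
    (hN : ∀ z ∈ N, z ∈ nearCurve α ε ∧ (f ∘ ofComplex) z = 0)
    (hL : ∀ z ∈ L, z ∈ ordinaryZeros (f ∘ ofComplex) ∧ z ∈ lineRho) :
    (N.card : ℝ) ≤ zeroCount (f ∘ ofComplex) (nearCurve α ε) ∧
    (zeroCount (f ∘ ofComplex) ((fundDomain \ (arc ∪ lineRho)) \ nearCurve α ε) : ℝ) ≤
      3 * (k / 12 - A.card - N.card - L.card) ∧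
    (L.card : ℝ) ≤ zeroCount (f ∘ ofComplex) lineRho ∧
    (zeroCount (f ∘ ofComplex) lineRho : ℝ) ≤
      L.card + 3 * (k / 12 - A.card - N.card - L.card) := by
  classical
  have hN' (z) (hz : z ∈ N) := mem_ordinaryZeros_of_mem_nearCurve (hN z hz).1 (hN z hz).2
  have hAN : Disjoint A N :=
    Finset.disjoint_left.mpr fun z hz hz' => (hN' z hz').2 (.inl (hA z hz).2.1)
  have hANL : Disjoint (A ∪ N) L := Finset.disjoint_union_left.mpr
    ⟨Finset.disjoint_left.mpr fun z hz hz' => (hA z hz).2.2 (hL z hz').2,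
      Finset.disjoint_left.mpr fun z hz hz' => (hN' z hz).2 (.inr (hL z hz').2)⟩
  have hord : ∀ z ∈ A ∪ N, z ∈ ordinaryZeros (f ∘ ofComplex) ∧ z ∉ lineRho := fun z hz =>
    (Finset.mem_union.mp hz).elim (fun h => ⟨(hA z h).1, (hA z h).2.2⟩)
      fun h => ⟨(hN' z h).1, fun h' => (hN' z h).2 (.inr h')⟩
  have hrest : ∀ z ∈ A ∪ N ∪ L, z ∈ ordinaryZeros (f ∘ ofComplex) ∧
      z ∉ (fundDomain \ (arc ∪ lineRho)) \ nearCurve α ε := by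
    intro z hz
    rcases Finset.mem_union.mp hz with hz | hz
    · refine ⟨(hord z hz).1, fun h => ?_⟩
      exact (Finset.mem_union.mp hz).elim (fun hzA => h.1.2 (.inl (hA z hzA).2.1))
        fun hzN => h.2 (hN z hzN).1
    · exact ⟨(hL z hz).1, fun h => h.1.2 (.inr (hL z hz).2)⟩
  have hcountRest := zeroCount_le hf hk (fun z hz => hz.1.1) hrest (W := ∅) (by simp)
  have hcountLine := zeroCount_le hf hk lineRho_subset_fundDomain hord hL
  rw [Finset.card_union_of_disjoint hANL, Finset.card_union_of_disjoint hAN, Finset.card_empty,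
    Nat.cast_zero, zero_add, sub_zero] at hcountRest
  rw [Finset.card_union_of_disjoint hAN] at hcountLine
  push_cast at hcountRest hcountLine
  exact ⟨by exact_mod_cast card_le_zeroCount hf hk (fun z hz => hz.1.1) hN, by linarith,
    by exact_mod_cast card_le_zeroCount hf hk lineRho_subset_fundDomain fun z hz =>
      ⟨(hL z hz).2, (hL z hz).1.2.1⟩, by linarith⟩

theorem curveProportion_add_rhoProportion (α T : ℝ) :
    curveProportion α T + rhoProportion α T / 12 = α := by
  rw [curveProportion, rhoProportion]
  ring

theorem eqOn_poincare_poincareForm {k m : ℕ} (hk : 3 ≤ k) (hm : m ≠ 0) :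
    Set.EqOn (poincare k m) (poincareForm hk hm ∘ ofComplex) {z | 0 < z.im} := fun z hz => by
  rw [Function.comp_apply, ofComplex_apply_of_im_pos hz]
  rfl

theorem zeroCount_poincare_bounds {k m : ℕ} (hk : 3 ≤ k) (hm : m ≠ 0)
    (hf : poincareForm hk hm ≠ 0) {α ε : ℝ} {A N L : Finset ℂ}
    (hA : ∀ z ∈ A, poincare k m z = 0 ∧ 0 < z.im ∧ ‖z‖ = 1 ∧ 0 < z.re ∧ z.re < 1 / 2)
    (hN : ∀ z ∈ N, z ∈ nearCurve α ε ∧ poincare k m z = 0)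
    (hL : ∀ z ∈ L, poincare k m z = 0 ∧ z.re = 1 / 2 ∧ √3 / 2 < z.im) :
    (N.card : ℝ) ≤ zeroCount (poincare k m) (nearCurve α ε) ∧
    (zeroCount (poincare k m) ((fundDomain \ (arc ∪ lineRho)) \ nearCurve α ε) : ℝ) ≤
      3 * (k / 12 - A.card - N.card - L.card) ∧
    (L.card : ℝ) ≤ zeroCount (poincare k m) lineRho ∧
    (zeroCount (poincare k m) lineRho : ℝ) ≤
      L.card + 3 * (k / 12 - A.card - N.card - L.card) := by
  have heq := eqOn_poincare_poincareForm hk hm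
  have hzero {z : ℂ} (him : 0 < z.im) (h0 : poincare k m z = 0) :
      (poincareForm hk hm ∘ ofComplex) z = 0 := (heq him).symm.trans h0
  have hcongr {S : Set ℂ} (hS : S ⊆ fundDomain) :=
    zeroCount_congr isOpen_upperHalfPlaneSet heq fun z hz => im_pos_of_mem_fundDomain (hS hz)
  have hbounds := zeroCount_bounds hf (Int.natCast_nonneg k)
    (fun z hz => have ⟨h0, him, hn, hre, hre'⟩ := hA z hz
      mem_ordinaryZeros_and_mem_arc_diff_lineRho (hzero him h0) him hn hre hre')
    (fun z hz => ⟨(hN z hz).1, hzero (im_pos_of_mem_fundDomain (hN z hz).1.1.1) (hN z hz).2⟩)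
    (fun z hz => have ⟨h0, hre, him⟩ := hL z hz
      mem_ordinaryZeros_and_mem_lineRho (hzero (lt_trans (by positivity) him) h0) hre him)
  rwa [Int.cast_natCast, ← hcongr (fun z hz => hz.1.1), ← hcongr (fun z hz => hz.1.1),
    ← hcongr lineRho_subset_fundDomain] at hbounds

theorem finite_zeros_poincare {k m : ℕ} (hk : 3 ≤ k) (hm : m ≠ 0) (hf : poincareForm hk hm ≠ 0) :
    {z ∈ fundDomain | poincare k m z = 0}.Finite :=
  (finite_zeros hf (Int.natCast_nonneg k)).subset fun _ hz =>
    ⟨hz.1, (eqOn_poincare_poincareForm hk hm (im_pos_of_mem_fundDomain hz.1)).symm.trans hz.2⟩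

theorem eventually_zeroCount_bounds {α T ε ε' : ℝ} (hα₀ : 0 < α) (hα₁ : α < 1 / (4 * Real.pi))
    (hT : √3 / 2 < T) (hTα : heightFun T = α) (hε : 0 < ε) (hε' : 0 < ε') :
    ∀ᶠ p in proportional α, {z ∈ fundDomain | poincare p.1 p.2 z = 0}.Finite ∧
      (curveProportion α T - ε') * p.1 ≤ zeroCount (poincare p.1 p.2) (nearCurve α ε) ∧
      zeroCount (poincare p.1 p.2) ((fundDomain \ (arc ∪ lineRho)) \ nearCurve α ε) ≤
        ε' * p.1 ∧
      |zeroCount (poincare p.1 p.2) lineRho - rhoProportion α T * ((p.1 : ℝ) / 12)| ≤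
        ε' * p.1 := by
  obtain ⟨κ, hκ, hle⟩ := exists_proportional_le_subcritical hα₁
  obtain ⟨η, hη, rfl⟩ : ∃ η, 0 < η ∧ 21 * η = ε' := ⟨ε' / 21, by positivity, by ring⟩
  filter_upwards [hle (eventually_exists_zeros_arc hκ hη),
    eventually_exists_zeros_nearCurve hα₀ hα₁ hT hTα hε hη,
    eventually_exists_zeros_lineRho hα₁ hT hTα hη, eventually_poincareForm_ne_zero hα₁,
    (tendsto_fst_proportional α).eventually_ge_atTop 3,
    (tendsto_natCast_fst_proportional α).eventually_ge_atTop (2 / η),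
    (tendsto_div_proportional α).eventually_const_lt hα₀,
    (tendsto_div_proportional α).eventually_lt_const (lt_add_of_pos_right α hη)]
    with ⟨k, m⟩ ⟨A, hA, hcardA⟩ ⟨N, hN, hcardN⟩ ⟨L, hL, hcardL⟩ hne hk hkη hm hmη
  have hm0 : m ≠ 0 := by
    rintro rfl
    simp at hm
  obtain ⟨hnear, hrest, hline, hline'⟩ :=
    zeroCount_poincare_bounds hk hm0 (hne hk hm0) hA hN hL
  rw [div_le_iff₀' hη] at hkη
  rw [div_lt_iff₀ (by exact_mod_cast (by omega : 0 < k))] at hmη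
  have hsum : curveProportion α T * k + rhoProportion α T / 12 * k = α * k := by
    rw [← add_mul, curveProportion_add_rhoProportion]
  have hrem : (k / 12 - A.card - N.card - L.card : ℝ) ≤ 7 * (η * k) := by linarith
  refine ⟨finite_zeros_poincare hk hm0 (hne hk hm0), by linarith,
    hrest.trans (by linarith only [hrem]), ?_⟩
  exact abs_le.mpr ⟨by linarith, by linarith⟩

theorem tendsto_prodMk_proportional {ι : Type*} {l : Filter ι} {k m : ι → ℕ} {α : ℝ}
    (hev : ∀ j, Even (k j)) (hk : Tendsto k l atTop)
    (hm : (fun j => (m j : ℝ) - α * k j) =o[l] fun j => (k j : ℝ)) :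
    Tendsto (fun j => (k j, m j)) l (proportional α) := by
  refine tendsto_inf.mpr ⟨tendsto_inf.mpr ⟨tendsto_comap_iff.mpr hk,
    tendsto_principal.mpr (.of_forall hev)⟩, tendsto_comap_iff.mpr ?_⟩
  have hlim := hm.tendsto_div_nhds_zero.add_const α
  rw [zero_add] at hlim
  refine hlim.congr' ((hk.eventually_ne_atTop 0).mono fun j hj => ?_)
  have hj0 : (k j : ℝ) ≠ 0 := by exact_mod_cast hj
  rw [sub_div, mul_div_cancel_right₀ _ hj0, sub_add_cancel]
  rfl

theorem exists_isLittleO_lt {ι : Type*} {l : Filter ι} {f g : ι → ℝ} {C : ℝ}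
    (hg : Tendsto g l atTop) (h : ∀ c, 0 < c → ∀ᶠ j in l, (C - c) * g j ≤ f j) :
    ∃ e : ι → ℝ, e =o[l] g ∧ ∀ j, C * g j + e j < f j := by
  refine ⟨fun j => min 0 (f j - C * g j) - 1, IsLittleO.of_bound fun c hc => ?_, fun j => ?_⟩
  · filter_upwards [h (c / 2) (half_pos hc), hg.eventually_ge_atTop (2 / c),
      hg.eventually_ge_atTop 0] with j hj hjc hj0
    rw [div_le_iff₀ hc] at hjc
    have hmin : -(c / 2 * g j) ≤ min 0 (f j - C * g j) :=
      le_min (neg_nonpos.mpr (by positivity)) (by linarith)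
    rw [Real.norm_of_nonpos (by linarith [min_le_left 0 (f j - C * g j)]),
      Real.norm_of_nonneg hj0]
    linarith
  · linarith [min_le_right 0 (f j - C * g j)]

end PoincareZeros

theorem theorem3 (α : ℝ) (hα₀ : 0 < α) (hα₁ : α < 1 / (4 * Real.pi)) :
    ∃ C T : ℝ, 0 < C ∧
      -- `T` is the unique solution `F⁻¹(α)` of `F(t) = α` in `t > √3/2`
      (√3 / 2 < T ∧ PoincareZeros.heightFun T = α ∧
        ∀ t : ℝ, √3 / 2 < t → PoincareZeros.heightFun t = α → t = T) ∧
      ∀ k m : ℕ → ℕ, (∀ j, Even (k j)) → Tendsto k atTop atTop →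
        (fun j => (m j : ℝ) - α * k j) =o[atTop] (fun j => (k j : ℝ)) →
        -- eventually there are only finitely many zeros, so that all the counts are genuine
        (∀ᶠ j in atTop,
          {z ∈ PoincareZeros.fundDomain | PoincareZeros.poincare (k j) (m j) z = 0}.Finite) ∧
        (∀ ε : ℝ, 0 < ε →
          (∃ e : ℕ → ℝ, e =o[atTop] (fun j => (k j : ℝ)) ∧
            ∀ j, C * k j + e j <
              (PoincareZeros.zeroCount (PoincareZeros.poincare (k j) (m j))
                (PoincareZeros.nearCurve α ε) : ℝ)) ∧
          (fun j => (PoincareZeros.zeroCount (PoincareZeros.poincare (k j) (m j))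
              ((PoincareZeros.fundDomain \ (PoincareZeros.arc ∪ PoincareZeros.lineRho)) \
                PoincareZeros.nearCurve α ε) : ℝ)) =o[atTop] (fun j => (k j : ℝ))) ∧
        (fun j => (PoincareZeros.zeroCount (PoincareZeros.poincare (k j) (m j))
            PoincareZeros.lineRho : ℝ) -
              PoincareZeros.rhoProportion α T * ((k j : ℝ) / 12)) =o[atTop]
          (fun j => (k j : ℝ)) := by
  obtain ⟨T, hT, hTα⟩ := PoincareZeros.exists_heightFun_eq hα₀ hα₁
  refine ⟨PoincareZeros.curveProportion α T, T, PoincareZeros.curveProportion_pos hT hTα,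
    ⟨hT, hTα, fun t ht h => PoincareZeros.strictAntiOn_heightFun.injOn ht hT (h.trans hTα.symm)⟩,
    fun k m hev hk hm => ?_⟩
  have hbounds {ε ε' : ℝ} (hε : 0 < ε) (hε' : 0 < ε') :=
    (PoincareZeros.tendsto_prodMk_proportional hev hk hm).eventually
      (PoincareZeros.eventually_zeroCount_bounds hα₀ hα₁ hT hTα hε hε')
  refine ⟨(hbounds one_pos one_pos).mono fun j hj => hj.1, fun ε hε => ⟨?_, ?_⟩, ?_⟩
  · exact PoincareZeros.exists_isLittleO_lt (tendsto_natCast_atTop_atTop.comp hk) fun c hc =>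
      (hbounds hε hc).mono fun j hj => hj.2.1
  · refine IsLittleO.of_bound fun c hc => (hbounds hε hc).mono fun j hj => ?_
    rw [Real.norm_natCast, Real.norm_natCast]
    exact hj.2.2.1
  · refine IsLittleO.of_bound fun c hc => (hbounds one_pos hc).mono fun j hj => ?_
    rw [Real.norm_eq_abs, Real.norm_natCast]
    exact hj.2.2.2
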